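/- Let $(A,\mathfrak m)$ be an abstract local hypersurface of Krull dimension $3$, that is, a Noetherian local ring whose $\mathfrak m$-adic completion is isomorphic to $S/(f)$ for some regular local ring $S$ and some nonzero nonunit $f\in S$. Let $M$ and $N$ be finitely generated reflexive $A$-modules that are locally free on the punctured spectrum $\operatorname{Spec}A\setminus\{\mathfrak m\}$, and suppose that $\operatorname{Hom}_A(M,N)$ is a maximal Cohen–Macaulay $A$-module, i.e. it is zero or has depth $\dim A$. Write $M^*=\operatorname{Hom}_A(M,A)$ and let $\ell$ denote length. Then Hochster's theta invariant $$\theta^A(M^*,N)=\ell(\operatorname{Tor}^A_{2e+2}(M^*,N))-\ell(\operatorname{Tor}^A_{2e+1}(M^*,N)),\qquad e\in\mathbb{N},\ 2e\ge\dim A,$$ is well defined (both lengths are finite and the difference does not depend on $e$), and $$\theta^A(M^*,N)\le 0.$$ Moreover, $\theta^A(M^*,N)=0$ if and only if $M$ is free or $N$ is free. -/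

import Mathlib

universe u

open IsLocalRing CategoryTheory

noncomputable section

/-- An abstract (local) hypersurface: a Noetherian local ring whose completion at the maximal ideal
is isomorphic to `S ⧸ (f)` for a regular local ring `S` and a nonzero nonunit `f` of `S`. (A regular
local ring `A` is included: take `S = Â⟦X⟧` and `f = X`.) -/
def IsAbstractHypersurface (A : Type u) [CommRing A] [IsLocalRing A] : Prop :=
  IsNoetherianRing A ∧
    ∃ (S : Type u) (_ : CommRing S) (_ : IsRegularLocalRing S) (f : S),
      f ≠ 0 ∧ ¬ IsUnit f ∧
        Nonempty (AdicCompletion (maximalIdeal A) A ≃+* S ⧸ Ideal.span {f})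

/-- The depth of a module over a local ring: the supremum of the lengths of the regular
sequences on `M` contained in the maximal ideal. -/
def localDepth (A : Type u) [CommRing A] [IsLocalRing A]
    (M : Type u) [AddCommGroup M] [Module A M] : ℕ∞ :=
  ⨆ (rs : List A) (_ : ∀ r ∈ rs, r ∈ maximalIdeal A)
    (_ : RingTheory.Sequence.IsRegular M rs), (rs.length : ℕ∞)

/-- Maximal Cohen–Macaulay modules: finitely generated, and of depth `dim A` unless zero
(the zero module counts as maximal Cohen–Macaulay). -/
def IsMaximalCohenMacaulay (A : Type u) [CommRing A] [IsLocalRing A]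
    (M : Type u) [AddCommGroup M] [Module A M] : Prop :=
  Module.Finite A M ∧
    (Subsingleton M ∨ (localDepth A M : WithBot ℕ∞) = ringKrullDim A)

/-- `M` is locally free on `Spec A ∖ {𝔪}`: `M_𝔭` is a free `A_𝔭`-module for every prime `𝔭 ≠ 𝔪`. -/
def IsLocallyFreeOnPuncturedSpectrum (A : Type u) [CommRing A] [IsLocalRing A]
    (M : Type u) [AddCommGroup M] [Module A M] : Prop :=
  {closedPoint A}ᶜ ⊆ Module.freeLocus A M

/-- The length of `Tor_i^A(M, N)`. -/
def torLength (A : Type u) [CommRing A] (M N : Type u) [AddCommGroup M] [Module A M]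
    [AddCommGroup N] [Module A N] (i : ℕ) : ℕ∞ :=
  Module.length A (((Tor (ModuleCat.{u} A) i).obj (ModuleCat.of A M)).obj (ModuleCat.of A N))

/-- Hochster's theta invariant `θ^A(M, N)` is defined and equal to the integer `t`: for every `e`
with `2e ≥ dim A` the modules `Tor_{2e+2}^A(M, N)` and `Tor_{2e+1}^A(M, N)` have finite length, and
the difference of their lengths is `t`. -/
def HasHochsterTheta (A : Type u) [CommRing A] (M N : Type u) [AddCommGroup M] [Module A M]
    [AddCommGroup N] [Module A N] (t : ℤ) : Prop :=
  ∀ e : ℕ, ringKrullDim A ≤ ((2 * e : ℕ) : WithBot ℕ∞) →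
    ∃ p q : ℕ, torLength A M N (2 * e + 2) = p ∧ torLength A M N (2 * e + 1) = q ∧
      t = (p : ℤ) - (q : ℤ)

end

/-! Lengths of Tor, freeness and the consequences of the hypotheses used below all pass to the
completion, so the ring becomes R = S/(f) with S regular local of dimension 4. Depth is then
measured by projective dimension over S: maximal depth corresponds to projective dimension at most 1
(`ProjDimLT S _ 2`), and a finite module of projective dimension less than 4 that is killed by a
power of the maximal ideal vanishes (`IsRegularLocalRing.subsingleton_of_projDimLT`).

Take minimal free covers, F of M and R^c of N, with kernels L and Y. Reflexive modules are second
syzygies, hence of projective dimension at most 2 over S; so L and Y have projective dimension at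
most 1 and are cokernels of matrix factorizations of f. The factorization for Y makes the resolution
of N periodic after its first step, with matrices φ and ψ, and theta becomes the difference of the
lengths of ker φ/im ψ and ker ψ/im φ on powers of M*. It is additive, and it vanishes on free
modules and, the dimension being positive, on modules of finite length. Dualizing 0 → L → F → M → 0
leaves the cokernel Ext¹(M,R), of finite length, so θ(M*,N) = -θ(L*,N).

For the sign: Ext¹(M,N) is the cokernel of Hom(F,N) → Hom(L,N). It has finite length, and maximal
depth of Hom(M,N) pushes its projective dimension below 4, so it is zero
(`IsHypersurfaceQuotient.range_resKer_eq_top`). A cycle for the odd Tor of L* and N induces a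
homomorphism L → N, and extending that to F yields a null-homotopy of the cycle
(`IsExactPair.torZero_dual`). Hence the odd Tor vanishes and θ(L*,N) is a length.

If theta is zero, the even Tor vanishes too. For Tor-independent modules of maximal depth the tensor
product has projective dimension at most 1 over S and is killed by f, so a minimal presentation has
as many relations as generators. For reduced factorizations of sizes p and n it has pn generators
and 2pn relations, whence pn = 0 (`eq_zero_or_eq_zero_of_torZero`). So L* or Y is free. If L* is
free, so is L; as L lies in 𝔪F, extending homomorphisms L → N forces L = 0 or N = 𝔪N = 0. If Y is
free and N ≠ 0, Nakayama turns Ext¹(M,N) = 0 into Ext¹(M,R) = 0, so M* has maximal depth, and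
counting generators and relations in 0 → (M*)^s → (M*)^c → Hom(M,N) → 0 gives s = 0 or M* = 0. -/

set_option linter.unusedSectionVars false
set_option linter.style.haveILetI false

open Module

/-! ### Regular local rings -/

namespace IsRegularLocalRing

open RingTheory.Sequence
open scoped Pointwise

variable {S : Type u} [CommRing S]

/-- If `x ∈ 𝔪 ∖ 𝔪²`, then the maximal ideal modulo `x` needs one generator less. -/
lemma maximalIdeal_le_span_insert_of_notMem_sq [IsLocalRing S] {n : ℕ} (y : Fin (n + 1) → S)
    (hy : Ideal.span (Set.range y) = maximalIdeal S) {x : S} (hx : x ∈ maximalIdeal S)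
    (hx2 : x ∉ maximalIdeal S ^ 2) :
    ∃ z : Fin n → S, (∀ i, z i ∈ maximalIdeal S) ∧
      maximalIdeal S ≤ Ideal.span {x} ⊔ Ideal.span (Set.range z) := by
  have hx' := hx
  rw [← hy, Ideal.mem_span_range_iff_exists_fun] at hx'
  obtain ⟨c, hc⟩ := hx'
  have hym : ∀ i, y i ∈ maximalIdeal S := fun i => hy ▸ Ideal.subset_span ⟨i, rfl⟩
  obtain ⟨i, hi⟩ : ∃ i, IsUnit (c i) := by
    by_contra! h
    apply hx2
    rw [← hc, pow_two]
    exact Ideal.sum_mem _ fun i _ => Ideal.mul_mem_mul ((mem_maximalIdeal _).2 (h i)) (hym i)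
  refine ⟨fun j => y (i.succAbove j), fun j => hym _, ?_⟩
  rw [← hy, Ideal.span_le]
  rintro _ ⟨j, rfl⟩
  set J := Ideal.span {x} ⊔ Ideal.span (Set.range fun j => y (i.succAbove j))
  have hne : ∀ j, y (i.succAbove j) ∈ J := fun j =>
    Ideal.mem_sup_right (Ideal.subset_span ⟨j, rfl⟩)
  rcases eq_or_ne j i with rfl | hj
  · have hmem : c j * y j ∈ J := by
      rw [Fin.sum_univ_succAbove _ j] at hc
      rw [eq_sub_of_add_eq hc]
      exact J.sub_mem (Ideal.mem_sup_left (Ideal.mem_span_singleton_self x))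
        (J.sum_mem fun k _ => J.mul_mem_left _ (hne k))
    exact (Ideal.unit_mul_mem_iff_mem J hi).1 hmem
  · obtain ⟨k, rfl⟩ := Fin.exists_succAbove_eq hj
    exact hne k

lemma exists_fin_span_eq_maximalIdeal [IsLocalRing S] [IsNoetherianRing S] {d : ℕ}
    (hd : (maximalIdeal S).spanFinrank = d) :
    ∃ y : Fin d → S, Ideal.span (Set.range y) = maximalIdeal S := by
  obtain ⟨s, hs, hspan⟩ :=
    Submodule.FG.exists_span_finset_card_eq_spanFinrank (maximalIdeal S).fg_of_isNoetherianRing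
  rw [← hd, ← hs]
  refine ⟨fun i => (s.equivFin.symm i : S), ?_⟩
  rw [Set.range_comp' Subtype.val (s.equivFin.symm), Set.range_eq_univ.2 (Equiv.surjective _)]
  simpa using hspan

/-- A quotient of a regular local ring by an element of `𝔪 ∖ 𝔪²` is regular, of embedding
dimension one less. -/
lemma quotient_span_singleton [IsRegularLocalRing S] {d : ℕ}
    (hd : (maximalIdeal S).spanFinrank = d + 1) {x : S} (hx : x ∈ maximalIdeal S)
    (hx2 : x ∉ maximalIdeal S ^ 2) :
    ∃ _ : IsRegularLocalRing (S ⧸ Ideal.span {x}),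
      (maximalIdeal (S ⧸ Ideal.span {x})).spanFinrank = d := by
  have hne : Ideal.span {x} ≠ ⊤ := by
    rw [Ne, Ideal.span_singleton_eq_top]; exact (mem_maximalIdeal _).1 hx
  have : Nontrivial (S ⧸ Ideal.span {x}) := Ideal.Quotient.nontrivial_iff.2 hne
  have hloc : IsLocalRing (S ⧸ Ideal.span {x}) :=
    IsLocalRing.of_surjective' _ Ideal.Quotient.mk_surjective
  have hdim : ringKrullDim S ≤ ringKrullDim (S ⧸ Ideal.span {x}) + 1 := by
    have h : Ideal.span {x} = x • (⊤ : Ideal S) := by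
      simp [← Submodule.ideal_span_singleton_smul]
    rw [h]
    exact ringKrullDim_le_ringKrullDim_quotSMulTop_succ hx
  have hS := IsRegularLocalRing.spanFinrank_maximalIdeal (R := S)
  rw [hd] at hS
  have hle : (maximalIdeal (S ⧸ Ideal.span {x})).spanFinrank ≤ d := by
    obtain ⟨y, hy⟩ := exists_fin_span_eq_maximalIdeal hd
    obtain ⟨z, hzm, hz⟩ := maximalIdeal_le_span_insert_of_notMem_sq y hy hx hx2
    have hmap : maximalIdeal (S ⧸ Ideal.span {x}) =
        Ideal.span (Set.range fun i => Ideal.Quotient.mk (Ideal.span {x}) (z i)) := by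
      apply le_antisymm
      · intro a ha
        obtain ⟨b, rfl⟩ := Ideal.Quotient.mk_surjective a
        have hb : b ∈ maximalIdeal S := by
          rw [mem_maximalIdeal, mem_nonunits_iff] at ha ⊢
          exact fun h => ha (h.map _)
        have := Ideal.mem_map_of_mem (Ideal.Quotient.mk (Ideal.span {x})) (hz hb)
        rw [Ideal.map_sup, Ideal.map_span, Ideal.map_span, Set.image_singleton,
          Ideal.Quotient.eq_zero_iff_mem.2 (Ideal.mem_span_singleton_self x),
          ← Set.range_comp, Ideal.span_singleton_zero, bot_sup_eq] at this
        exact this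
      · rw [Ideal.span_le]
        rintro _ ⟨i, rfl⟩
        have : IsLocalHom (Ideal.Quotient.mk (Ideal.span {x})) :=
          IsLocalHom.of_surjective _ Ideal.Quotient.mk_surjective
        exact (mem_maximalIdeal _).2 fun h =>
          (mem_maximalIdeal _).1 (hzm i) (isUnit_of_map_unit _ _ h)
    rw [hmap]
    refine (Submodule.spanFinrank_span_le_ncard_of_finite (Set.finite_range _)).trans ?_
    rw [← Set.image_univ]
    exact (Set.ncard_image_le Set.finite_univ).trans (by simp)
  have hge : ((d : ℕ) : WithBot ℕ∞) ≤ ringKrullDim (S ⧸ Ideal.span {x}) := by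
    rw [← hS] at hdim
    push_cast at hdim
    exact (ENat.WithBot.add_le_add_one_right_iff).1 hdim
  have hreg : IsRegularLocalRing (S ⧸ Ideal.span {x}) :=
    of_spanFinrank_maximalIdeal_le _ (le_trans (by exact_mod_cast hle) hge)
  refine ⟨hreg, le_antisymm hle ?_⟩
  have := hreg.spanFinrank_maximalIdeal
  rw [← this] at hge
  exact_mod_cast hge

/-- In a regular local ring of positive dimension some element of `𝔪 ∖ 𝔪²` avoids all minimal
primes. -/
lemma exists_notMem_sq_notMem_minimalPrimes [IsRegularLocalRing S]
    (hd : (maximalIdeal S).spanFinrank ≠ 0) :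
    ∃ x ∈ maximalIdeal S, x ∉ maximalIdeal S ^ 2 ∧ ∀ p ∈ minimalPrimes S, x ∉ p := by
  classical
  have hfin := minimalPrimes.finite_of_isNoetherianRing S
  by_contra! h
  let s : Finset (Ideal S) := insert (maximalIdeal S ^ 2) hfin.toFinset
  have hsub : (maximalIdeal S : Set S) ⊆ ⋃ i ∈ (s : Set (Ideal S)), (i : Set S) := by
    intro x hx
    by_cases hx2 : x ∈ maximalIdeal S ^ 2
    · exact Set.mem_biUnion (x := maximalIdeal S ^ 2) (by simp [s]) hx2
    · obtain ⟨p, hp, hxp⟩ := h x hx hx2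
      exact Set.mem_biUnion (x := p) (by simp [s, hp]) hxp
  -- Prime avoidance tolerates two ideals that are not prime; 𝔪² fills both exceptional slots.
  obtain ⟨i, hi, hmi⟩ := (Ideal.subset_union_prime (f := fun i : Ideal S => i)
    (maximalIdeal S ^ 2) (maximalIdeal S ^ 2) (fun i hi h1 _ => by
      simp only [s, Finset.mem_insert, Set.Finite.mem_toFinset] at hi
      exact (hi.resolve_left h1).1.1)).1 hsub
  simp only [s, Finset.mem_insert, Set.Finite.mem_toFinset] at hi
  have hS := IsRegularLocalRing.spanFinrank_maximalIdeal (R := S)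
  rcases hi with rfl | hi
  · apply hd
    have : maximalIdeal S = ⊥ := by
      apply Submodule.eq_bot_of_le_smul_of_le_jacobson_bot (maximalIdeal S) _
        (maximalIdeal S).fg_of_isNoetherianRing _ (maximalIdeal_le_jacobson _)
      simpa [pow_two] using hmi
    rw [this]; simp
  · have hi' : i.IsPrime := hi.1.1
    have heq : maximalIdeal S = i := le_antisymm hmi (le_maximalIdeal hi'.ne_top)
    rw [← IsLocalRing.maximalIdeal_height_eq_ringKrullDim, heq,
      (Ideal.height_eq_zero_iff).2 hi, ← heq] at hS
    apply hd
    exact_mod_cast hS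

/-- A regular local ring is a domain, and its maximal ideal is generated by a regular sequence. -/
theorem isDomain_and_exists_isWeaklyRegular (d : ℕ) (S : Type u) [CommRing S]
    [IsRegularLocalRing S] (hd : (maximalIdeal S).spanFinrank = d) :
    IsDomain S ∧ ∃ rs : List S, IsWeaklyRegular S rs ∧ Ideal.ofList rs = maximalIdeal S ∧
      rs.length = d := by
  induction d generalizing S with
  | zero =>
    have hbot : maximalIdeal S = ⊥ := by
      rwa [Submodule.spanFinrank_eq_zero_iff_eq_bot
        (maximalIdeal S).fg_of_isNoetherianRing] at hd
    have hf : IsField S := (isField_iff_maximalIdeal_eq).2 hbot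
    exact ⟨hf.isDomain, [], IsWeaklyRegular.nil _ _, by simp [hbot], rfl⟩
  | succ d ih =>
    obtain ⟨x, hx, hx2, hxp⟩ := exists_notMem_sq_notMem_minimalPrimes (S := S) (by omega)
    obtain ⟨hreg, hd'⟩ := quotient_span_singleton hd hx hx2
    obtain ⟨hdom, rs, hrs, hspan, hlen⟩ := ih (S ⧸ Ideal.span {x}) hd'
    have hprime : (Ideal.span {x}).IsPrime := (Ideal.Quotient.isDomain_iff_prime _).1 hdom
    obtain ⟨q, hq, hqx⟩ := Ideal.exists_minimalPrimes_le (I := (⊥ : Ideal S))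
      (J := Ideal.span {x}) bot_le
    have hqp : q.IsPrime := hq.1.1
    have hxq : x ∉ q := hxp q hq
    -- Since q ⊆ (x) and x ∉ q, every element of q is x times an element of q; Nakayama applies.
    have hq0 : q = ⊥ := by
      apply Submodule.eq_bot_of_le_smul_of_le_jacobson_bot (maximalIdeal S) _
        q.fg_of_isNoetherianRing _ (maximalIdeal_le_jacobson _)
      intro a ha
      obtain ⟨b, rfl⟩ := Ideal.mem_span_singleton'.1 (hqx ha)
      rw [mul_comm]
      exact Submodule.smul_mem_smul hx ((hqp.mem_or_mem ha).resolve_right hxq)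
    have hSd : IsDomain S := by
      rw [hq0] at hqp
      exact (IsDomain.of_bot_isPrime S)
    refine ⟨hSd, ?_⟩
    obtain ⟨rs', rfl⟩ : ∃ rs' : List S, rs'.map (Ideal.Quotient.mk (Ideal.span {x})) = rs :=
      List.map_surjective_iff.2 Ideal.Quotient.mk_surjective rs
    have hx0 : x ≠ 0 := fun h => hxq (h ▸ q.zero_mem)
    refine ⟨x :: rs', ?_, ?_, by simpa using hlen⟩
    · rw [isWeaklyRegular_cons_iff]
      refine ⟨IsSMulRegular.of_ne_zero hx0, ?_⟩
      have h1 := (isWeaklyRegular_map_algebraMap_iff (S ⧸ Ideal.span {x})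
        (S ⧸ Ideal.span {x}) rs').1 hrs
      have h : Ideal.span {x} = x • (⊤ : Ideal S) := by
        simp [← Submodule.ideal_span_singleton_smul]
      exact ((Submodule.quotEquivOfEq _ _ h).isWeaklyRegular_congr rs').1 h1
    · have := congrArg (Ideal.comap (Ideal.Quotient.mk (Ideal.span {x}))) hspan
      rw [← Ideal.map_ofList, Ideal.comap_map_of_surjective _ Ideal.Quotient.mk_surjective,
        ← RingHom.ker_eq_comap_bot, Ideal.mk_ker] at this
      rw [Ideal.ofList_cons, sup_comm, this]
      have : IsLocalHom (Ideal.Quotient.mk (Ideal.span {x})) :=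
          IsLocalHom.of_surjective _ Ideal.Quotient.mk_surjective
      exact ((IsLocalRing.local_hom_TFAE (Ideal.Quotient.mk (Ideal.span {x}))).out 0 4).1 this

end IsRegularLocalRing

/-! ### Projective dimension of modules over a local ring -/

namespace Module

open RingTheory.Sequence
open scoped Pointwise

/-- The module `Z` has projective dimension less than `n`. -/
def ProjDimLT (S : Type u) [CommRing S] (Z : Type u) [AddCommGroup Z] [Module S Z] (n : ℕ) : Prop :=
  HasProjectiveDimensionLT (ModuleCat.of S Z) n

namespace ProjDimLT

variable {S : Type u} [CommRing S] {Z Z₁ Z₂ Z₃ : Type u} [AddCommGroup Z] [Module S Z]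
  [AddCommGroup Z₁] [Module S Z₁] [AddCommGroup Z₂] [Module S Z₂] [AddCommGroup Z₃] [Module S Z₃]

lemma mono {n m : ℕ} (h : ProjDimLT S Z n) (hnm : n ≤ m) : ProjDimLT S Z m :=
  have : HasProjectiveDimensionLT (ModuleCat.of S Z) n := h
  hasProjectiveDimensionLT_of_ge _ n m hnm

lemma of_equiv {n : ℕ} (h : ProjDimLT S Z₁ n) (e : Z₁ ≃ₗ[S] Z₂) : ProjDimLT S Z₂ n :=
  have : HasProjectiveDimensionLT (ModuleCat.of S Z₁) n := h
  hasProjectiveDimensionLT_of_iso e.toModuleIso n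

lemma one_iff : ProjDimLT S Z 1 ↔ Module.Projective S Z := by
  rw [ProjDimLT, ← projective_iff_hasProjectiveDimensionLT_one]
  exact (IsProjective.iff_projective (R := S) Z).symm

lemma of_subsingleton [Subsingleton Z] (n : ℕ) : ProjDimLT S Z n :=
  mono (n := 0) ((hasProjectiveDimensionLT_zero_iff_isZero _).2
    ((ModuleCat.isZero_iff_subsingleton).2 ‹_›)) (Nat.zero_le n)

section exact

variable {f : Z₁ →ₗ[S] Z₂} {g : Z₂ →ₗ[S] Z₃} (hf : Function.Injective f)
  (hfg : Function.Exact f g) (hg : Function.Surjective g)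

include hf hfg hg

lemma shortExact : (ShortComplex.mk (ModuleCat.ofHom f) (ModuleCat.ofHom g)
    (by rw [← ModuleCat.ofHom_comp, hfg.linearMap_comp_eq_zero]; rfl)).ShortExact where
  exact := (ShortComplex.ShortExact.moduleCat_exact_iff_function_exact _).2 hfg
  mono_f := (ModuleCat.mono_iff_injective _).2 hf
  epi_g := (ModuleCat.epi_iff_surjective _).2 hg

lemma left {n : ℕ} (h₂ : ProjDimLT S Z₂ n) (h₃ : ProjDimLT S Z₃ (n + 1)) : ProjDimLT S Z₁ n :=
  (shortExact hf hfg hg).hasProjectiveDimensionLT_X₁ n h₂ h₃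

lemma middle {n : ℕ} (h₁ : ProjDimLT S Z₁ n) (h₃ : ProjDimLT S Z₃ n) : ProjDimLT S Z₂ n :=
  (shortExact hf hfg hg).hasProjectiveDimensionLT_X₂ n h₁ h₃

lemma right {n : ℕ} (h₁ : ProjDimLT S Z₁ n) (h₂ : ProjDimLT S Z₂ (n + 1)) :
    ProjDimLT S Z₃ (n + 1) :=
  (shortExact hf hfg hg).hasProjectiveDimensionLT_X₃ n h₁ h₂

end exact

lemma pi {n : ℕ} (h : ProjDimLT S Z n) (k : ℕ) : ProjDimLT S (Fin k → Z) n := by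
  induction k with
  | zero => exact of_subsingleton n
  | succ k ih =>
    refine middle (f := LinearMap.single S (fun _ : Fin (k + 1) => Z) 0)
      (g := LinearMap.funLeft S Z Fin.succ) (fun a b h => by simpa using congrFun h 0) ?_
      (LinearMap.funLeft_surjective_of_injective _ _ _ (Fin.succ_injective k)) h ih
    intro v
    constructor
    · intro hv
      refine ⟨v 0, ?_⟩
      ext i
      refine Fin.cases ?_ (fun j => ?_) i
      · simp
      · have := congrFun hv j
        simp only [LinearMap.funLeft_apply, Pi.zero_apply] at this
        simp [this]
    · rintro ⟨z, rfl⟩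
      ext j
      simp [LinearMap.funLeft_apply]

lemma lt_iff {n : ℕ} : ProjDimLT S Z n ↔ projectiveDimension (ModuleCat.of S Z) < n :=
  projectiveDimension_lt_iff.symm

section local_ring

variable [IsLocalRing S] [IsNoetherianRing S]

/-- Each member of the sequence raises the projective dimension by exactly one. The form with a
strict bound also covers infinite projective dimension and the zero module. -/
lemma add_length_iff [Module.Finite S Z] {rs : List S} (reg : IsWeaklyRegular Z rs)
    (hrs : ∀ r ∈ rs, r ∈ maximalIdeal S) {n : ℕ} :
    ProjDimLT S (Z ⧸ Ideal.ofList rs • (⊤ : Submodule S Z)) (n + rs.length) ↔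
      ProjDimLT S Z n := by
  rcases subsingleton_or_nontrivial Z with hZ | hZ
  · exact ⟨fun _ => of_subsingleton _, fun _ => of_subsingleton _⟩
  have : Nontrivial (ModuleCat.of S Z) := hZ
  have h := ModuleCat.projectiveDimension_quotient_eq_add_length_of_isWeaklyRegular (ModuleCat.of S Z) rs
    reg hrs
  rw [lt_iff, lt_iff]
  change projectiveDimension (ModuleCat.of S (Z ⧸ Ideal.ofList rs • (⊤ : Submodule S Z))) = _ at h
  rw [h]
  push_cast
  generalize projectiveDimension (ModuleCat.of S Z) = a
  generalize rs.length = l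
  induction a with
  | bot => simp
  | coe a =>
    induction a with
    | top =>
      refine iff_of_false (fun h => ?_) (by simp)
      have h2 : ((⊤ : ℕ∞) : WithBot ℕ∞) + (l : WithBot ℕ∞) = ((⊤ : ℕ∞) : WithBot ℕ∞) := by
        norm_cast
      rw [h2] at h
      exact not_top_lt h
    | coe a => norm_cast; simp

end local_ring

end ProjDimLT

end Module

/-- A syzygy gains one element of a weakly regular sequence. -/
lemma RingTheory.Sequence.IsWeaklyRegular.syzygy {S : Type u} [CommRing S]
    {K F Z : Type*} [AddCommGroup K] [Module S K] [AddCommGroup F] [Module S F]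
    [AddCommGroup Z] [Module S Z] {f : K →ₗ[S] F} {g : F →ₗ[S] Z}
    (hf : Function.Injective f) (hfg : Function.Exact f g) (hg : Function.Surjective g)
    (rs : List S) (r : S) (hF : IsWeaklyRegular F (rs ++ [r])) (hZ : IsWeaklyRegular Z rs) :
    IsWeaklyRegular K (rs ++ [r]) := by
  induction rs generalizing K F Z with
  | nil =>
    simp only [List.nil_append, isWeaklyRegular_singleton_iff] at hF ⊢
    exact hF.of_injective f hf
  | cons x rs ih =>
    rw [List.cons_append, isWeaklyRegular_cons_iff] at hF ⊢
    rw [isWeaklyRegular_cons_iff] at hZ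
    refine ⟨hF.1.of_injective f hf, ?_⟩
    have h0 : Function.Exact (0 : K →ₗ[S] K) f := by
      rw [LinearMap.exact_zero_iff_injective]; exact hf
    -- Regularity of x on Z keeps K/xK → F/xF injective, so the induction can continue modulo x.
    have h1 := QuotSMulTop.map_first_exact_on_four_term_exact_of_isSMulRegular_last h0 hfg hZ.1
    rw [map_zero, LinearMap.exact_zero_iff_injective] at h1
    exact ih h1 (QuotSMulTop.map_exact x hfg hg) (QuotSMulTop.map_surjective x hg) hF.2 hZ.2

/-! ### Global dimension of regular local rings -/

namespace IsRegularLocalRing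

open RingTheory.Sequence Module Function

variable {S : Type u} [CommRing S] [IsRegularLocalRing S]

instance (priority := low) isDomain : IsDomain S :=
  (isDomain_and_exists_isWeaklyRegular _ S rfl).1

variable {d : ℕ} (hd : (maximalIdeal S).spanFinrank = d)

include hd

lemma exists_isWeaklyRegular : ∃ rs : List S, IsWeaklyRegular S rs ∧
    Ideal.ofList rs = maximalIdeal S ∧ rs.length = d :=
  (isDomain_and_exists_isWeaklyRegular d S hd).2

/-- The residue field is S modulo a weakly regular sequence of length d, so its projective dimension
is d more than that of S. -/
lemma projDimLT_residueField_iff {n : ℕ} :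
    ProjDimLT S (ResidueField S) n ↔ d < n := by
  obtain ⟨rs, hrs, hm, hlen⟩ := exists_isWeaklyRegular hd
  have hmem : ∀ r ∈ rs, r ∈ maximalIdeal S := fun r hr => hm ▸ Ideal.subset_span hr
  have e : (S ⧸ Ideal.ofList rs • (⊤ : Submodule S S)) ≃ₗ[S] ResidueField S :=
    Submodule.quotEquivOfEq _ _ (by rw [hm]; simp)
  rcases le_or_gt d n with hn | hn
  · obtain ⟨m, rfl⟩ := Nat.exists_eq_add_of_le' hn
    have h := ProjDimLT.add_length_iff (Z := S) hrs hmem (n := m)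
    rw [hlen] at h
    have : ProjDimLT S (ResidueField S) (m + d) ↔
      ProjDimLT S (S ⧸ Ideal.ofList rs • (⊤ : Submodule S S)) (m + d) :=
      ⟨fun h => h.of_equiv e.symm, fun h => h.of_equiv e⟩
    rw [this, h]
    rcases m with _ | m
    · simp only [zero_add, lt_irrefl, iff_false]
      intro h
      have := (hasProjectiveDimensionLT_zero_iff_isZero _).1 h
      exact not_subsingleton S (ModuleCat.isZero_iff_subsingleton.1 this)
    · exact iff_of_true ((ProjDimLT.one_iff.2 inferInstance).mono (by omega)) (by omega)
  · refine iff_of_false (fun h => ?_) (by omega)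
    have h := (h.mono hn.le).of_equiv e.symm
    rw [← hlen] at h
    have h := (ProjDimLT.add_length_iff hrs hmem (n := 0)).1 (by simpa using h)
    have := (hasProjectiveDimensionLT_zero_iff_isZero _).1 h
    exact not_subsingleton S (ModuleCat.isZero_iff_subsingleton.1 this)

lemma projDimLT_quotient_maximalIdeal_smul_top (Z : Type u) [AddCommGroup Z] [Module S Z]
    [Module.Finite S Z] :
    ProjDimLT S (Z ⧸ maximalIdeal S • (⊤ : Submodule S Z)) (d + 1) := by
  let _ : Field (S ⧸ maximalIdeal S) := Ideal.Quotient.field _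
  have : Module.Finite (S ⧸ maximalIdeal S) (Z ⧸ maximalIdeal S • (⊤ : Submodule S Z)) :=
    Module.Finite.of_restrictScalars_finite S _ _
  let b := Module.finBasis (S ⧸ maximalIdeal S) (Z ⧸ maximalIdeal S • (⊤ : Submodule S Z))
  have h : ProjDimLT S (S ⧸ maximalIdeal S) (d + 1) :=
    (projDimLT_residueField_iff hd).2 (Nat.lt_succ_self d)
  exact (h.pi _).of_equiv (b.equivFun.symm.restrictScalars S)

/-- The global dimension of a regular local ring is at most its embedding dimension. -/
theorem projDimLT_succ (Z : Type u) [AddCommGroup Z] [Module S Z] [Module.Finite S Z] :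
    ProjDimLT S Z (d + 1) := by
  obtain ⟨rs, hrs, hm, hlen⟩ := exists_isWeaklyRegular hd
  have hmem : ∀ r ∈ rs, r ∈ maximalIdeal S := fun r hr => hm ▸ Ideal.subset_span hr
  -- Induction on the missing depth: if the first d - j members of the sequence are weakly regular
  -- on Z, then Z has projective dimension at most j, because a syzygy gains one member. For j = 0
  -- the quotient of Z by the whole sequence is a vector space over the residue field.
  suffices H : ∀ j, j ≤ d → ∀ (Z : Type u) [AddCommGroup Z] [Module S Z] [Module.Finite S Z],
      IsWeaklyRegular Z (rs.take (d - j)) → ProjDimLT S Z (j + 1) from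
    H d le_rfl Z (by simp)
  intro j
  induction j with
  | zero =>
    intro _ Z _ _ _ hZ
    rw [Nat.sub_zero, ← hlen, List.take_length] at hZ
    rw [← ProjDimLT.add_length_iff hZ hmem, hlen, hm, add_comm, zero_add]
    exact projDimLT_quotient_maximalIdeal_smul_top hd Z
  | succ j ih =>
    intro hj Z _ _ _ hZ
    obtain ⟨n, g, hg⟩ := Module.Finite.exists_fin' S Z
    have hlt : d - (j + 1) < rs.length := by omega
    have htake : rs.take (d - j) = rs.take (d - (j + 1)) ++ [rs[d - (j + 1)]] := by
      rw [show d - j = d - (j + 1) + 1 by omega, List.take_succ_eq_append_getElem hlt]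
    have hF : IsWeaklyRegular (Fin n → S) (rs.take (d - j)) := by
      have h1 := ((TensorProduct.rid S (Fin n → S)).isWeaklyRegular_congr rs).1
        (hrs.isWeaklyRegular_lTensor (M₂ := Fin n → S))
      rw [← List.take_append_drop (d - j) rs, isWeaklyRegular_append_iff] at h1
      exact h1.1
    have hK := ih (by omega) (LinearMap.ker g) (by
      rw [htake] at hF ⊢
      exact IsWeaklyRegular.syzygy (Submodule.injective_subtype _)
        (LinearMap.exact_subtype_ker_map g) hg _ _ hF hZ)
    exact ProjDimLT.right (Submodule.injective_subtype _)
        (LinearMap.exact_subtype_ker_map g) hg hK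
        ((ProjDimLT.one_iff.2 inferInstance).mono (by omega))

/-- A socle element embeds the residue field k into Z. The quotient has projective dimension at most
d, so a bound below d for Z would pass to k, whose projective dimension is d. -/
lemma not_projDimLT_of_smul_eq_zero {Z : Type u} [AddCommGroup Z] [Module S Z]
    [Module.Finite S Z] {z : Z} (hz : z ≠ 0) (hmz : ∀ r ∈ maximalIdeal S, r • z = 0) :
    ¬ ProjDimLT S Z d := by
  intro h
  let f : (S ⧸ maximalIdeal S) →ₗ[S] Z :=
    Submodule.liftQ (maximalIdeal S) (LinearMap.toSpanSingleton S Z z) fun r hr => hmz r hr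
  have hf : Function.Injective f := by
    rw [← LinearMap.ker_eq_bot]
    refine Submodule.ker_liftQ_eq_bot _ _ _ ?_
    intro r hr
    by_contra hr'
    obtain ⟨u, rfl⟩ : IsUnit r := by_contra fun h => hr' h
    apply hz
    exact (u.isUnit.smul_eq_zero).1 hr
  have hk : ProjDimLT S (S ⧸ maximalIdeal S) d :=
    ProjDimLT.left hf (LinearMap.exact_map_mkQ_range f) (Submodule.mkQ_surjective _) h
      (projDimLT_succ hd _)
  exact lt_irrefl _ ((projDimLT_residueField_iff hd).1 hk)

/-- A nonzero module killed by a power of the maximal ideal has maximal projective dimension. -/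
theorem subsingleton_of_projDimLT {Z : Type u} [AddCommGroup Z] [Module S Z]
    [Module.Finite S Z] (h : ProjDimLT S Z d) {k : ℕ}
    (hk : ∀ r ∈ maximalIdeal S ^ k, ∀ z : Z, r • z = 0) : Subsingleton Z := by
  by_contra hZ
  rw [not_subsingleton_iff_nontrivial] at hZ
  have hex : ∃ k, ∀ r ∈ maximalIdeal S ^ k, ∀ z : Z, r • z = 0 := ⟨k, hk⟩
  classical
  have hmin := Nat.find_spec hex
  rcases hj : Nat.find hex with _ | j
  · obtain ⟨z, hz⟩ := exists_ne (0 : Z)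
    rw [hj] at hmin
    exact hz (by simpa using hmin 1 (by simp) z)
  · have hnot := Nat.find_min hex (m := j) (by omega)
    push Not at hnot
    obtain ⟨r, hr, z, hz⟩ := hnot
    rw [hj] at hmin
    refine not_projDimLT_of_smul_eq_zero hd hz (fun s hs => ?_) h
    rw [smul_smul]
    exact hmin _ (by rw [pow_succ']; exact Ideal.mul_mem_mul hs hr) z

end IsRegularLocalRing

/-! ### Minimal covers -/

/-- The relations of a minimal set of generators have no unit coefficients. -/
lemma IsLocalRing.mem_maximalIdeal_of_minimal {R : Type*} [CommRing R] [IsLocalRing R] {Z : Type*}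
    [AddCommGroup Z] [Module R Z] {n : ℕ} (π : (Fin n → R) →ₗ[R] Z) (hπ : Function.Surjective π)
    (hmin : ∀ (c : ℕ) (ρ : (Fin c → R) →ₗ[R] Z), Function.Surjective ρ → n ≤ c)
    (v : Fin n → R) (hv : π v = 0) (i : Fin n) : v i ∈ maximalIdeal R := by
  by_contra hi
  obtain _ | c := n
  · exact i.elim0
  have hu : IsUnit (v i) := by_contra fun h => hi h
  obtain ⟨w, hw⟩ := hu.exists_left_inv
  let ρ : (Fin c → R) →ₗ[R] Z := Fintype.linearCombination R fun j => π (Pi.single (i.succAbove j) 1)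
  -- A unit coefficient expresses the i-th generator through the others, so one generator can be
  -- dropped.
  suffices hρ : Function.Surjective ρ by have := hmin c ρ hρ; omega
  rw [← LinearMap.range_eq_top, eq_top_iff, ← LinearMap.range_eq_top.2 hπ]
  have hne : ∀ j, π (Pi.single (i.succAbove j) 1) ∈ LinearMap.range ρ := fun j =>
    ⟨Pi.single j 1, by simp [ρ]⟩
  have hdec : ∀ x : Fin (c + 1) → R, π x = x i • π (Pi.single i 1) +
      ∑ j, x (i.succAbove j) • π (Pi.single (i.succAbove j) 1) := fun x => by
    conv_lhs => rw [pi_eq_sum_univ' x]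
    rw [map_sum, Fin.sum_univ_succAbove _ i]
    congr 1
    · rw [← map_smul]
    · refine Finset.sum_congr rfl fun j _ => ?_
      rw [← map_smul]
  have hi1 : π (Pi.single i 1) ∈ LinearMap.range ρ := by
    have h1 := hdec v
    rw [hv] at h1
    have h2 : π (Pi.single i 1) =
        -(w • ∑ j, v (i.succAbove j) • π (Pi.single (i.succAbove j) 1)) := by
      rw [← smul_neg, ← eq_neg_of_add_eq_zero_left h1.symm, smul_smul, hw, one_smul]
    rw [h2]
    exact Submodule.neg_mem _ (Submodule.smul_mem _ _ (Submodule.sum_mem _ fun j _ =>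
      Submodule.smul_mem _ _ (hne j)))
  rintro _ ⟨x, rfl⟩
  rw [hdec x]
  exact Submodule.add_mem _ (Submodule.smul_mem _ _ hi1) (Submodule.sum_mem _ fun j _ =>
      Submodule.smul_mem _ _ (hne j))

/-- A finitely generated module over a local ring has a minimal cover by a free module. -/
lemma IsLocalRing.exists_minimal_cover (R : Type*) [CommRing R] [IsLocalRing R] (Z : Type*)
    [AddCommGroup Z] [Module R Z] [Module.Finite R Z] :
    ∃ (n : ℕ) (π : (Fin n → R) →ₗ[R] Z), Function.Surjective π ∧
      (∀ v, π v = 0 → ∀ i, v i ∈ maximalIdeal R) ∧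
      ∀ (c : ℕ) (ρ : (Fin c → R) →ₗ[R] Z), Function.Surjective ρ → n ≤ c := by
  classical
  have hex : ∃ n, ∃ π : (Fin n → R) →ₗ[R] Z, Function.Surjective π :=
    Module.Finite.exists_fin' R Z
  obtain ⟨π, hπ⟩ := Nat.find_spec hex
  have hmin : ∀ (c : ℕ) (ρ : (Fin c → R) →ₗ[R] Z), Function.Surjective ρ → Nat.find hex ≤ c :=
    fun c ρ hρ => Nat.find_min' hex ⟨ρ, hρ⟩
  exact ⟨_, π, hπ, mem_maximalIdeal_of_minimal π hπ hmin, hmin⟩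

/-! ### Matrix factorizations -/

/-- `R` is the quotient of the regular local ring `S` by the nonzero nonunit `f`. -/
structure IsHypersurfaceQuotient (S R : Type u) [CommRing S] [CommRing R] [Algebra S R]
    (f : S) : Prop where
  isRegularLocalRing : IsRegularLocalRing S
  surjective : Function.Surjective (algebraMap S R)
  algebraMap_eq_zero_iff : ∀ s, algebraMap S R s = 0 ↔ f ∣ s
  ne_zero : f ≠ 0
  not_isUnit : ¬ IsUnit f

/-- `(Φ, Ψ)` is a matrix factorization of `f`. -/
structure IsMatrixFactorization {S : Type u} [CommRing S] (f : S) {n : ℕ}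
    (Φ Ψ : Matrix (Fin n) (Fin n) S) : Prop where
  mul_eq : Φ * Ψ = f • 1
  mul_eq' : Ψ * Φ = f • 1

namespace IsMatrixFactorization

variable {S : Type u} [CommRing S] {f : S} {n : ℕ} {Φ Ψ : Matrix (Fin n) (Fin n) S}

lemma swap (h : IsMatrixFactorization f Φ Ψ) : IsMatrixFactorization f Ψ Φ :=
  ⟨h.mul_eq', h.mul_eq⟩

lemma transpose (h : IsMatrixFactorization f Φ Ψ) :
    IsMatrixFactorization f Φ.transpose Ψ.transpose := by
  constructor
  · rw [← Matrix.transpose_mul, h.mul_eq', Matrix.transpose_smul, Matrix.transpose_one]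
  · rw [← Matrix.transpose_mul, h.mul_eq, Matrix.transpose_smul, Matrix.transpose_one]

lemma mulVec_injective [IsDomain S] (hf : f ≠ 0) (h : IsMatrixFactorization f Φ Ψ)
    {v : Fin n → S} (hv : Φ.mulVec v = 0) : v = 0 := by
  have := congrArg Ψ.mulVec hv
  rw [Matrix.mulVec_mulVec, h.mul_eq', Matrix.smul_mulVec, Matrix.one_mulVec,
    Matrix.mulVec_zero] at this
  exact (smul_eq_zero.1 this).resolve_left hf

end IsMatrixFactorization

/-! ### Modules of projective dimension at most one killed by f -/

section rank

variable {S : Type u} [CommRing S] [IsLocalRing S] [IsNoetherianRing S] [IsDomain S]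
  {Z : Type u} [AddCommGroup Z] [Module S Z]

/-- A module of projective dimension at most one killed by `f ≠ 0` has as many relations as
generators. -/
lemma card_eq_of_projDimLT_two {f : S} (hf : f ≠ 0) (hfZ : ∀ z : Z, f • z = 0)
    (hZ : ProjDimLT S Z 2) {ι κ : Type} [Fintype ι] [Fintype κ] (π : (ι → S) →ₗ[S] Z)
    (hπ : Function.Surjective π) (Θ : (κ → S) →ₗ[S] (ι → S)) (hΘ : Function.Exact Θ π)
    (hker : ∀ v, Θ v = 0 → ∀ i, v i ∈ maximalIdeal S) :
    Fintype.card κ = Fintype.card ι := by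
  classical
  have hK : Module.Projective S (LinearMap.ker π) := ProjDimLT.one_iff.1 <|
    ProjDimLT.left (Submodule.injective_subtype _) (LinearMap.exact_subtype_ker_map π) hπ
      (ProjDimLT.one_iff.2 inferInstance) hZ
  let Θ' : (κ → S) →ₗ[S] LinearMap.ker π := Θ.codRestrict _ fun v => hΘ.apply_apply_eq_zero v
  have hΘ' : Function.Surjective Θ' := by
    rintro ⟨x, hx⟩
    obtain ⟨v, rfl⟩ := (hΘ x).1 hx
    exact ⟨v, rfl⟩
  obtain ⟨σ, hσ⟩ := Module.projective_lifting_property Θ' LinearMap.id hΘ'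
  have hσ' : ∀ x, Θ' (σ x) = x := fun x => LinearMap.congr_fun hσ x
  -- The splitting σ puts e_i - σ(Θe_i) into ker Θ, and each q in ker Θ is the sum of the q_i (e_i -
  -- σ(Θe_i)). As all q_i lie in 𝔪, this gives ker Θ ⊆ 𝔪 ker Θ.
  have hinj : LinearMap.ker Θ = ⊥ := by
    apply Submodule.eq_bot_of_le_smul_of_le_jacobson_bot (maximalIdeal S) _
      (IsNoetherian.noetherian _) _ (maximalIdeal_le_jacobson _)
    intro q hq
    have hq' : q = ∑ i, q i • ((Pi.single i 1 : κ → S) - σ (Θ' (Pi.single i 1))) := by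
      have h1 : Θ' q = 0 := Subtype.ext hq
      have h2 : q = ∑ i, q i • (Pi.single i 1 : κ → S) := by
        conv_lhs => rw [pi_eq_sum_univ' q]
      conv_lhs => rw [← sub_zero q, ← map_zero σ, ← h1, h2]
      simp only [map_sum, map_smul, smul_sub, Finset.sum_sub_distrib]
    rw [hq']
    refine Submodule.sum_mem _ fun i _ => Submodule.smul_mem_smul (hker q hq i) ?_
    rw [LinearMap.mem_ker, map_sub, sub_eq_zero]
    exact (congrArg Subtype.val (hσ' (Θ' (Pi.single i 1)))).symm
  have h1 : Fintype.card κ ≤ Fintype.card ι := by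
    simpa using LinearMap.finrank_le_finrank_of_injective (LinearMap.ker_eq_bot.1 hinj)
  -- Multiplication by f embeds S^ι into ker π, and σ embeds ker π into S^κ.
  have h2 : Fintype.card ι ≤ Fintype.card κ := by
    let F : (ι → S) →ₗ[S] LinearMap.ker π := (f • LinearMap.id).codRestrict _ fun v => by
      simp [hfZ]
    have hF : Function.Injective (σ ∘ₗ F) := by
      rw [LinearMap.coe_comp]
      refine (Function.LeftInverse.injective hσ').comp ?_
      intro a b hab
      have := congrArg Subtype.val hab
      exact smul_right_injective _ hf this
    simpa using LinearMap.finrank_le_finrank_of_injective hF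
  exact le_antisymm h1 h2

/-- A module of projective dimension at most one killed by `f ≠ 0` is the cokernel of a matrix
factorization of minimal size. -/
theorem exists_isMatrixFactorization {f : S} (hf : f ≠ 0) (hfZ : ∀ z : Z, f • z = 0)
    [Module.Finite S Z] (hZ : ProjDimLT S Z 2) :
    ∃ (n : ℕ) (Φ Ψ : Matrix (Fin n) (Fin n) S) (π : (Fin n → S) →ₗ[S] Z),
      IsMatrixFactorization f Φ Ψ ∧ Function.Surjective π ∧ Function.Exact Φ.mulVecLin π ∧
      (∀ i j, Φ i j ∈ maximalIdeal S) ∧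
      ∀ (c : ℕ) (ρ : (Fin c → S) →ₗ[S] Z), Function.Surjective ρ → n ≤ c := by
  obtain ⟨n, π, hπ, hker, hmin⟩ := IsLocalRing.exists_minimal_cover S Z
  have hK : Module.Projective S (LinearMap.ker π) := ProjDimLT.one_iff.1 <|
    ProjDimLT.left (Submodule.injective_subtype _) (LinearMap.exact_subtype_ker_map π) hπ
      (ProjDimLT.one_iff.2 inferInstance) hZ
  have hfree : Module.Free S (LinearMap.ker π) := Module.free_of_flat_of_isLocalRing
  let F : (Fin n → S) →ₗ[S] LinearMap.ker π := (f • LinearMap.id).codRestrict _ fun v => by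
      simp [hfZ]
  have hF : Function.Injective F := by
    intro a b hab
    exact smul_right_injective _ hf (congrArg Subtype.val hab)
  have hrank : finrank S (LinearMap.ker π) = n := by
    apply le_antisymm
    · simpa using LinearMap.finrank_le_finrank_of_injective
        (Submodule.injective_subtype (LinearMap.ker π))
    · simpa using LinearMap.finrank_le_finrank_of_injective hF
  let e : LinearMap.ker π ≃ₗ[S] (Fin n → S) := (finBasisOfFinrankEq S _ hrank).equivFun
  -- φ is the inclusion of the relations and ψ is multiplication by f regarded as a map into them;
  -- both composites are f.
  let φ : (Fin n → S) →ₗ[S] (Fin n → S) := (LinearMap.ker π).subtype ∘ₗ e.symm.toLinearMap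
  let ψ : (Fin n → S) →ₗ[S] (Fin n → S) := e.toLinearMap ∘ₗ F
  have hφ : Function.Injective φ :=
    (Submodule.injective_subtype _).comp e.symm.injective
  have h1 : φ ∘ₗ ψ = f • LinearMap.id := by
    ext i j; simp [φ, ψ, F]
  have h2 : ψ ∘ₗ φ = f • LinearMap.id := by
    apply LinearMap.ext
    intro v
    apply hφ
    have := LinearMap.congr_fun h1 (φ v)
    simpa using this
  refine ⟨n, LinearMap.toMatrix' φ, LinearMap.toMatrix' ψ, π, ⟨?_, ?_⟩, hπ, ?_, ?_, hmin⟩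
  · rw [← LinearMap.toMatrix'_comp, h1, map_smul, LinearMap.toMatrix'_id]
  · rw [← LinearMap.toMatrix'_comp, h2, map_smul, LinearMap.toMatrix'_id]
  · rw [← Matrix.toLin'_apply', Matrix.toLin'_toMatrix']
    intro x
    constructor
    · intro hx
      exact ⟨e ⟨x, hx⟩, by simp [φ]⟩
    · rintro ⟨v, rfl⟩
      exact (e.symm v).2
  · intro i j
    rw [LinearMap.toMatrix'_apply]
    exact hker _ ((e.symm _).2) i

end rank

/-! ### Homology of a pair of composable linear maps -/

namespace LinearMap

variable {R : Type*} [CommRing R] {U V W : Type*} [AddCommGroup U] [Module R U]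
  [AddCommGroup V] [Module R V] [AddCommGroup W] [Module R W]

/-- The homology `ker g / (ker g ∩ im f)` of a pair of composable maps. -/
abbrev Homology (f : U →ₗ[R] V) (g : V →ₗ[R] W) : Type _ :=
  ker g ⧸ (range f).comap (ker g).subtype

namespace Homology

variable {f : U →ₗ[R] V} {g : V →ₗ[R] W}

/-- Homology is computed by any model of the kernel and of the quotient. -/
lemma nonempty_equiv {K H : Type*} [AddCommGroup K] [Module R K] [AddCommGroup H] [Module R H]
    {k : K →ₗ[R] V} {q : K →ₗ[R] H} (hk : Function.Injective k) (hkg : Function.Exact k g)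
    (hq : Function.Surjective q) (hfq : ∀ x, q x = 0 ↔ k x ∈ range f) :
    Nonempty (H ≃ₗ[R] Homology f g) := by
  let e : K ≃ₗ[R] ker g := (LinearEquiv.ofInjective k hk).trans
    (LinearEquiv.ofEq _ _ hkg.linearMap_ker_eq.symm)
  let r : K →ₗ[R] Homology f g := Submodule.mkQ _ ∘ₗ e.toLinearMap
  have hr : Function.Surjective r := (Submodule.mkQ_surjective _).comp e.surjective
  have hker : ker q = ker r := by
    ext x
    rw [mem_ker, hfq]
    simp only [r, mem_ker, coe_comp, Function.comp_apply, Submodule.mkQ_apply,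
      Submodule.Quotient.mk_eq_zero, Submodule.mem_comap]
    rfl
  exact ⟨(q.quotKerEquivOfSurjective hq).symm.trans
    ((Submodule.quotEquivOfEq _ _ hker).trans (r.quotKerEquivOfSurjective hr))⟩

lemma length_eq_of_equiv {U' V' W' : Type*} [AddCommGroup U'] [Module R U']
    [AddCommGroup V'] [Module R V'] [AddCommGroup W'] [Module R W']
    {f' : U' →ₗ[R] V'} {g' : V' →ₗ[R] W'} (e : V ≃ₗ[R] V') (hg : ∀ v, g v = 0 ↔ g' (e v) = 0)
    (hf : ∀ v, v ∈ range f ↔ e v ∈ range f') :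
    Module.length R (Homology f g) = Module.length R (Homology f' g') := by
  obtain ⟨E⟩ := nonempty_equiv (f := f') (g := g') (k := e.toLinearMap ∘ₗ (ker g).subtype)
    (q := ((range f).comap (ker g).subtype).mkQ)
    (e.injective.comp (Submodule.injective_subtype _)) (fun v => by
      rw [← e.apply_symm_apply v, ← hg]
      constructor
      · intro h; exact ⟨⟨_, h⟩, rfl⟩
      · rintro ⟨x, hx⟩
        rw [← e.injective hx]; exact x.2) (Submodule.mkQ_surjective _) (fun x => by
      rw [Submodule.mkQ_apply, Submodule.Quotient.mk_eq_zero, Submodule.mem_comap]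
      exact hf _)
  exact E.length_eq

lemma subsingleton_iff : Subsingleton (Homology f g) ↔ ∀ v, g v = 0 → v ∈ range f := by
  rw [Submodule.Quotient.subsingleton_iff, eq_top_iff]
  exact ⟨fun h v hv => h (x := ⟨v, hv⟩) trivial, fun h v _ => h v.1 v.2⟩

lemma smul_eq_zero {a : R} (h : ∀ v, g v = 0 → a • v ∈ range f) (x : Homology f g) :
    a • x = 0 := by
  obtain ⟨v, rfl⟩ := Submodule.mkQ_surjective _ x
  rw [← map_smul, Submodule.mkQ_apply, Submodule.Quotient.mk_eq_zero]
  exact h v.1 v.2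

variable {U' V' W' : Type*} [AddCommGroup U'] [Module R U'] [AddCommGroup V'] [Module R V']
  [AddCommGroup W'] [Module R W'] {f' : U' →ₗ[R] V'} {g' : V' →ₗ[R] W'}

def map (t : V →ₗ[R] V') (hg : ∀ v, g v = 0 → g' (t v) = 0)
    (hf : ∀ v ∈ range f, t v ∈ range f') : Homology f g →ₗ[R] Homology f' g' :=
  Submodule.mapQ _ _ (t.restrict hg) fun v hv => hf v.1 hv

end Homology

/-! ### The exact hexagon of a short exact sequence of 2-periodic complexes -/

section herbrand

variable {U₁ U₂ U₃ : Type*} [AddCommGroup U₁] [Module R U₁] [AddCommGroup U₂] [Module R U₂]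
  [AddCommGroup U₃] [Module R U₃] {i : U₁ →ₗ[R] U₂} {p : U₂ →ₗ[R] U₃}
  {a₁ b₁ : U₁ →ₗ[R] U₁} {a₂ b₂ : U₂ →ₗ[R] U₂} {a₃ b₃ : U₃ →ₗ[R] U₃}

lemma length_range_add_length_range {A B C : Type*} [AddCommGroup A] [Module R A]
    [AddCommGroup B] [Module R B] [AddCommGroup C] [Module R C] {s : A →ₗ[R] B} {t : B →ₗ[R] C}
    (h : Function.Exact s t) :
    Module.length R B = Module.length R (range s) + Module.length R (range t) :=
  Module.length_eq_add_of_exact (range s).subtype t.rangeRestrict (Submodule.injective_subtype _)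
    t.surjective_rangeRestrict (fun x => by
      rw [← h.linearMap_ker_eq]
      constructor
      · intro hx; exact ⟨⟨x, congrArg Subtype.val hx⟩, rfl⟩
      · rintro ⟨y, rfl⟩; exact Subtype.ext y.2)

variable (a₁ b₁) in
/-- The map `U / im b → ker b` induced by `a`; its kernel and cokernel are the two homologies. -/
def quotRangeToKer (hab : ∀ x, a₁ (b₁ x) = 0) (hba : ∀ x, b₁ (a₁ x) = 0) :
    (U₁ ⧸ range b₁) →ₗ[R] ker b₁ :=
  (range b₁).liftQ (a₁.codRestrict _ hba) (by rintro _ ⟨x, rfl⟩; exact Subtype.ext (hab x))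

variable (a₁ b₁) in
/-- The inclusion of the homology `ker a / im b` into `U / im b`. -/
def Homology.toQuotRange : Homology b₁ a₁ →ₗ[R] (U₁ ⧸ range b₁) :=
  Submodule.mapQ _ _ (ker a₁).subtype le_rfl

/-- With `exact_quotRangeToKer`, this is the part of 0 → ker a/im b → U/im b → ker b → ker b/im a →
0 that the snake lemma needs. -/
lemma exact_toQuotRange (hab : ∀ x, a₁ (b₁ x) = 0) (hba : ∀ x, b₁ (a₁ x) = 0) :
    Function.Exact (Homology.toQuotRange a₁ b₁) (quotRangeToKer a₁ b₁ hab hba) := by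
  intro x
  obtain ⟨x, rfl⟩ := Submodule.mkQ_surjective _ x
  constructor
  · intro hx
    exact ⟨Submodule.Quotient.mk ⟨x, congrArg Subtype.val hx⟩, rfl⟩
  · rintro ⟨y, hy⟩
    obtain ⟨y, rfl⟩ := Submodule.mkQ_surjective _ y
    rw [← hy]
    exact Subtype.ext y.2

lemma exact_quotRangeToKer (hab : ∀ x, a₁ (b₁ x) = 0) (hba : ∀ x, b₁ (a₁ x) = 0) :
    Function.Exact (quotRangeToKer a₁ b₁ hab hba) (((range a₁).comap (ker b₁).subtype).mkQ) := by
  intro x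
  rw [Submodule.mkQ_apply, Submodule.Quotient.mk_eq_zero]
  constructor
  · rintro ⟨y, hy⟩; exact ⟨Submodule.Quotient.mk y, Subtype.ext hy⟩
  · rintro ⟨y, hy⟩
    obtain ⟨y, rfl⟩ := Submodule.mkQ_surjective _ y
    exact ⟨y, congrArg Subtype.val hy⟩

/-- The connecting map of the exact hexagon. -/
lemma exists_connecting (hi : Function.Injective i) (hip : Function.Exact i p)
    (hp : Function.Surjective p) (ha₁ : ∀ x, i (a₁ x) = a₂ (i x)) (hb₁ : ∀ x, i (b₁ x) = b₂ (i x))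
    (ha₂ : ∀ x, p (a₂ x) = a₃ (p x)) (hb₂ : ∀ x, p (b₂ x) = b₃ (p x))
    (hab₁ : ∀ x, a₁ (b₁ x) = 0) (hab₂ : ∀ x, a₂ (b₂ x) = 0) (hab₃ : ∀ x, a₃ (b₃ x) = 0)
    (hba₁ : ∀ x, b₁ (a₁ x) = 0) (hba₂ : ∀ x, b₂ (a₂ x) = 0) (hba₃ : ∀ x, b₃ (a₃ x) = 0)
    (P : Homology b₂ a₂ →ₗ[R] Homology b₃ a₃) (I : Homology a₁ b₁ →ₗ[R] Homology a₂ b₂)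
    (hP : ∀ x : ker a₂, P (Submodule.Quotient.mk x) = Submodule.Quotient.mk
      ⟨p x, by rw [mem_ker, ← ha₂, x.2, map_zero]⟩)
    (hI : ∀ x : ker b₁, I (Submodule.Quotient.mk x) = Submodule.Quotient.mk
      ⟨i x, by rw [mem_ker, ← hb₁, x.2, map_zero]⟩) :
    ∃ δ : Homology b₃ a₃ →ₗ[R] Homology a₁ b₁, Function.Exact P δ ∧ Function.Exact δ I := by
  -- The snake lemma is applied to the right exact row of the U_i/im b_i and the left exact row of
  -- the ker b_i, joined by the maps induced by the a_i.
  let A₁ := quotRangeToKer a₁ b₁ hab₁ hba₁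
  let A₂ := quotRangeToKer a₂ b₂ hab₂ hba₂
  let A₃ := quotRangeToKer a₃ b₃ hab₃ hba₃
  let f₁ : (U₁ ⧸ range b₁) →ₗ[R] (U₂ ⧸ range b₂) := Submodule.mapQ _ _ i (by
    rintro _ ⟨x, rfl⟩; exact ⟨i x, (hb₁ x).symm⟩)
  let f₂ : (U₂ ⧸ range b₂) →ₗ[R] (U₃ ⧸ range b₃) := Submodule.mapQ _ _ p (by
    rintro _ ⟨x, rfl⟩; exact ⟨p x, (hb₂ x).symm⟩)
  let g₁ : ker b₁ →ₗ[R] ker b₂ := i.restrict fun x hx => by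
    rw [mem_ker] at hx ⊢; rw [← hb₁, hx, map_zero]
  let g₂ : ker b₂ →ₗ[R] ker b₃ := p.restrict fun x hx => by
    rw [mem_ker] at hx ⊢; rw [← hb₂, hx, map_zero]
  have hf : Function.Exact f₁ f₂ := by
    intro x
    obtain ⟨x, rfl⟩ := Submodule.mkQ_surjective _ x
    constructor
    · intro hx
      obtain ⟨y, hy⟩ := (Submodule.Quotient.mk_eq_zero _).1 hx
      obtain ⟨z, rfl⟩ := hp y
      rw [← hb₂] at hy
      obtain ⟨w, hw⟩ := (hip (x - b₂ z)).1 (by rw [map_sub, hy, sub_self])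
      refine ⟨Submodule.Quotient.mk w, ?_⟩
      change Submodule.Quotient.mk (i w) = Submodule.Quotient.mk x
      rw [Submodule.Quotient.eq, hw]
      exact ⟨-z, by simp⟩
    · rintro ⟨w, hw⟩
      obtain ⟨w, rfl⟩ := Submodule.mkQ_surjective _ w
      rw [← hw]
      change Submodule.Quotient.mk (p (i w)) = 0
      rw [hip.apply_apply_eq_zero]; rfl
  have hf₂ : Function.Surjective f₂ := by
    intro x
    obtain ⟨x, rfl⟩ := Submodule.mkQ_surjective _ x
    obtain ⟨y, rfl⟩ := hp x
    exact ⟨Submodule.Quotient.mk y, rfl⟩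
  have hg : Function.Exact g₁ g₂ := by
    intro x
    constructor
    · intro hx
      obtain ⟨w, hw⟩ := (hip x.1).1 (congrArg Subtype.val hx)
      refine ⟨⟨w, hi ?_⟩, Subtype.ext hw⟩
      rw [hb₁, hw, map_zero]; exact x.2
    · rintro ⟨w, rfl⟩
      exact Subtype.ext (hip.apply_apply_eq_zero w.1)
  have hg₁ : Function.Injective g₁ := fun x y h => Subtype.ext (hi (congrArg Subtype.val h))
  have hι₃ : Function.Injective (Homology.toQuotRange a₃ b₃) := by
    rw [← ker_eq_bot]
    exact Submodule.ker_liftQ_eq_bot _ _ _ (by intro x hx; simpa using hx)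
  have h₁ : g₁ ∘ₗ A₁ = A₂ ∘ₗ f₁ := by
    ext x; exact ha₁ x
  have h₂ : g₂ ∘ₗ A₂ = A₃ ∘ₗ f₂ := by
    ext x; exact ha₂ x
  refine ⟨SnakeLemma.δ' A₁ A₂ A₃ f₁ f₂ hf g₁ g₂ hg h₁ h₂ _ (exact_toQuotRange hab₃ hba₃)
    _ (exact_quotRangeToKer hab₁ hba₁) hf₂ hg₁, ?_, ?_⟩
  · refine SnakeLemma.exact_δ'_right A₁ A₂ A₃ f₁ f₂ hf g₁ g₂ hg h₁ h₂ _
      (exact_toQuotRange hab₂ hba₂) _ (exact_toQuotRange hab₃ hba₃) _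
      (exact_quotRangeToKer hab₁ hba₁) hf₂ hg₁ P ?_ hι₃
    refine LinearMap.ext fun x => ?_
    obtain ⟨x, rfl⟩ := Submodule.mkQ_surjective _ x
    rw [comp_apply, comp_apply, Submodule.mkQ_apply, hP]
    rfl
  · refine SnakeLemma.exact_δ'_left A₁ A₂ A₃ f₁ f₂ hf g₁ g₂ hg h₁ h₂ _
      (exact_toQuotRange hab₃ hba₃) _ (exact_quotRangeToKer hab₁ hba₁) _
      (exact_quotRangeToKer hab₂ hba₂) hf₂ hg₁ I ?_ (Submodule.mkQ_surjective _)
    refine LinearMap.ext fun x => ?_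
    rw [comp_apply, comp_apply, Submodule.mkQ_apply, hI]
    rfl

/-- The homology of a short exact sequence of 2-periodic complexes is exact in the middle. -/
lemma exact_homologyMap (hi : Function.Injective i) (hip : Function.Exact i p)
    (hp : Function.Surjective p) (ha₁ : ∀ x, i (a₁ x) = a₂ (i x))
    (hb₂ : ∀ x, p (b₂ x) = b₃ (p x)) (hab₂ : ∀ x, a₂ (b₂ x) = 0)
    (I : Homology b₁ a₁ →ₗ[R] Homology b₂ a₂) (P : Homology b₂ a₂ →ₗ[R] Homology b₃ a₃)
    (hI : ∀ x : ker a₁, ∃ h, I (Submodule.Quotient.mk x) = Submodule.Quotient.mk ⟨i x, h⟩)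
    (hP : ∀ x : ker a₂, ∃ h, P (Submodule.Quotient.mk x) = Submodule.Quotient.mk ⟨p x, h⟩) :
    Function.Exact I P := by
  intro x
  obtain ⟨x, rfl⟩ := Submodule.mkQ_surjective _ x
  obtain ⟨h, hx⟩ := hP x
  rw [Submodule.mkQ_apply, hx, Submodule.Quotient.mk_eq_zero]
  constructor
  · rintro ⟨y, hy⟩
    obtain ⟨z, rfl⟩ := hp y
    rw [← hb₂] at hy
    obtain ⟨w, hw⟩ := (hip (x.1 - b₂ z)).1 (by rw [map_sub, hy]; exact sub_self _)
    have hwa : a₁ w = 0 := hi (by rw [ha₁, hw, map_sub, hab₂, map_zero, sub_zero]; exact x.2)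
    obtain ⟨h', hI'⟩ := hI ⟨w, hwa⟩
    refine ⟨_, hI'.trans ?_⟩
    rw [Submodule.Quotient.eq]
    exact ⟨-z, by simp [hw]⟩
  · rintro ⟨w, hw⟩
    obtain ⟨w, rfl⟩ := Submodule.mkQ_surjective _ w
    obtain ⟨h', hI'⟩ := hI w
    rw [Submodule.mkQ_apply, hI', Submodule.Quotient.eq] at hw
    obtain ⟨z, hz⟩ := hw
    refine ⟨-p z, ?_⟩
    have : b₂ z = i w.1 - x.1 := hz
    rw [map_neg, ← hb₂, this, map_sub, hip.apply_apply_eq_zero, zero_sub, neg_neg]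
    rfl

/-- Additivity of the Herbrand difference along a short exact sequence of 2-periodic complexes. -/
theorem length_homology_add (hi : Function.Injective i) (hip : Function.Exact i p)
    (hp : Function.Surjective p) (ha₁ : ∀ x, i (a₁ x) = a₂ (i x)) (hb₁ : ∀ x, i (b₁ x) = b₂ (i x))
    (ha₂ : ∀ x, p (a₂ x) = a₃ (p x)) (hb₂ : ∀ x, p (b₂ x) = b₃ (p x))
    (hab₁ : ∀ x, a₁ (b₁ x) = 0) (hab₂ : ∀ x, a₂ (b₂ x) = 0) (hab₃ : ∀ x, a₃ (b₃ x) = 0)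
    (hba₁ : ∀ x, b₁ (a₁ x) = 0) (hba₂ : ∀ x, b₂ (a₂ x) = 0) (hba₃ : ∀ x, b₃ (a₃ x) = 0) :
    Module.length R (Homology b₂ a₂) + Module.length R (Homology a₁ b₁) +
        Module.length R (Homology a₃ b₃) =
      Module.length R (Homology b₁ a₁) + Module.length R (Homology b₃ a₃) +
        Module.length R (Homology a₂ b₂) := by
  have kera₁ : ∀ x, a₁ x = 0 → a₂ (i x) = 0 := fun x hx => by rw [← ha₁, hx, map_zero]
  have kerb₁ : ∀ x, b₁ x = 0 → b₂ (i x) = 0 := fun x hx => by rw [← hb₁, hx, map_zero]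
  have kera₂ : ∀ x, a₂ x = 0 → a₃ (p x) = 0 := fun x hx => by rw [← ha₂, hx, map_zero]
  have kerb₂ : ∀ x, b₂ x = 0 → b₃ (p x) = 0 := fun x hx => by rw [← hb₂, hx, map_zero]
  have rga₁ : ∀ x ∈ range a₁, i x ∈ range a₂ := by rintro _ ⟨x, rfl⟩; exact ⟨i x, (ha₁ x).symm⟩
  have rgb₁ : ∀ x ∈ range b₁, i x ∈ range b₂ := by rintro _ ⟨x, rfl⟩; exact ⟨i x, (hb₁ x).symm⟩
  have rga₂ : ∀ x ∈ range a₂, p x ∈ range a₃ := by rintro _ ⟨x, rfl⟩; exact ⟨p x, (ha₂ x).symm⟩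
  have rgb₂ : ∀ x ∈ range b₂, p x ∈ range b₃ := by rintro _ ⟨x, rfl⟩; exact ⟨p x, (hb₂ x).symm⟩
  let Ia : Homology b₁ a₁ →ₗ[R] Homology b₂ a₂ := Homology.map i kera₁ rgb₁
  let Pa : Homology b₂ a₂ →ₗ[R] Homology b₃ a₃ := Homology.map p kera₂ rgb₂
  let Ib : Homology a₁ b₁ →ₗ[R] Homology a₂ b₂ := Homology.map i kerb₁ rga₁
  let Pb : Homology a₂ b₂ →ₗ[R] Homology a₃ b₃ := Homology.map p kerb₂ rga₂
  have hIPa : Function.Exact Ia Pa := exact_homologyMap hi hip hp ha₁ hb₂ hab₂ Ia Pa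
    (fun x => ⟨kera₁ _ x.2, rfl⟩) (fun x => ⟨kera₂ _ x.2, rfl⟩)
  have hIPb : Function.Exact Ib Pb := exact_homologyMap hi hip hp hb₁ ha₂ hba₂ Ib Pb
    (fun x => ⟨kerb₁ _ x.2, rfl⟩) (fun x => ⟨kerb₂ _ x.2, rfl⟩)
  obtain ⟨δ, hδ₁, hδ₂⟩ := exists_connecting hi hip hp ha₁ hb₁ ha₂ hb₂ hab₁ hab₂ hab₃ hba₁ hba₂
    hba₃ Pa Ib (fun _ => rfl) (fun _ => rfl)
  obtain ⟨ε, hε₁, hε₂⟩ := exists_connecting hi hip hp hb₁ ha₁ hb₂ ha₂ hba₁ hba₂ hba₃ hab₁ hab₂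
    hab₃ Pb Ia (fun _ => rfl) (fun _ => rfl)
  -- Each vertex of the hexagon has as length the sum of the lengths of two adjacent images, so both
  -- alternate triples of vertices have the same total. No subtraction occurs, hence infinite
  -- lengths are allowed.
  rw [length_range_add_length_range hIPa, length_range_add_length_range hIPb,
    length_range_add_length_range hδ₁, length_range_add_length_range hδ₂,
    length_range_add_length_range hε₁, length_range_add_length_range hε₂]
  abel

end herbrand

end LinearMap

/-! ### Matrices acting on powers of a module -/

namespace Matrix

variable {R : Type*} [CommRing R] {ι κ μ : Type*} [Fintype κ] [Fintype μ]
  {X X' : Type*} [AddCommGroup X] [Module R X] [AddCommGroup X'] [Module R X']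

variable (X) in
/-- The linear map `X^κ → X^ι` given by a matrix. -/
def act (A : Matrix ι κ R) : (κ → X) →ₗ[R] (ι → X) :=
  LinearMap.pi fun i => ∑ j, A i j • LinearMap.proj j

lemma act_apply (A : Matrix ι κ R) (v : κ → X) (i : ι) : A.act X v i = ∑ j, A i j • v j := by
  simp [act]

lemma act_mul (A : Matrix ι κ R) (B : Matrix κ μ R) (v : μ → X) :
    (A * B).act X v = A.act X (B.act X v) := by
  ext i
  simp only [act_apply, mul_apply, Finset.sum_smul, Finset.smul_sum, smul_smul]
  exact Finset.sum_comm

lemma act_add (A B : Matrix ι κ R) (v : κ → X) :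
    (A + B).act X v = A.act X v + B.act X v := by
  ext i
  simp [act_apply, add_smul, Finset.sum_add_distrib]

@[simp]
lemma act_zero (v : κ → X) : (0 : Matrix ι κ R).act X v = 0 := by
  ext i; simp [act_apply]

lemma act_smul_one [DecidableEq κ] (r : R) (v : κ → X) :
    (r • (1 : Matrix κ κ R)).act X v = r • v := by
  ext i
  simp [act_apply, one_apply]

lemma act_comp (A : Matrix ι κ R) (g : X →ₗ[R] X') (v : κ → X) :
    (fun i => g (A.act X v i)) = A.act X' fun j => g (v j) := by
  ext i
  simp [act_apply, map_sum]

lemma act_eq_mulVec (A : Matrix ι κ R) (v : κ → R) : A.act R v = A.mulVec v := by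
  ext i
  simp [act_apply, mulVec, dotProduct]

/-- Matrices with columns in the range of the matrix `B` are the left multiples of `B`. -/
lemma exists_eq_mul_of_forall_col {ν : Type*} {B : Matrix ι κ R} {G : Matrix ι ν R}
    (h : ∀ j, ∃ w, (fun i => G i j) = B.mulVec w) : ∃ W : Matrix κ ν R, G = B * W := by
  choose w hw using h
  refine ⟨of fun i j => w j i, ?_⟩
  ext i j
  exact congrFun (hw j) i

end Matrix

/-- `(φ, ψ)` is a pair of square matrices giving an exact 2-periodic complex whose transpose is
exact, too. -/
structure IsExactPair {R : Type*} [CommRing R] {n : ℕ} (φ ψ : Matrix (Fin n) (Fin n) R) :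
    Prop where
  mul_eq_zero : φ * ψ = 0
  mul_eq_zero' : ψ * φ = 0
  exists_of_mulVec : ∀ v, φ.mulVec v = 0 → ∃ w, v = ψ.mulVec w
  exists_of_mulVec' : ∀ v, ψ.mulVec v = 0 → ∃ w, v = φ.mulVec w
  exists_of_transpose : ∀ v, φ.transpose.mulVec v = 0 → ∃ w, v = ψ.transpose.mulVec w
  exists_of_transpose' : ∀ v, ψ.transpose.mulVec v = 0 → ∃ w, v = φ.transpose.mulVec w

namespace IsExactPair

variable {R : Type*} [CommRing R] {n : ℕ} {φ ψ : Matrix (Fin n) (Fin n) R}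

lemma swap (h : IsExactPair φ ψ) : IsExactPair ψ φ :=
  ⟨h.mul_eq_zero', h.mul_eq_zero, h.exists_of_mulVec', h.exists_of_mulVec,
    h.exists_of_transpose', h.exists_of_transpose⟩

lemma transpose (h : IsExactPair φ ψ) : IsExactPair φ.transpose ψ.transpose :=
  ⟨by rw [← Matrix.transpose_mul, h.mul_eq_zero', Matrix.transpose_zero],
    by rw [← Matrix.transpose_mul, h.mul_eq_zero, Matrix.transpose_zero],
    h.exists_of_transpose, h.exists_of_transpose',
    by simpa using h.exists_of_mulVec, by simpa using h.exists_of_mulVec'⟩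

lemma exists_eq_mul_left {κ : Type*} (h : IsExactPair φ ψ)
    {G : Matrix (Fin n) κ R} (hG : φ * G = 0) : ∃ W : Matrix (Fin n) κ R, G = ψ * W := by
  apply Matrix.exists_eq_mul_of_forall_col
  intro j
  refine h.exists_of_mulVec _ ?_
  ext i
  exact congrFun (congrFun hG i) j

lemma exists_eq_mul_right {κ : Type*} (h : IsExactPair φ ψ)
    {G : Matrix κ (Fin n) R} (hG : G * φ = 0) : ∃ W : Matrix κ (Fin n) R, G = W * ψ := by
  obtain ⟨W, hW⟩ := h.transpose.exists_eq_mul_left (G := G.transpose)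
    (by rw [← Matrix.transpose_mul, hG, Matrix.transpose_zero])
  exact ⟨W.transpose, by rw [← Matrix.transpose_transpose G, hW, Matrix.transpose_mul, Matrix.transpose_transpose]⟩

section

variable (X : Type*) [AddCommGroup X] [Module R X]

lemma act_act (h : IsExactPair φ ψ) (v : Fin n → X) : φ.act X (ψ.act X v) = 0 := by
  rw [← Matrix.act_mul, h.mul_eq_zero, Matrix.act_zero]

end

end IsExactPair

/-- If Φw = fu over S, then Φw = Φ(Ψu), and Φ is injective because ΨΦ = f is; so w = Ψu already over
S. The transposed pair is again a matrix factorization. -/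
lemma IsMatrixFactorization.isExactPair {S R : Type u} [CommRing S] [CommRing R] [Algebra S R]
    {f : S} (hR : IsHypersurfaceQuotient S R f) {n : ℕ} {Φ Ψ : Matrix (Fin n) (Fin n) S}
    (h : IsMatrixFactorization f Φ Ψ) :
    IsExactPair (Φ.map (algebraMap S R)) (Ψ.map (algebraMap S R)) := by
  have := hR.isRegularLocalRing
  have hf0 : algebraMap S R f = 0 := (hR.algebraMap_eq_zero_iff f).2 dvd_rfl
  have key : ∀ {Φ Ψ : Matrix (Fin n) (Fin n) S}, IsMatrixFactorization f Φ Ψ →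
      Φ.map (algebraMap S R) * Ψ.map (algebraMap S R) = 0 ∧
      ∀ v, (Φ.map (algebraMap S R)).mulVec v = 0 → ∃ w, v = (Ψ.map (algebraMap S R)).mulVec w := by
    intro Φ Ψ h
    refine ⟨?_, fun v hv => ?_⟩
    · rw [← Matrix.map_mul, h.mul_eq]
      ext i j
      rcases eq_or_ne i j with rfl | hij
      · simp [hf0]
      · simp [hij]
    · choose w hw using fun i => hR.surjective (v i)
      obtain rfl : (algebraMap S R) ∘ w = v := funext hw
      have h1 : ∀ i, ∃ u, Φ.mulVec w i = f * u := fun i =>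
        (hR.algebraMap_eq_zero_iff _).1 (by
          rw [RingHom.map_mulVec]; exact congrFun hv i)
      choose u hu using h1
      have h2 : w - Ψ.mulVec u = 0 := by
        apply h.mulVec_injective hR.ne_zero
        rw [Matrix.mulVec_sub, Matrix.mulVec_mulVec, h.mul_eq, Matrix.smul_mulVec,
          Matrix.one_mulVec, sub_eq_zero]
        exact funext hu
      refine ⟨algebraMap S R ∘ u, ?_⟩
      rw [sub_eq_zero.1 h2]
      ext i
      simp [RingHom.map_mulVec]
  refine ⟨(key h).1, (key h.swap).1, (key h).2, (key h.swap).2, ?_, ?_⟩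
  · simpa only [Matrix.transpose_map] using (key h.transpose).2
  · simpa only [Matrix.transpose_map] using (key h.transpose.swap).2

/-! ### The theta invariant of an exact pair of matrices -/

/-- A finitely generated module killed by a power of the maximal ideal has finite length. -/
lemma IsLocalRing.isFiniteLength_of_pow_smul_eq_zero {R : Type*} [CommRing R] [IsLocalRing R]
    [IsNoetherianRing R] (k : ℕ) {T : Type*} [AddCommGroup T] [Module R T] [Module.Finite R T]
    (h : ∀ r ∈ maximalIdeal R ^ k, ∀ t : T, r • t = 0) : IsFiniteLength R T := by
  rw [← Module.length_ne_top_iff]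
  induction k generalizing T with
  | zero =>
    have : Subsingleton T := ⟨fun a b => by
      rw [← one_smul R a, ← one_smul R b, h 1 (by simp), h 1 (by simp)]⟩
    simp
  | succ k ih =>
    let N : Submodule R T := maximalIdeal R • ⊤
    have h1 : Module.length R N ≠ ⊤ := ih fun r hr t => by
      obtain ⟨t, ht⟩ := t
      apply Subtype.ext
      change r • t = 0
      refine Submodule.smul_induction_on ht (fun s hs x _ => ?_) (fun x y hx hy => ?_)
      · rw [smul_smul]; exact h _ (by rw [pow_succ]; exact Ideal.mul_mem_mul hr hs) x
      · rw [smul_add, hx, hy, add_zero]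
    have h2 : Module.length R (T ⧸ N) ≠ ⊤ := by
      let _ : Field (R ⧸ maximalIdeal R) := Ideal.Quotient.field _
      have : Module.Finite (R ⧸ maximalIdeal R) (T ⧸ N) :=
        Module.Finite.of_restrictScalars_finite R _ _
      rw [Module.length_eq_of_surjective (R := R ⧸ maximalIdeal R) Ideal.Quotient.mk_surjective,
        Module.length_eq_finrank]
      exact ENat.natCast_ne_top _
    rw [Module.length_eq_add_of_exact N.subtype N.mkQ (Submodule.injective_subtype _)
      (Submodule.mkQ_surjective _) (LinearMap.exact_subtype_mkQ N)]
    simp [h1, h2]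

section theta

variable {R : Type u} [CommRing R] {n : ℕ} (φ ψ : Matrix (Fin n) (Fin n) R)

/-- The homology `ker φ / im ψ` on `X^n`. -/
abbrev Matrix.PairHomology (X : Type*) [AddCommGroup X] [Module R X] : Type _ :=
  LinearMap.Homology (ψ.act X) (φ.act X)

/-- The lengths of the two homology modules of the pair are finite for all finitely generated
coefficient modules. -/
def HasFiniteHomology : Prop :=
  ∀ (X : Type u) [AddCommGroup X] [Module R X] [Module.Finite R X],
    Module.length R (Matrix.PairHomology φ ψ X) ≠ ⊤ ∧
      Module.length R (Matrix.PairHomology ψ φ X) ≠ ⊤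

/-- The difference of the lengths of the two homology modules. -/
noncomputable def pairTheta (X : Type*) [AddCommGroup X] [Module R X] : ℤ :=
  (Module.length R (Matrix.PairHomology φ ψ X)).toNat -
    (Module.length R (Matrix.PairHomology ψ φ X)).toNat

variable {φ ψ}

namespace IsExactPair

variable {X X₁ X₂ X₃ : Type u} [AddCommGroup X] [Module R X] [AddCommGroup X₁] [Module R X₁]
  [AddCommGroup X₂] [Module R X₂] [AddCommGroup X₃] [Module R X₃]

lemma length_add (h : IsExactPair φ ψ) {i : X₁ →ₗ[R] X₂} {p : X₂ →ₗ[R] X₃}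
    (hi : Function.Injective i) (hip : Function.Exact i p) (hp : Function.Surjective p) :
    Module.length R (Matrix.PairHomology φ ψ X₂) + Module.length R (Matrix.PairHomology ψ φ X₁) +
        Module.length R (Matrix.PairHomology ψ φ X₃) =
      Module.length R (Matrix.PairHomology φ ψ X₁) + Module.length R (Matrix.PairHomology φ ψ X₃) +
        Module.length R (Matrix.PairHomology ψ φ X₂) := by
  refine LinearMap.length_homology_add (i := i.compLeft (Fin n)) (p := p.compLeft (Fin n))
    (fun v w hvw => funext fun j => hi (congrFun hvw j)) (fun v => ?_) (fun v => ?_)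
    (fun v => Matrix.act_comp φ i v) (fun v => Matrix.act_comp ψ i v)
    (fun v => Matrix.act_comp φ p v) (fun v => Matrix.act_comp ψ p v)
    (h.act_act X₁) (h.act_act X₂) (h.act_act X₃)
    (h.swap.act_act X₁) (h.swap.act_act X₂) (h.swap.act_act X₃)
  · constructor
    · intro hv
      choose w hw using fun j => (hip (v j)).1 (congrFun hv j)
      exact ⟨w, funext hw⟩
    · rintro ⟨w, rfl⟩
      exact funext fun j => hip.apply_apply_eq_zero (w j)
  · choose w hw using fun j => hp (v j)
    exact ⟨w, funext hw⟩

/-- The theta invariant is additive on short exact sequences. -/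
lemma pairTheta_add (h : IsExactPair φ ψ) (hfin : HasFiniteHomology φ ψ) [Module.Finite R X₁]
    [Module.Finite R X₂] [Module.Finite R X₃] {i : X₁ →ₗ[R] X₂} {p : X₂ →ₗ[R] X₃}
    (hi : Function.Injective i) (hip : Function.Exact i p) (hp : Function.Surjective p) :
    pairTheta φ ψ X₂ = pairTheta φ ψ X₁ + pairTheta φ ψ X₃ := by
  have H := h.length_add hi hip hp
  obtain ⟨a₁, b₁⟩ := hfin X₁
  obtain ⟨a₂, b₂⟩ := hfin X₂
  obtain ⟨a₃, b₃⟩ := hfin X₃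
  unfold pairTheta
  lift Module.length R (Matrix.PairHomology φ ψ X₁) to ℕ using a₁ with x₁
  lift Module.length R (Matrix.PairHomology φ ψ X₂) to ℕ using a₂ with x₂
  lift Module.length R (Matrix.PairHomology φ ψ X₃) to ℕ using a₃ with x₃
  lift Module.length R (Matrix.PairHomology ψ φ X₁) to ℕ using b₁ with y₁
  lift Module.length R (Matrix.PairHomology ψ φ X₂) to ℕ using b₂ with y₂
  lift Module.length R (Matrix.PairHomology ψ φ X₃) to ℕ using b₃ with y₃
  norm_cast at H
  simp only [ENat.toNat_natCast]
  omega

end IsExactPair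

lemma length_pairHomology_congr {X₁ X₂ : Type*} [AddCommGroup X₁] [Module R X₁]
    [AddCommGroup X₂] [Module R X₂] (e : X₁ ≃ₗ[R] X₂) :
    Module.length R (Matrix.PairHomology φ ψ X₁) =
      Module.length R (Matrix.PairHomology φ ψ X₂) := by
  have hnat : ∀ (A : Matrix (Fin n) (Fin n) R) (v : Fin n → X₁),
      LinearEquiv.piCongrRight (fun _ : Fin n => e) (A.act X₁ v) =
        A.act X₂ (LinearEquiv.piCongrRight (fun _ : Fin n => e) v) :=
    fun A v => Matrix.act_comp A e.toLinearMap v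
  refine LinearMap.Homology.length_eq_of_equiv (LinearEquiv.piCongrRight fun _ => e)
    (fun v => ?_) (fun v => ?_)
  · rw [← hnat, LinearEquiv.map_eq_zero_iff]
  · constructor
    · rintro ⟨w, rfl⟩
      exact ⟨_, (hnat ψ w).symm⟩
    · rintro ⟨w, hw⟩
      refine ⟨(LinearEquiv.piCongrRight fun _ => e).symm w,
        (LinearEquiv.piCongrRight (fun _ : Fin n => e)).injective ?_⟩
      rw [hnat, LinearEquiv.apply_symm_apply, hw]

lemma pairTheta_congr {X₁ X₂ : Type*} [AddCommGroup X₁] [Module R X₁]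
    [AddCommGroup X₂] [Module R X₂] (e : X₁ ≃ₗ[R] X₂) :
    pairTheta φ ψ X₁ = pairTheta φ ψ X₂ := by
  rw [pairTheta, pairTheta, length_pairHomology_congr e, length_pairHomology_congr e]

lemma pairTheta_eq_zero_of_subsingleton {X : Type*} [AddCommGroup X] [Module R X]
    [Subsingleton X] : pairTheta φ ψ X = 0 := by
  simp [pairTheta]

/-- The homology of an exact pair with coefficients in a free module vanishes. -/
lemma IsExactPair.subsingleton_of_free (h : IsExactPair φ ψ) (X : Type*) [AddCommGroup X]
    [Module R X] [Module.Free R X] [Module.Finite R X] :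
    Subsingleton (Matrix.PairHomology φ ψ X) := by
  rw [LinearMap.Homology.subsingleton_iff]
  intro v hv
  let b := Module.Free.chooseBasis R X
  have h1 : ∀ k, ∃ w, (fun j => b.repr (v j) k) = ψ.mulVec w := fun k => by
    apply h.exists_of_mulVec
    have := Matrix.act_comp φ (b.coord k) v
    rw [hv, Matrix.act_eq_mulVec] at this
    refine this.symm.trans ?_
    ext i
    exact map_zero _
  choose w hw using h1
  refine ⟨fun j => ∑ k, w k j • b k, ?_⟩
  ext i
  rw [Matrix.act_apply]
  conv_rhs => rw [← b.sum_repr (v i)]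
  simp only [Finset.smul_sum, smul_smul]
  rw [Finset.sum_comm]
  refine Finset.sum_congr rfl fun k _ => ?_
  rw [congrFun (hw k) i, Matrix.mulVec, dotProduct, Finset.sum_smul]

lemma IsExactPair.pairTheta_eq_zero_of_free (h : IsExactPair φ ψ) (X : Type*) [AddCommGroup X]
    [Module R X] [Module.Free R X] [Module.Finite R X] : pairTheta φ ψ X = 0 := by
  have := h.subsingleton_of_free X
  have := h.swap.subsingleton_of_free X
  simp [pairTheta]

variable [IsLocalRing R]

/-- Additivity along a composition series, all of whose factors are the residue field. -/
lemma pairTheta_eq_length_mul (h : IsExactPair φ ψ) (hfin : HasFiniteHomology φ ψ)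
    {E : Type u} [AddCommGroup E] [Module R E] (hE : IsFiniteLength R E) :
    pairTheta φ ψ E = (Module.length R E).toNat * pairTheta φ ψ (R ⧸ maximalIdeal R) := by
  induction hE with
  | of_subsingleton => simp [pairTheta_eq_zero_of_subsingleton]
  | @of_simple_quotient M _ _ N _ hN ih =>
    have hM : IsFiniteLength R M := .of_simple_quotient hN
    have := (isFiniteLength_iff_isNoetherian_isArtinian.1 hN).1
    have := (isFiniteLength_iff_isNoetherian_isArtinian.1 hM).1
    rw [h.pairTheta_add hfin (Submodule.injective_subtype N) (LinearMap.exact_subtype_mkQ N)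
      (Submodule.mkQ_surjective _), ih,
      Module.length_eq_add_of_exact N.subtype N.mkQ (Submodule.injective_subtype _)
      (Submodule.mkQ_surjective _) (LinearMap.exact_subtype_mkQ N)]
    obtain ⟨I, hI, ⟨e⟩⟩ := isSimpleModule_iff_quot_maximal.1 ‹IsSimpleModule R (M ⧸ N)›
    obtain rfl := IsLocalRing.eq_maximalIdeal hI
    rw [pairTheta_congr e, Module.length_eq_one_iff.2 ‹IsSimpleModule R (M ⧸ N)›,
      ENat.toNat_add (Module.length_ne_top_iff.2 hN) (by simp)]
    simp [add_mul]

/-- The theta invariant vanishes on modules of finite length, as soon as the ring has positive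
dimension. -/
theorem pairTheta_eq_zero_of_isFiniteLength [IsNoetherianRing R] (h : IsExactPair φ ψ) (hfin : HasFiniteHomology φ ψ)
    (hdim : ∃ p : Ideal R, p.IsPrime ∧ p ≠ maximalIdeal R)
    {E : Type u} [AddCommGroup E] [Module R E] (hE : IsFiniteLength R E) :
    pairTheta φ ψ E = 0 := by
  -- With p maximal among the primes other than 𝔪 and x ∈ 𝔪 outside p, the ideal J = p + (x) is
  -- 𝔪-primary, so R/J is nonzero of finite length.
  obtain ⟨p, ⟨hp, hpm⟩, hmax⟩ := set_has_maximal_iff_noetherian.2 ‹IsNoetherianRing R›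
    {p : Ideal R | p.IsPrime ∧ p ≠ maximalIdeal R} hdim
  obtain ⟨x, hx, hxp⟩ := SetLike.exists_of_lt (lt_of_le_of_ne (le_maximalIdeal hp.ne_top) hpm)
  let J : Ideal R := p ⊔ Ideal.span {x}
  have hrad : maximalIdeal R ≤ J.radical := by
    rw [Ideal.radical_eq_sInf]
    refine le_sInf fun q hq => ?_
    by_contra hqm
    have hpq : p < q := lt_of_le_of_ne (le_sup_left.trans hq.1) (by
      rintro rfl
      exact hxp (hq.1 (Ideal.mem_sup_right (Ideal.mem_span_singleton_self x))))
    exact hmax q ⟨hq.2, fun h => hqm h.ge⟩ hpq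
  obtain ⟨k, hk⟩ := Ideal.exists_pow_le_of_le_radical_of_fg hrad
    (maximalIdeal R).fg_of_isNoetherianRing
  have hJ : J ≠ ⊤ := fun hJ => by
    have : J ≤ maximalIdeal R := sup_le (le_maximalIdeal hp.ne_top)
      ((Ideal.span_singleton_le_iff_mem _).2 hx)
    rw [hJ, top_le_iff] at this
    exact (maximalIdeal.isMaximal R).ne_top this
  have hfl : IsFiniteLength R (R ⧸ J) := isFiniteLength_of_pow_smul_eq_zero k fun r hr t => by
    obtain ⟨t, rfl⟩ := Submodule.mkQ_surjective _ t
    rw [← map_smul, Submodule.mkQ_apply, Submodule.Quotient.mk_eq_zero]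
    exact J.mul_mem_right _ (hk hr)
  let i : (R ⧸ p) →ₗ[R] (R ⧸ p) := LinearMap.lsmul R (R ⧸ p) x
  let q : (R ⧸ p) →ₗ[R] (R ⧸ J) := Submodule.factor le_sup_left
  have hi : Function.Injective i := by
    rw [← LinearMap.ker_eq_bot, LinearMap.ker_eq_bot']
    intro t ht
    obtain ⟨t, rfl⟩ := Submodule.mkQ_surjective _ t
    simp only [i, LinearMap.lsmul_apply] at ht
    rw [← map_smul, Submodule.mkQ_apply, Submodule.Quotient.mk_eq_zero] at ht
    rw [Submodule.mkQ_apply, Submodule.Quotient.mk_eq_zero]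
    exact (hp.mem_or_mem ht).resolve_left hxp
  have hiq : Function.Exact i q := by
    intro t
    obtain ⟨t, rfl⟩ := Submodule.mkQ_surjective _ t
    have hq : q (Submodule.Quotient.mk t) = 0 ↔ t ∈ J := Submodule.Quotient.mk_eq_zero J
    rw [Submodule.mkQ_apply, hq]
    constructor
    · intro ht
      obtain ⟨a, ha, b, hb, rfl⟩ := Submodule.mem_sup.1 ht
      obtain ⟨c, rfl⟩ := Ideal.mem_span_singleton'.1 hb
      refine ⟨Submodule.Quotient.mk c, ?_⟩
      simp only [i, LinearMap.lsmul_apply]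
      rw [← Submodule.Quotient.mk_smul, eq_comm, Submodule.Quotient.eq]
      simpa [mul_comm] using ha
    · rintro ⟨c, hc⟩
      obtain ⟨c, rfl⟩ := Submodule.mkQ_surjective _ c
      simp only [i, LinearMap.lsmul_apply, Submodule.mkQ_apply] at hc
      rw [← Submodule.Quotient.mk_smul, eq_comm, Submodule.Quotient.eq] at hc
      have : t = (t - x • c) + x • c := by ring
      rw [this]
      exact Submodule.add_mem _ (Ideal.mem_sup_left hc)
        (Ideal.mem_sup_right (Ideal.mul_mem_right _ _ (Ideal.mem_span_singleton_self x)))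
  -- The ends of 0 → R/p → R/p → R/J → 0 cancel. As R/J has positive length, theta of the residue
  -- field is then zero.
  have h0 : pairTheta φ ψ (R ⧸ J) = 0 := by
    have := h.pairTheta_add hfin hi hiq (Submodule.factor_surjective _)
    omega
  rw [pairTheta_eq_length_mul h hfin hfl, mul_eq_zero] at h0
  have hk0 : pairTheta φ ψ (R ⧸ maximalIdeal R) = 0 := by
    refine h0.resolve_left fun h0 => ?_
    have h1 := Module.length_ne_top_iff.2 hfl
    have : Nontrivial (R ⧸ J) := Ideal.Quotient.nontrivial_iff.2 hJ
    have h2 := (Module.length_pos (R := R) (M := R ⧸ J)).ne'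
    have h3 : (Module.length R (R ⧸ J)).toNat = 0 := by exact_mod_cast h0
    exact (ENat.toNat_eq_zero.1 h3).elim h2 h1
  rw [pairTheta_eq_length_mul h hfin hE, hk0, mul_zero]

end theta

/-! ### Tor-independence of cokernels of matrix factorizations -/

section coker

variable {S : Type u} [CommRing S] {f : S} {n p : ℕ} {Φ Ψ : Matrix (Fin n) (Fin n) S}
  {A B : Matrix (Fin p) (Fin p) S}
  {X Y : Type u} [AddCommGroup X] [Module S X] [AddCommGroup Y] [Module S Y]

/-- `X` is a cokernel of the matrix `A`. -/
def IsCokerOf (A : Matrix (Fin p) (Fin p) S) (X : Type*) [AddCommGroup X] [Module S X] : Prop :=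
  ∃ π : (Fin p → S) →ₗ[S] X, Function.Surjective π ∧ Function.Exact A.mulVecLin π

/-- The kernel of `Φ` on `X^n` is the range of `Ψ`. -/
def TorZero (Φ Ψ : Matrix (Fin n) (Fin n) S) (X : Type*) [AddCommGroup X] [Module S X] : Prop :=
  ∀ v : Fin n → X, Φ.act X v = 0 → ∃ w, v = Ψ.act X w

lemma IsCokerOf.nonempty_equiv (hX : IsCokerOf A X) (hY : IsCokerOf A Y) :
    Nonempty (X ≃ₗ[S] Y) := by
  obtain ⟨π, hπ, hAπ⟩ := hX
  obtain ⟨ρ, hρ, hAρ⟩ := hY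
  exact ⟨(π.quotKerEquivOfSurjective hπ).symm.trans ((Submodule.quotEquivOfEq _ _
    (hAπ.linearMap_ker_eq.trans hAρ.linearMap_ker_eq.symm)).trans
    (ρ.quotKerEquivOfSurjective hρ))⟩

lemma IsCokerOf.of_equiv (hX : IsCokerOf A X) (e : X ≃ₗ[S] Y) : IsCokerOf A Y := by
  obtain ⟨π, hπ, hAπ⟩ := hX
  refine ⟨e.toLinearMap ∘ₗ π, e.surjective.comp hπ, fun v => ?_⟩
  rw [← hAπ v]
  simp

/-- The columns of a matrix, mapped to a cokernel. -/
lemma IsCokerOf.torZero_iff (hX : IsCokerOf A X) : TorZero Φ Ψ X ↔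
    ∀ U V : Matrix (Fin p) (Fin n) S, V * Φ.transpose = A * U →
      ∃ W U' : Matrix (Fin p) (Fin n) S, V = W * Ψ.transpose + A * U' := by
  obtain ⟨π, hπ, hAπ⟩ := hX
  -- An n-tuple in X is lifted to the columns of a p × n matrix. Then Φ acts as right multiplication
  -- by its transpose, and the matrices representing zero are those of the form A * U.
  let c : Matrix (Fin p) (Fin n) S → Fin n → X := fun V j => π fun i => V i j
  have hadd : ∀ V W, c (V - W) = c V - c W := fun V W => funext fun j =>
    map_sub π (fun i => V i j) (fun i => W i j)
  have hsurj : ∀ v, ∃ V, c V = v := fun v => by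
    choose V hV using fun j => hπ (v j)
    exact ⟨Matrix.of fun i j => V j i, funext hV⟩
  have hact : ∀ (Φ : Matrix (Fin n) (Fin n) S) V, Φ.act X (c V) = c (V * Φ.transpose) := by
    intro Φ V
    ext i
    simp only [Matrix.act_apply, c, ← map_smul, ← map_sum]
    congr 1
    ext k
    simp [Matrix.mul_apply, mul_comm]
  have hzero : ∀ V, c V = 0 ↔ ∃ U : Matrix (Fin p) (Fin n) S, V = A * U := by
    intro V
    constructor
    · intro hV
      refine Matrix.exists_eq_mul_of_forall_col fun j => ?_
      obtain ⟨w, hw⟩ := (hAπ _).1 (congrFun hV j)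
      exact ⟨w, hw.symm⟩
    · rintro ⟨U, rfl⟩
      ext j
      exact hAπ.apply_apply_eq_zero fun i => U i j
  constructor
  · intro h U V hUV
    obtain ⟨w, hw⟩ := h (c V) (by rw [hact, hzero]; exact ⟨U, hUV⟩)
    obtain ⟨W, rfl⟩ := hsurj w
    rw [hact, ← sub_eq_zero, ← hadd, hzero] at hw
    obtain ⟨U', hU'⟩ := hw
    exact ⟨W, U', by rw [← hU']; abel⟩
  · intro h v hv
    obtain ⟨V, rfl⟩ := hsurj v
    rw [hact, hzero] at hv
    obtain ⟨U, hU⟩ := hv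
    obtain ⟨W, U', rfl⟩ := h U V hU
    refine ⟨c W, ?_⟩
    rw [hact, ← sub_eq_zero, ← hadd, hzero]
    exact ⟨U', by abel⟩

namespace IsMatrixFactorization

lemma mul_left_cancel [IsDomain S] {κ : Type*} [Fintype κ] (hf : f ≠ 0) (h : IsMatrixFactorization f A B)
    {U V : Matrix (Fin p) κ S} (hUV : A * U = A * V) : U = V := by
  have := congrArg (B * ·) hUV
  simp only [← Matrix.mul_assoc, h.mul_eq', Matrix.smul_mul, Matrix.one_mul] at this
  exact smul_right_injective _ hf this

lemma projDimLT_two [IsDomain S] (hf : f ≠ 0) (h : IsMatrixFactorization f A B)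
    (hX : IsCokerOf A X) : ProjDimLT S X 2 := by
  obtain ⟨π, hπ, hAπ⟩ := hX
  refine ProjDimLT.right (n := 1) ?_ hAπ hπ (ProjDimLT.one_iff.2 inferInstance)
    ((ProjDimLT.one_iff.2 inferInstance).mono (by omega))
  rw [← LinearMap.ker_eq_bot, LinearMap.ker_eq_bot']
  exact fun v hv => h.mulVec_injective hf hv

/-- Symmetry of Tor-vanishing, in odd degrees. -/
lemma torZero_symm [IsDomain S] (hf : f ≠ 0) (hA : IsMatrixFactorization f A B)
    (hΦ : IsMatrixFactorization f Φ Ψ) (hX : IsCokerOf A X) (hY : IsCokerOf Φ Y)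
    (h : TorZero Φ Ψ X) : TorZero A B Y := by
  rw [hX.torZero_iff] at h
  rw [hY.torZero_iff]
  intro U V hUV
  -- Transposing the relation interchanges the roles of the two factorizations.
  have hUV' : U.transpose * Φ.transpose = A * V.transpose := by
    rw [← Matrix.transpose_mul, ← hUV, Matrix.transpose_mul, Matrix.transpose_transpose]
  obtain ⟨W, U', hU⟩ := h _ _ hUV'
  have h1 : A * V.transpose = A * (B * W + U' * Φ.transpose) := by
    rw [← hUV', hU, Matrix.add_mul, Matrix.mul_assoc W, hΦ.transpose.mul_eq', Matrix.mul_add,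
      ← Matrix.mul_assoc, hA.mul_eq]
    simp [Matrix.mul_assoc]
  have h2 := congrArg Matrix.transpose (hA.mul_left_cancel hf h1)
  refine ⟨W.transpose, U'.transpose, ?_⟩
  simpa using h2

/-- Symmetry of Tor-vanishing, in even degrees. -/
lemma torZero_symm' [IsDomain S] (hf : f ≠ 0) (hA : IsMatrixFactorization f A B)
    (hΦ : IsMatrixFactorization f Φ Ψ) (hX : IsCokerOf A X) (hY : IsCokerOf Φ Y)
    (h : TorZero Ψ Φ X) : TorZero B A Y := by
  rw [hX.torZero_iff] at h
  rw [hY.torZero_iff]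
  intro U V hUV
  have hUV' : B * V.transpose = U.transpose * Φ.transpose := by
    rw [← Matrix.transpose_mul, ← hUV, Matrix.transpose_mul, Matrix.transpose_transpose]
  have h1 : B * (V.transpose * Ψ.transpose) = B * (A * U.transpose) := by
    rw [← Matrix.mul_assoc, hUV', Matrix.mul_assoc, hΦ.transpose.mul_eq, ← Matrix.mul_assoc,
      hA.mul_eq']
    simp
  obtain ⟨W, U', hV⟩ := h _ _ (hA.swap.mul_left_cancel hf h1)
  have h2 := congrArg Matrix.transpose hV
  refine ⟨U'.transpose, W.transpose, ?_⟩
  rw [add_comm]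
  simpa using h2

end IsMatrixFactorization

end coker

/-- Modules that are each other's syzygies with respect to modules of projective dimension at
most one have projective dimension at most one. -/
lemma Module.ProjDimLT.two_of_periodic {S : Type u} [CommRing S] {Z Z' P : Type u}
    [AddCommGroup Z] [Module S Z] [AddCommGroup Z'] [Module S Z'] [AddCommGroup P] [Module S P]
    {i : Z' →ₗ[S] P} {q : P →ₗ[S] Z} {i' : Z →ₗ[S] P} {q' : P →ₗ[S] Z'}
    (hi : Function.Injective i) (hiq : Function.Exact i q) (hq : Function.Surjective q)
    (hi' : Function.Injective i') (hiq' : Function.Exact i' q') (hq' : Function.Surjective q')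
    (hP : ProjDimLT S P 2) (d : ℕ) (hZ : ProjDimLT S Z d) (hZ' : ProjDimLT S Z' d) :
    ProjDimLT S Z 2 ∧ ProjDimLT S Z' 2 := by
  induction d with
  | zero => exact ⟨hZ.mono (by omega), hZ'.mono (by omega)⟩
  | succ d ih =>
    rcases le_or_gt (d + 1) 2 with hd | hd
    · exact ⟨hZ.mono hd, hZ'.mono hd⟩
    -- Each module is the kernel of a surjection from P onto the other, so as long as the bound
    -- exceeds that of P it drops by one for both.
    · exact ih (ProjDimLT.left hi' hiq' hq' (hP.mono (by omega)) hZ')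
        (ProjDimLT.left hi hiq hq (hP.mono (by omega)) hZ)

/-! ### Counting relations in a Tor-independent tensor product -/

section kuenneth

variable {S : Type u} [CommRing S] [IsRegularLocalRing S] {f : S} {n p : ℕ}
  {Φ Ψ : Matrix (Fin n) (Fin n) S} {A B : Matrix (Fin p) (Fin p) S}
  {X Y : Type u} [AddCommGroup X] [Module S X] [AddCommGroup Y] [Module S Y]

/-- If `X` is Tor-independent of the cokernel of `Φ`, their tensor product has projective
dimension at most one if `X` has. -/
lemma projDimLT_two_quotient_range_act [Module.Finite S X] (hX : ProjDimLT S X 2)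
    (h : TorZero Φ Ψ X) (h' : TorZero Ψ Φ X)
    (h0 : ∀ v, Φ.act X (Ψ.act X v) = 0) (h0' : ∀ v, Ψ.act X (Φ.act X v) = 0) :
    ProjDimLT S ((Fin n → X) ⧸ LinearMap.range (Φ.act X)) 2 := by
  have key : ∀ {Φ Ψ : Matrix (Fin n) (Fin n) S}, TorZero Φ Ψ X →
      (∀ v, Φ.act X (Ψ.act X v) = 0) →
      ∃ i : ((Fin n → X) ⧸ LinearMap.range (Ψ.act X)) →ₗ[S] (Fin n → X),
        Function.Injective i ∧ Function.Exact i (LinearMap.range (Φ.act X)).mkQ := by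
    intro Φ Ψ h h0
    refine ⟨Submodule.liftQ _ (Φ.act X) ?_, ?_, ?_⟩
    · rintro _ ⟨v, rfl⟩; exact h0 v
    · rw [← LinearMap.ker_eq_bot]
      refine Submodule.ker_liftQ_eq_bot _ _ _ fun v hv => ?_
      obtain ⟨w, hw⟩ := h v hv
      exact ⟨w, hw.symm⟩
    · rw [LinearMap.exact_iff, Submodule.range_liftQ, Submodule.ker_mkQ]
  obtain ⟨i, hi, hiq⟩ := key h h0
  obtain ⟨i', hi', hiq'⟩ := key h' h0'
  -- The cokernels of Φ and Ψ on X^n are each other's syzygies inside X^n; finite global dimension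
  -- of S starts the descent.
  exact (ProjDimLT.two_of_periodic hi hiq (Submodule.mkQ_surjective _) hi' hiq'
    (Submodule.mkQ_surjective _) (hX.pi n) _ (IsRegularLocalRing.projDimLT_succ rfl _)
    (IsRegularLocalRing.projDimLT_succ rfl _)).1

/-- Reduced matrix factorizations with Tor-independent cokernels: one of them is empty. -/
theorem eq_zero_or_eq_zero_of_torZero (hf : f ≠ 0) (hA : IsMatrixFactorization f A B)
    (hΦ : IsMatrixFactorization f Φ Ψ) (hX : IsCokerOf A X)
    (hAm : ∀ i j, A i j ∈ maximalIdeal S) (hBm : ∀ i j, B i j ∈ maximalIdeal S)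
    (hΦm : ∀ i j, Φ i j ∈ maximalIdeal S) (hΨm : ∀ i j, Ψ i j ∈ maximalIdeal S)
    (h : TorZero Φ Ψ X) (h' : TorZero Ψ Φ X) : p = 0 ∨ n = 0 := by
  have hfX : ∀ x : X, f • x = 0 := by
    obtain ⟨π, hπ, hAπ⟩ := hX
    intro x
    obtain ⟨v, rfl⟩ := hπ x
    rw [← map_smul, hAπ]
    exact ⟨B.mulVec v, by
      rw [Matrix.mulVecLin_apply, Matrix.mulVec_mulVec, hA.mul_eq, Matrix.smul_mulVec,
        Matrix.one_mulVec]⟩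
  have hact : ∀ {Φ Ψ : Matrix (Fin n) (Fin n) S}, IsMatrixFactorization f Φ Ψ →
      ∀ v, Φ.act X (Ψ.act X v) = 0 := by
    intro Φ Ψ hΦ v
    rw [← Matrix.act_mul, hΦ.mul_eq, Matrix.act_smul_one]
    exact funext fun i => hfX _
  have hPX := hA.projDimLT_two hf hX
  have hiff := (hX.torZero_iff (Φ := Φ) (Ψ := Ψ)).1 h
  obtain ⟨π, hπ, hAπ⟩ := hX
  have : Module.Finite S X := Module.Finite.of_surjective π hπ
  have hZ := projDimLT_two_quotient_range_act hPX h h' (hact hΦ) (hact hΦ.swap)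
  let c : (Fin p × Fin n → S) →ₗ[S] (Fin n → X) :=
    LinearMap.pi fun j => π ∘ₗ LinearMap.funLeft S S fun i => (i, j)
  have hc : ∀ V j, c V j = π fun i => V (i, j) := fun V j => rfl
  have hcs : Function.Surjective c := fun v => by
    choose V hV using fun j => hπ (v j)
    exact ⟨fun ij => V ij.2 ij.1, funext hV⟩
  -- The presentation of the tensor product of the two cokernels, (U, V) ↦ AU + VΦᵀ, with pn
  -- generators and 2pn relations.
  let Θ : ((Fin p × Fin n) ⊕ (Fin p × Fin n) → S) →ₗ[S] (Fin p × Fin n → S) :=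
    LinearMap.pi fun ij => (∑ k, A ij.1 k • LinearMap.proj (Sum.inl (k, ij.2))) +
      ∑ k, Φ ij.2 k • LinearMap.proj (Sum.inr (ij.1, k))
  let mU (v : (Fin p × Fin n) ⊕ (Fin p × Fin n) → S) : Matrix (Fin p) (Fin n) S :=
    Matrix.of fun i j => v (Sum.inl (i, j))
  let mV (v : (Fin p × Fin n) ⊕ (Fin p × Fin n) → S) : Matrix (Fin p) (Fin n) S :=
    Matrix.of fun i j => v (Sum.inr (i, j))
  have hΘ : ∀ v i j, Θ v (i, j) = (A * mU v + mV v * Φ.transpose) i j := by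
    intro v i j
    simp [Θ, mU, mV, Matrix.mul_apply, mul_comm]
  have hcard := card_eq_of_projDimLT_two hf (Z := (Fin n → X) ⧸ LinearMap.range (Φ.act X))
    (fun z => by
      obtain ⟨v, rfl⟩ := Submodule.mkQ_surjective _ z
      rw [← map_smul, show f • v = 0 from funext fun i => hfX _, map_zero]) hZ
    (Submodule.mkQ _ ∘ₗ c) ((Submodule.mkQ_surjective _).comp hcs) Θ ?_ ?_
  · simp only [Fintype.card_sum, Fintype.card_prod, Fintype.card_fin] at hcard
    have : p * n = 0 := by omega
    simpa using this
  · intro V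
    rw [LinearMap.comp_apply, Submodule.mkQ_apply, Submodule.Quotient.mk_eq_zero]
    constructor
    · rintro ⟨w, hw⟩
      obtain ⟨W, rfl⟩ := hcs w
      have h1 : ∀ j, ∃ u, A.mulVecLin u = fun i => V (i, j) - ∑ k, Φ j k * W (i, k) := fun j => by
        refine (hAπ _).1 ?_
        have h2 := congrFun hw j
        rw [Matrix.act_apply] at h2
        simp only [hc, ← map_smul, ← map_sum] at h2
        rw [← sub_eq_zero, ← map_sub] at h2
        rw [← neg_eq_zero, ← map_neg, ← h2]
        congr 1
        ext i
        simp
      choose u hu using h1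
      refine ⟨Sum.elim (fun ij => u ij.2 ij.1) W, ?_⟩
      ext ⟨i, j⟩
      have := congrFun (hu j) i
      simp only [Matrix.mulVecLin_apply, Matrix.mulVec, dotProduct] at this
      simp [Θ, this]
    · rintro ⟨v, rfl⟩
      refine ⟨c fun ij => v (Sum.inr ij), ?_⟩
      ext j
      rw [Matrix.act_apply]
      simp only [hc, ← map_smul, ← map_sum]
      rw [← sub_eq_zero, ← map_sub, ← neg_eq_zero, ← map_neg]
      refine (hAπ _).2 ⟨fun i => v (Sum.inl (i, j)), ?_⟩
      ext i
      simp [Θ, Matrix.mulVec, dotProduct]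
  · intro v hv
    have h0 : A * mU v + mV v * Φ.transpose = 0 := by
      ext i j
      rw [← hΘ, hv]; rfl
    have memT : ∀ {k l m : ℕ} {C : Matrix (Fin k) (Fin l) S} {D : Matrix (Fin l) (Fin m) S},
        (∀ i j, C i j ∈ maximalIdeal S) → ∀ i j, (C * D) i j ∈ maximalIdeal S := by
      intro k l m C D hC i j
      rw [Matrix.mul_apply]
      exact Ideal.sum_mem _ fun t _ => Ideal.mul_mem_right _ _ (hC i t)
    have memT' : ∀ {k l m : ℕ} {C : Matrix (Fin k) (Fin l) S} {D : Matrix (Fin l) (Fin m) S},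
        (∀ i j, D i j ∈ maximalIdeal S) → ∀ i j, (C * D) i j ∈ maximalIdeal S := by
      intro k l m C D hC i j
      rw [Matrix.mul_apply]
      exact Ideal.sum_mem _ fun t _ => Ideal.mul_mem_left _ _ (hC t j)
    -- Tor-vanishing gives V = WΨᵀ + AU' and U = -(BW + U'Φᵀ) for every (U, V) in ker Θ. All four
    -- matrices are reduced, so these entries lie in 𝔪, as the count requires.
    obtain ⟨W, U', hV⟩ := hiff (-mU v) (mV v) (by
      rw [Matrix.mul_neg]; exact eq_neg_of_add_eq_zero_right h0)
    have hU : mU v = -(B * W + U' * Φ.transpose) := by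
      apply hA.mul_left_cancel hf
      rw [eq_neg_of_add_eq_zero_left h0, hV, Matrix.add_mul, Matrix.mul_assoc W,
        hΦ.transpose.mul_eq', Matrix.mul_neg, Matrix.mul_add, ← Matrix.mul_assoc A B, hA.mul_eq]
      simp [Matrix.mul_assoc]
    rintro (⟨i, j⟩ | ⟨i, j⟩)
    · change mU v i j ∈ _
      rw [hU]
      exact Ideal.neg_mem_iff _ |>.2 (Ideal.add_mem _ (memT hBm i j)
        (memT' (fun k l => hΦm l k) i j))
    · change mV v i j ∈ _
      rw [hV]
      exact Ideal.add_mem _ (memT' (fun k l => hΨm l k) i j) (memT hAm i j)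

end kuenneth

/-! ### Reduced matrix factorizations -/

section reduce

variable {S R : Type u} [CommRing S] [CommRing R] [Algebra S R] {f : S} {p : ℕ}
  {A B : Matrix (Fin p) (Fin p) S}

/-- The cokernel over `R` of a matrix over `S`. -/
abbrev Matrix.QuotCoker (R : Type u) [CommRing R] [Algebra S R] (A : Matrix (Fin p) (Fin p) S) :
    Type u :=
  (Fin p → R) ⧸ LinearMap.range (A.map (algebraMap S R)).mulVecLin

lemma Matrix.map_mulVec_algebraMap (A : Matrix (Fin p) (Fin p) S) (v : Fin p → S) :
    (A.map (algebraMap S R)).mulVec (fun i => algebraMap S R (v i)) =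
      fun i => algebraMap S R (A.mulVec v i) := by
  ext i
  simp [Matrix.mulVec, dotProduct]

/-- The cokernel over S is already killed by f, because fu = A(Bu); reduction modulo f does not
change it. -/
lemma IsMatrixFactorization.isCokerOf_quotCoker (hR : IsHypersurfaceQuotient S R f)
    (h : IsMatrixFactorization f A B) : IsCokerOf A (A.QuotCoker R) := by
  let c : (Fin p → S) →ₗ[S] (Fin p → R) := (Algebra.linearMap S R).compLeft (Fin p)
  have hc : ∀ v, c v = fun i => algebraMap S R (v i) := fun v => rfl
  have hcs : Function.Surjective c := fun v => by
    choose w hw using fun i => hR.surjective (v i)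
    exact ⟨w, funext hw⟩
  refine ⟨(Submodule.mkQ (LinearMap.range (A.map (algebraMap S R)).mulVecLin)).restrictScalars S ∘ₗ
    c, (Submodule.mkQ_surjective _).comp hcs, fun v => ?_⟩
  rw [LinearMap.comp_apply, LinearMap.restrictScalars_apply, Submodule.mkQ_apply,
    Submodule.Quotient.mk_eq_zero]
  constructor
  · rintro ⟨w, hw⟩
    obtain ⟨w, rfl⟩ := hcs w
    rw [Matrix.mulVecLin_apply, hc, hc, Matrix.map_mulVec_algebraMap] at hw
    have : ∀ i, ∃ u, v i - A.mulVec w i = f * u := fun i =>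
      (hR.algebraMap_eq_zero_iff _).1 (by rw [map_sub, congrFun hw i, sub_self])
    choose u hu using this
    refine ⟨w + B.mulVec u, ?_⟩
    rw [map_add, Matrix.mulVecLin_apply, Matrix.mulVecLin_apply, Matrix.mulVec_mulVec, h.mul_eq,
      Matrix.smul_mulVec, Matrix.one_mulVec]
    ext i
    rw [Pi.add_apply, Pi.smul_apply, smul_eq_mul, ← hu i]
    ring
  · rintro ⟨w, rfl⟩
    exact ⟨c w, by rw [Matrix.mulVecLin_apply, hc, Matrix.map_mulVec_algebraMap]; rfl⟩

/-- The cokernel of `A` is projective if that of `B` is. -/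
lemma IsMatrixFactorization.projective_quotCoker (hR : IsHypersurfaceQuotient S R f)
    (h : IsMatrixFactorization f A B) (hB : Module.Projective R (B.QuotCoker R)) :
    Module.Projective R (A.QuotCoker R) := by
  have hE := h.isExactPair hR
  set α := A.map (algebraMap S R)
  set β := B.map (algebraMap S R)
  have hβα : LinearMap.range α.mulVecLin ≤ LinearMap.ker β.mulVecLin := by
    rintro _ ⟨v, rfl⟩
    simp [Matrix.mulVec_mulVec, hE.mul_eq_zero']
  -- β embeds coker α into R^p with quotient coker β, so coker α is the kernel of a surjection
  -- between projectives.
  refine ProjDimLT.one_iff.1 (ProjDimLT.left (f := Submodule.liftQ _ β.mulVecLin hβα)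
    (g := (LinearMap.range β.mulVecLin).mkQ) ?_ ?_ (Submodule.mkQ_surjective _)
    (ProjDimLT.one_iff.2 inferInstance) ((ProjDimLT.one_iff.2 hB).mono (by omega)))
  · rw [← LinearMap.ker_eq_bot]
    refine Submodule.ker_liftQ_eq_bot _ _ _ fun v hv => ?_
    obtain ⟨w, hw⟩ := hE.exists_of_mulVec' v hv
    exact ⟨w, hw.symm⟩
  · rw [LinearMap.exact_iff, Submodule.range_liftQ, Submodule.ker_mkQ]

variable {X Y : Type u} [AddCommGroup X] [Module S X] [Module R X] [IsScalarTower S R X]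
  [AddCommGroup Y] [Module S Y] [Module R Y] [IsScalarTower S R Y]

lemma IsHypersurfaceQuotient.smul_eq_zero (hR : IsHypersurfaceQuotient S R f) (x : X) :
    f • x = 0 := by
  rw [← algebraMap_smul R, (hR.algebraMap_eq_zero_iff f).2 dvd_rfl, zero_smul]

lemma IsHypersurfaceQuotient.projective_of_equiv (hR : IsHypersurfaceQuotient S R f)
    (e : X ≃ₗ[S] Y) (h : Module.Projective R X) : Module.Projective R Y :=
  Module.Projective.of_equiv (e.extendScalarsOfSurjective hR.surjective)

/-- Every finite module of projective dimension at most one over `S` can be replaced by the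
cokernel of a reduced matrix factorization, preserving Tor-vanishing. -/
lemma exists_reduced_isMatrixFactorization (hR : IsHypersurfaceQuotient S R f) (m : ℕ)
    (ρ : (Fin m → S) →ₗ[S] X) (hρ : Function.Surjective ρ) (hX : ProjDimLT S X 2) :
    ∃ (p : ℕ) (A B : Matrix (Fin p) (Fin p) S) (X' : Type u) (_ : AddCommGroup X')
      (_ : Module S X'), IsMatrixFactorization f A B ∧ IsCokerOf A X' ∧
      (∀ i j, A i j ∈ (letI := hR.isRegularLocalRing; maximalIdeal S)) ∧
      (∀ i j, B i j ∈ (letI := hR.isRegularLocalRing; maximalIdeal S)) ∧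
      (∀ (n : ℕ) (Φ Ψ : Matrix (Fin n) (Fin n) S), IsMatrixFactorization f Φ Ψ →
        TorZero Φ Ψ X → TorZero Ψ Φ X → TorZero Φ Ψ X' ∧ TorZero Ψ Φ X') ∧
      (p = 0 → Module.Projective R X) := by
  letI := hR.isRegularLocalRing
  induction m using Nat.strong_induction_on generalizing X with
  | _ m ih =>
  have : Module.Finite S X := Module.Finite.of_surjective ρ hρ
  obtain ⟨p, A, B, π, hAB, hπ, hAπ, hAm, hmin⟩ :=
    exists_isMatrixFactorization hR.ne_zero hR.smul_eq_zero hX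
  have hcX : IsCokerOf A X := ⟨π, hπ, hAπ⟩
  have hcX' := hAB.swap.isCokerOf_quotCoker hR
  obtain ⟨π', hπ', hBπ'⟩ := id hcX'
  have : Module.Finite S (B.QuotCoker R) := Module.Finite.of_surjective π' hπ'
  -- If coker B needs all p generators, B has no unit entry. Otherwise coker B, a syzygy of X over
  -- R, needs fewer than p ≤ m generators and replaces X in the induction.
  by_cases hp : ∀ (c : ℕ) (ρ : (Fin c → S) →ₗ[S] B.QuotCoker R), Function.Surjective ρ → p ≤ c
  · refine ⟨p, A, B, X, inferInstance, inferInstance, hAB, hcX, hAm, fun i j => ?_,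
      fun n Φ Ψ _ h h' => ⟨h, h'⟩, ?_⟩
    · refine mem_maximalIdeal_of_minimal π' hπ' hp (fun i => B i j) ?_ i
      refine (hBπ' _).2 ⟨Pi.single j 1, ?_⟩
      ext i
      simp
    · rintro rfl
      have : Subsingleton X := hπ.subsingleton
      infer_instance
  · push Not at hp
    obtain ⟨c, ρ', hρ', hc⟩ := hp
    obtain ⟨q, A', B', X', i₁, i₂, h₁, h₂, h₃, h₄, h₅, h₆⟩ := ih c (hc.trans_le (hmin _ ρ hρ)) ρ' hρ'
      (hAB.swap.projDimLT_two hR.ne_zero hcX')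
    refine ⟨q, A', B', X', i₁, i₂, h₁, h₂, h₃, h₄, fun n Φ Ψ hΦ h h' => ?_, fun hq => ?_⟩
    · have hY := hΦ.isCokerOf_quotCoker hR
      -- Vanishing moves from coker A to coker Φ and back to coker B; the swap of A and B
      -- interchanges the parities.
      have k₁ := hAB.torZero_symm hR.ne_zero hΦ hcX hY h
      have k₂ := hAB.torZero_symm' hR.ne_zero hΦ hcX hY h'
      exact h₅ n Φ Ψ hΦ (hΦ.torZero_symm hR.ne_zero hAB.swap hY hcX' k₂)
        (hΦ.torZero_symm' hR.ne_zero hAB.swap hY hcX' k₁)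
    · obtain ⟨e⟩ := (hAB.isCokerOf_quotCoker hR).nonempty_equiv hcX
      exact hR.projective_of_equiv e (hAB.projective_quotCoker hR (h₆ hq))

/-- Over a hypersurface, Tor-independent modules of maximal depth: one of them is projective. -/
theorem projective_or_projective_of_torZero (hR : IsHypersurfaceQuotient S R f) {n : ℕ}
    {Φ Ψ : Matrix (Fin n) (Fin n) S} (hΦ : IsMatrixFactorization f Φ Ψ)
    [Module.Finite S X] (hX : ProjDimLT S X 2) (hY : IsCokerOf Φ Y)
    (h : TorZero Φ Ψ X) (h' : TorZero Ψ Φ X) : Module.Projective R X ∨ Module.Projective R Y := by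
  letI := hR.isRegularLocalRing
  obtain ⟨m, ρ, hρ⟩ := Module.Finite.exists_fin' S X
  obtain ⟨p, A, B, X', i₁, i₂, h₁, h₂, h₃, h₄, h₅, h₆⟩ :=
    exists_reduced_isMatrixFactorization hR m ρ hρ hX
  obtain ⟨k, k'⟩ := h₅ n Φ Ψ hΦ h h'
  -- Symmetry lets Y take the place of the coefficient module, so that it can be reduced as well.
  have l := h₁.torZero_symm hR.ne_zero hΦ h₂ hY k
  have l' := h₁.torZero_symm' hR.ne_zero hΦ h₂ hY k'
  obtain ⟨ρ', hρ', -⟩ := id hY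
  obtain ⟨q, C, D, Y', j₁, j₂, m₁, m₂, m₃, m₄, m₅, m₆⟩ :=
    exists_reduced_isMatrixFactorization hR n ρ' hρ' (hΦ.projDimLT_two hR.ne_zero hY)
  obtain ⟨l, l'⟩ := m₅ p A B h₁ l l'
  rcases eq_zero_or_eq_zero_of_torZero hR.ne_zero m₁ h₁ m₂ m₃ m₄ h₃ h₄ l l' with h | h
  · exact Or.inr (m₆ h)
  · exact Or.inl (h₆ h)

end reduce

/-! ### Restriction of scalars from a hypersurface to the regular ring -/

namespace Module

variable {R : Type*} [CommRing R] {M N : Type*} [AddCommGroup M] [Module R M] [AddCommGroup N]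
  [Module R N]

variable (R M) in
/-- Multiplication by `r` on `M` factors through a finite free module. -/
def SMulFactorsThroughFree (r : R) : Prop :=
  ∃ (n : ℕ) (u : M →ₗ[R] (Fin n → R)) (v : (Fin n → R) →ₗ[R] M), ∀ x, v (u x) = r • x

/-- Write r = vu on M and lift v through q to v'. Then r - v'uq maps the cover into ker q and is
multiplication by r on ker q. -/
lemma SMulFactorsThroughFree.exists_section {r : R} (h : SMulFactorsThroughFree R M r) {m : ℕ}
    {q : (Fin m → R) →ₗ[R] M} (hq : Function.Surjective q) :
    ∃ s : (Fin m → R) →ₗ[R] LinearMap.ker q, ∀ x : LinearMap.ker q, s x = r • x := by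
  obtain ⟨n, u, v, huv⟩ := h
  obtain ⟨v', hv'⟩ := Module.projective_lifting_property q v hq
  have hv'' : ∀ x, q (v' x) = v x := fun x => LinearMap.congr_fun hv' x
  let s : (Fin m → R) →ₗ[R] (Fin m → R) := r • LinearMap.id - v' ∘ₗ u ∘ₗ q
  refine ⟨s.codRestrict _ fun x => ?_, fun x => Subtype.ext ?_⟩
  · simp [s, hv'', huv]
  · simp [s, show q x.1 = 0 from x.2]

/-- The restriction of homomorphisms from `F` to the kernel of `q`. -/
abbrev resKer {F : Type*} [AddCommGroup F] [Module R F] (q : F →ₗ[R] M) (N : Type*)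
    [AddCommGroup N] [Module R N] : (F →ₗ[R] N) →ₗ[R] (LinearMap.ker q →ₗ[R] N) :=
  LinearMap.lcomp R N (LinearMap.ker q).subtype

/-- Such a scalar r annihilates Ext¹(M,N), the cokernel of restriction to the syzygy: r • g extends
as g composed with the map from `exists_section`. -/
lemma SMulFactorsThroughFree.smul_mem_range_resKer {r : R} (h : SMulFactorsThroughFree R M r)
    {m : ℕ} {q : (Fin m → R) →ₗ[R] M} (hq : Function.Surjective q) (g : LinearMap.ker q →ₗ[R] N) :
    r • g ∈ LinearMap.range (resKer q N) := by
  obtain ⟨s, hs⟩ := h.exists_section hq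
  refine ⟨g ∘ₗ s, ?_⟩
  ext x
  simp [hs]

lemma exact_lcomp_resKer {F : Type*} [AddCommGroup F] [Module R F] {q : F →ₗ[R] M}
    (hq : Function.Surjective q) : Function.Exact (LinearMap.lcomp R N q) (resKer q N) := by
  intro g
  constructor
  · intro hg
    refine ⟨(LinearMap.ker q).liftQ g (fun x hx => LinearMap.congr_fun hg ⟨x, hx⟩) ∘ₗ
      (q.quotKerEquivOfSurjective hq).symm.toLinearMap, ?_⟩
    ext x
    have : (q.quotKerEquivOfSurjective hq).symm (q x) = (LinearMap.ker q).mkQ x := by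
      rw [LinearEquiv.symm_apply_eq]
      rfl
    simp only [LinearMap.lcomp_apply, LinearMap.comp_apply, LinearEquiv.coe_coe, this]
    exact (LinearMap.ker q).liftQ_apply g x
  · rintro ⟨k, rfl⟩
    ext x
    have : q x.1 = 0 := x.2
    simp [this]

lemma lcomp_injective {F : Type*} [AddCommGroup F] [Module R F] {q : F →ₗ[R] M}
    (hq : Function.Surjective q) : Function.Injective (LinearMap.lcomp R N q) := by
  intro a b hab
  ext x
  obtain ⟨y, rfl⟩ := hq x
  exact LinearMap.congr_fun hab y

end Module

namespace Module.ProjDimLT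

variable {S R : Type u} [CommRing S] [CommRing R] [Algebra S R] {Z₁ Z₂ Z₃ : Type u}
  [AddCommGroup Z₁] [Module S Z₁] [Module R Z₁] [IsScalarTower S R Z₁]
  [AddCommGroup Z₂] [Module S Z₂] [Module R Z₂] [IsScalarTower S R Z₂]
  [AddCommGroup Z₃] [Module S Z₃] [Module R Z₃] [IsScalarTower S R Z₃]
  {i : Z₁ →ₗ[R] Z₂} {p : Z₂ →ₗ[R] Z₃} (hi : Function.Injective i) (hip : Function.Exact i p)
  (hp : Function.Surjective p)

include hi hip hp

lemma left_of_tower {n : ℕ} (h₂ : ProjDimLT S Z₂ n) (h₃ : ProjDimLT S Z₃ (n + 1)) :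
    ProjDimLT S Z₁ n :=
  left (f := i.restrictScalars S) (g := p.restrictScalars S) hi hip hp h₂ h₃

lemma right_of_tower {n : ℕ} (h₁ : ProjDimLT S Z₁ n) (h₂ : ProjDimLT S Z₂ (n + 1)) :
    ProjDimLT S Z₃ (n + 1) :=
  right (f := i.restrictScalars S) (g := p.restrictScalars S) hi hip hp h₁ h₂

end Module.ProjDimLT

/-- Over a regular local ring of dimension `k + 1`, a kernel of a map between modules of projective
dimension less than `k` has projective dimension less than `k`. -/
lemma IsRegularLocalRing.projDimLT_of_exact {S : Type u} [CommRing S] [IsRegularLocalRing S] {k : ℕ}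
    (hd : (maximalIdeal S).spanFinrank = k + 1) {H P Q : Type u} [AddCommGroup H] [Module S H]
    [AddCommGroup P] [Module S P] [AddCommGroup Q] [Module S Q] [Module.Finite S Q]
    {i : H →ₗ[S] P} {g : P →ₗ[S] Q} (hi : Function.Injective i) (hig : Function.Exact i g)
    (hP : ProjDimLT S P k) (hQ : ProjDimLT S Q k) : ProjDimLT S H k := by
  -- The image of g is a syzygy of its cokernel, whose projective dimension is at most the global
  -- dimension k + 1. Passing to the kernel of g gains one more.
  have h1 : ProjDimLT S (LinearMap.range g) (k + 1) :=
    ProjDimLT.left (Submodule.injective_subtype _)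
      (by rw [LinearMap.exact_iff, Submodule.ker_mkQ, Submodule.range_subtype])
      (Submodule.mkQ_surjective (LinearMap.range g)) (hQ.mono (by omega))
      (IsRegularLocalRing.projDimLT_succ hd _)
  refine ProjDimLT.left hi (g := g.rangeRestrict) ?_ g.surjective_rangeRestrict hP h1
  rwa [LinearMap.exact_iff, LinearMap.ker_rangeRestrict, ← LinearMap.exact_iff]

namespace IsHypersurfaceQuotient

variable {S R : Type u} [CommRing S] [CommRing R] [Algebra S R] {f : S}

lemma isNoetherianRing (hR : IsHypersurfaceQuotient S R f) : IsNoetherianRing R :=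
  let := hR.isRegularLocalRing
  isNoetherianRing_of_surjective S R _ hR.surjective

lemma finite (hR : IsHypersurfaceQuotient S R f) : Module.Finite S R :=
  Module.Finite.of_surjective (Algebra.linearMap S R) hR.surjective

lemma finite_of_finite (hR : IsHypersurfaceQuotient S R f) (X : Type*) [AddCommGroup X] [Module S X]
    [Module R X] [IsScalarTower S R X] [Module.Finite R X] : Module.Finite S X :=
  have := hR.finite
  Module.Finite.trans R X

lemma projDimLT_two_self (hR : IsHypersurfaceQuotient S R f) : ProjDimLT S R 2 := by
  let := hR.isRegularLocalRing
  refine ProjDimLT.right (f := LinearMap.mulLeft S f) (g := Algebra.linearMap S R) (n := 1)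
    (mul_right_injective₀ hR.ne_zero) (fun s => ?_) hR.surjective (ProjDimLT.one_iff.2 inferInstance)
    ((ProjDimLT.one_iff.2 inferInstance).mono (by omega))
  rw [Algebra.linearMap_apply, hR.algebraMap_eq_zero_iff]
  exact ⟨fun ⟨t, ht⟩ => ⟨t, ht.symm⟩, fun ⟨t, ht⟩ => ⟨t, ht.symm⟩⟩

lemma projDimLT_two_fin (hR : IsHypersurfaceQuotient S R f) (n : ℕ) :
    ProjDimLT S (Fin n → R) 2 :=
  hR.projDimLT_two_self.pi n

lemma maximalIdeal_map [IsLocalRing S] [IsLocalRing R] (hR : IsHypersurfaceQuotient S R f) :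
    (maximalIdeal S).map (algebraMap S R) = maximalIdeal R :=
  IsLocalRing.map_maximalIdeal_of_surjective (algebraMap S R) hR.surjective

/-! ### Vanishing of Ext¹(M,N) -/

section extension

variable {M N : Type u} [AddCommGroup M] [Module S M]
  [Module R M] [IsScalarTower S R M] [AddCommGroup N] [Module S N] [Module R N]
  [IsScalarTower S R N]

lemma projDimLT_two_ker (hR : IsHypersurfaceQuotient S R f) (hM : ProjDimLT S M 3) {m : ℕ}
    {q : (Fin m → R) →ₗ[R] M} (hq : Function.Surjective q) :
    ProjDimLT S (LinearMap.ker q) 2 :=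
  ProjDimLT.left_of_tower (Submodule.injective_subtype _) (LinearMap.exact_subtype_ker_map q) hq
    (hR.projDimLT_two_fin m) hM

lemma projDimLT_linearMap_fin {k : ℕ} (hN : ProjDimLT S N k) (m : ℕ) :
    ProjDimLT S ((Fin m → R) →ₗ[R] N) k :=
  (hN.pi m).of_equiv ((Module.piEquiv (Fin m) R N).restrictScalars S)

variable [IsRegularLocalRing S] [IsLocalRing R] [IsNoetherianRing R]

/-- A weakly regular sequence of length `k` bounds the projective dimension over `S`. -/
lemma projDimLT_of_isWeaklyRegular (hR : IsHypersurfaceQuotient S R f) [Module.Finite R M]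
    {n : ℕ} {rs : List R} (hd : (maximalIdeal S).spanFinrank + 1 = n + rs.length)
    (hrs : ∀ r ∈ rs, r ∈ maximalIdeal R) (reg : RingTheory.Sequence.IsWeaklyRegular M rs) :
    ProjDimLT S M n := by
  have := hR.finite_of_finite M
  obtain ⟨ss, rfl⟩ : ∃ ss : List S, ss.map (algebraMap S R) = rs :=
    ⟨rs.map (Function.surjInv hR.surjective), by
      simp [List.map_map, Function.comp_def, Function.surjInv_eq hR.surjective]⟩
  rw [RingTheory.Sequence.isWeaklyRegular_map_algebraMap_iff] at reg
  rw [List.length_map] at hd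
  refine (ProjDimLT.add_length_iff reg fun s hs => ?_).1 (hd ▸ IsRegularLocalRing.projDimLT_succ rfl _)
  by_contra h
  have h1 : IsUnit s := by simpa using h
  exact (IsLocalRing.mem_maximalIdeal _).1 (hrs _ (List.mem_map_of_mem hs)) (h1.map (algebraMap S R))

/-- A second syzygy over a hypersurface of dimension three. -/
lemma projDimLT_three_of_exact (hR : IsHypersurfaceQuotient S R f)
    (hd : (maximalIdeal S).spanFinrank = 4) {a b : ℕ} {i : M →ₗ[R] (Fin a → R)}
    {g : (Fin a → R) →ₗ[R] (Fin b → R)} (hi : Function.Injective i) (hig : Function.Exact i g) :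
    ProjDimLT S M 3 := by
  have := hR.finite
  exact IsRegularLocalRing.projDimLT_of_exact (k := 3) hd (i := i.restrictScalars S) (g := g.restrictScalars S) hi hig
    ((hR.projDimLT_two_fin a).mono (by omega)) ((hR.projDimLT_two_fin b).mono (by omega))

/-- The module of homomorphisms into a second syzygy. -/
lemma projDimLT_linearMap (hR : IsHypersurfaceQuotient S R f)
    (hd : (maximalIdeal S).spanFinrank = 4) [Module.Finite R M] [Module.Finite R N]
    (hN : ProjDimLT S N 3) : ProjDimLT S (M →ₗ[R] N) 3 := by
  obtain ⟨m, q, hq⟩ := Module.Finite.exists_fin' R M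
  obtain ⟨m', q', hq'⟩ := Module.Finite.exists_fin' R (LinearMap.ker q)
  have := hR.finite_of_finite ((Fin m' → R) →ₗ[R] N)
  -- A presentation of M exhibits Hom(M,N) as the kernel of a map N^m → N^m'.
  refine IsRegularLocalRing.projDimLT_of_exact (k := 3) hd (i := (LinearMap.lcomp R N q).restrictScalars S)
    (g := (LinearMap.lcomp R N q' ∘ₗ resKer q N).restrictScalars S) (lcomp_injective hq) ?_
    (projDimLT_linearMap_fin hN m) (projDimLT_linearMap_fin hN m')
  intro g
  refine Iff.trans ?_ (exact_lcomp_resKer hq g)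
  exact map_eq_zero_iff _ (lcomp_injective hq')

/-- Homomorphisms from a syzygy of `M` to `N` extend if `Hom(M, N)` has maximal depth. -/
theorem range_resKer_eq_top (hR : IsHypersurfaceQuotient S R f)
    (hd : (maximalIdeal S).spanFinrank = 4) [Module.Finite R N]
    (hN : ProjDimLT S N 3) (hMN : ProjDimLT S (M →ₗ[R] N) 2) {k : ℕ}
    (hk : ∀ r ∈ maximalIdeal R ^ k, SMulFactorsThroughFree R M r) {m : ℕ}
    {q : (Fin m → R) →ₗ[R] M} (hq : Function.Surjective q) :
    LinearMap.range (resKer q N) = ⊤ := by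
  have := hR.finite_of_finite (LinearMap.ker q →ₗ[R] N)
  -- The image is Hom(F,N)/Hom(M,N); this is where maximal depth of Hom(M,N) saves one degree.
  have h1 : ProjDimLT S (LinearMap.range (resKer q N)) 3 := by
    refine ProjDimLT.right_of_tower (n := 2) (lcomp_injective (N := N) hq)
      (p := (resKer q N).rangeRestrict) ?_
      (LinearMap.surjective_rangeRestrict _) hMN (projDimLT_linearMap_fin hN m)
    intro g
    rw [← exact_lcomp_resKer hq g]
    exact Subtype.ext_iff
  -- This quotient is Ext¹(M,N). Projective dimension below 4 = dim S, together with annihilation by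
  -- a power of 𝔪, makes it zero.
  have h2 : ProjDimLT S ((LinearMap.ker q →ₗ[R] N) ⧸ LinearMap.range (resKer q N)) 4 := by
    refine ProjDimLT.right_of_tower (n := 3) (Submodule.injective_subtype _)
      (p := (LinearMap.range (resKer q N)).mkQ) ?_
      (Submodule.mkQ_surjective _) h1 ((hR.projDimLT_linearMap hd hN).mono (by omega))
    rw [LinearMap.exact_iff, Submodule.ker_mkQ, Submodule.range_subtype]
  have := hR.finite_of_finite ((LinearMap.ker q →ₗ[R] N) ⧸ LinearMap.range (resKer q N))
  rw [← Submodule.Quotient.subsingleton_iff]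
  refine IsRegularLocalRing.subsingleton_of_projDimLT hd h2 (k := k) fun s hs z => ?_
  obtain ⟨g, rfl⟩ := Submodule.mkQ_surjective _ z
  rw [← algebraMap_smul R, ← map_smul, Submodule.mkQ_apply, Submodule.Quotient.mk_eq_zero]
  refine (hk _ ?_).smul_mem_range_resKer hq g
  rw [← hR.maximalIdeal_map, ← Ideal.map_pow]
  exact Ideal.mem_map_of_mem _ hs

end extension

end IsHypersurfaceQuotient

/-! ### Exact pairs of matrices and duality -/

section

variable {R : Type u} [CommRing R] {p n c : ℕ} {α β : Matrix (Fin p) (Fin p) R}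
  {φ ψ : Matrix (Fin n) (Fin n) R} {L N : Type u} [AddCommGroup L] [Module R L]
  [AddCommGroup N] [Module R N]

lemma IsExactPair.exact (h : IsExactPair α β) : Function.Exact β.mulVecLin α.mulVecLin := by
  intro v
  constructor
  · intro hv
    obtain ⟨w, hw⟩ := h.exists_of_mulVec v hv
    exact ⟨w, hw.symm⟩
  · rintro ⟨w, rfl⟩
    rw [Matrix.mulVecLin_apply, Matrix.mulVecLin_apply, Matrix.mulVec_mulVec, h.mul_eq_zero,
      Matrix.zero_mulVec]

/-- Linear forms that vanish on the kernel of a surjection descend. -/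
lemma LinearMap.exists_comp_eq_of_surjective {P Z : Type*} [AddCommGroup P] [Module R P]
    [AddCommGroup Z] [Module R Z] {π : P →ₗ[R] L} (hπ : Function.Surjective π) (g : P →ₗ[R] Z)
    (hg : ∀ x, π x = 0 → g x = 0) : ∃ g' : L →ₗ[R] Z, ∀ x, g' (π x) = g x := by
  obtain ⟨g', hg'⟩ := (exact_lcomp_resKer (N := Z) hπ g).1 (by ext x; exact hg _ x.2)
  exact ⟨g', fun x => LinearMap.congr_fun hg' x⟩

/-- The dual of the cokernel of `α` is the cokernel of the transpose of `α`. -/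
lemma IsExactPair.isCokerOf_dual (h : IsExactPair α β) (hL : IsCokerOf α L) :
    IsCokerOf α.transpose (Dual R L) := by
  obtain ⟨π, hπ, hαπ⟩ := hL
  -- As βα = 0, the form y ↦ ⟨x, βy⟩ descends to coker α. Exactness of the transposed pair shows
  -- that all forms arise so, with x unique modulo im αᵀ.
  let δ : (Fin p → R) →ₗ[R] ((Fin p → R) →ₗ[R] R) :=
    LinearMap.lcomp R R β.mulVecLin ∘ₗ (dotProductBilin R R : (Fin p → R) →ₗ[R] _)
  have hδ : ∀ x y, δ x y = dotProduct x (β.mulVec y) := fun x y => rfl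
  have hδ' : ∀ x y, δ x y = dotProduct (β.transpose.mulVec x) y := fun x y => by
    rw [hδ, Matrix.dotProduct_mulVec, Matrix.mulVec_transpose]
  have hmem : ∀ x, δ x ∈ LinearMap.range (LinearMap.lcomp R R π) := fun x => by
    refine (exact_lcomp_resKer hπ _).1 ?_
    ext ⟨y, hy⟩
    obtain ⟨z, rfl⟩ := (hαπ y).1 hy
    change δ x (α.mulVec z) = 0
    rw [hδ, Matrix.mulVec_mulVec, h.mul_eq_zero', Matrix.zero_mulVec, dotProduct_zero]
  let e := LinearEquiv.ofInjective _ (lcomp_injective (N := R) hπ)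
  have hρ : ∀ x y, (e.symm.toLinearMap ∘ₗ δ.codRestrict _ hmem) x (π y) = δ x y := fun x y => by
    have : (e (e.symm (δ.codRestrict _ hmem x))).1 y = δ x y := by
      rw [LinearEquiv.apply_symm_apply]
      rfl
    exact this
  refine ⟨e.symm.toLinearMap ∘ₗ δ.codRestrict _ hmem, fun g => ?_, fun x => ?_⟩
  · obtain ⟨x, hx⟩ := h.exists_of_transpose (fun i => g (π (Pi.single i 1))) (by
      ext i
      have : π (α.mulVec (Pi.single i 1)) = 0 := hαπ.apply_apply_eq_zero _
      have h2 : α.mulVec (Pi.single i 1) = ∑ j, α j i • (Pi.single j 1 : Fin p → R) := by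
        ext k
        simp [Finset.sum_apply, Pi.single_apply]
      rw [h2, map_sum] at this
      have h3 := congrArg g this
      simpa [Matrix.mulVec, dotProduct] using h3)
    refine ⟨x, ?_⟩
    refine LinearMap.ext fun z => ?_
    obtain ⟨y, rfl⟩ := hπ z
    rw [hρ, hδ', ← hx]
    conv_rhs => rw [pi_eq_sum_univ' y]
    simp [dotProduct, mul_comm]
  · constructor
    · intro hx
      obtain ⟨w, hw⟩ := h.exists_of_transpose' x (by
        ext i
        have := hρ x (Pi.single i 1)
        rw [hx, hδ'] at this
        simpa using this.symm)
      exact ⟨w, hw.symm⟩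
    · rintro ⟨w, rfl⟩
      refine LinearMap.ext fun z => ?_
      obtain ⟨y, rfl⟩ := hπ z
      rw [hρ, hδ', Matrix.mulVecLin_apply, Matrix.mulVec_mulVec, ← Matrix.transpose_mul,
        h.mul_eq_zero, Matrix.transpose_zero, Matrix.zero_mulVec, zero_dotProduct]
      rfl

/-- Dualizing twice transposes α twice, so L is isomorphic to its bidual, which is projective when
the dual is. -/
lemma IsExactPair.projective_of_dual [IsLocalRing R] (h : IsExactPair α β) (hL : IsCokerOf α L)
    (hp : Module.Projective R (Dual R L)) : Module.Projective R L := by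
  have h1 := h.isCokerOf_dual hL
  have h2 := h.transpose.isCokerOf_dual h1
  rw [Matrix.transpose_transpose] at h2
  obtain ⟨π, hπ, -⟩ := id h1
  have : Module.Finite R (Dual R L) := Module.Finite.of_surjective π hπ
  obtain ⟨e⟩ := h2.nonempty_equiv hL
  exact Module.Projective.of_equiv e

/-- The chain homotopy by which a scalar acting through a free module kills the homology of an
exact pair. -/
lemma IsExactPair.exists_homotopy (h : IsExactPair φ ψ) {ι : (Fin n → R) →ₗ[R] (Fin c → R)}
    {ε : (Fin c → R) →ₗ[R] N} (hε : Function.Surjective ε) (hιε : Function.Exact ι ε)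
    (hφι : Function.Exact φ.mulVecLin ι) {r : R} (hr : SMulFactorsThroughFree R N r) :
    (∃ H H' : Matrix (Fin n) (Fin n) R, r • 1 = H * φ + ψ * H') ∧
      ∃ H H' : Matrix (Fin n) (Fin n) R, r • 1 = H * ψ + φ * H' := by
  -- s is multiplication by r on ker ε; lifted through ι it becomes σ with ισι = rι. So r - σι has
  -- columns in ker ι = im φ, while σι kills im φ. Exactness of the pair then produces the remaining
  -- homotopies one after another.
  obtain ⟨s, hs⟩ := hr.exists_section hε
  let ι' : (Fin n → R) →ₗ[R] LinearMap.ker ε :=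
    ι.codRestrict _ fun v => hιε.apply_apply_eq_zero v
  have hι' : Function.Surjective ι' := by
    rintro ⟨x, hx⟩
    obtain ⟨v, rfl⟩ := (hιε x).1 hx
    exact ⟨v, rfl⟩
  obtain ⟨σ, hσ⟩ := Module.projective_lifting_property ι' s hι'
  have hσ' : ∀ v, ι (σ (ι v)) = r • ι v := fun v => by
    have h1 := LinearMap.congr_fun hσ (ι v)
    have h2 := hs (ι' v)
    exact congrArg Subtype.val (h1.trans h2)
  set T : Matrix (Fin n) (Fin n) R := LinearMap.toMatrix' (σ ∘ₗ ι) with hT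
  have hT' : ∀ v, T.mulVec v = σ (ι v) := fun v => by
    rw [hT, LinearMap.toMatrix'_mulVec]; rfl
  obtain ⟨H, hH⟩ : ∃ H : Matrix (Fin n) (Fin n) R, r • 1 - T = φ * H := by
    refine Matrix.exists_eq_mul_of_forall_col fun j => ?_
    obtain ⟨w, hw⟩ := (hφι ((r • 1 - T).mulVec (Pi.single j 1))).1 (by
      rw [Matrix.sub_mulVec, hT', map_sub, hσ', Matrix.smul_mulVec, Matrix.one_mulVec, map_smul,
        sub_self])
    refine ⟨w, ?_⟩
    rw [← Matrix.mulVecLin_apply, hw]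
    ext i
    simp
  have hTφ : T * φ = 0 := by
    refine Matrix.ext_of_mulVec_single fun j => ?_
    rw [← Matrix.mulVec_mulVec, hT', ← Matrix.mulVecLin_apply, hφι.apply_apply_eq_zero, map_zero,
      Matrix.zero_mulVec]
  obtain ⟨H', hH'⟩ := h.exists_eq_mul_left (G := r • 1 - H * φ) (by
    rw [Matrix.mul_sub, ← Matrix.mul_assoc, ← hH, Matrix.sub_mul, hTφ]
    simp)
  have h1 : r • 1 = H * φ + ψ * H' := by rw [← hH']; abel
  obtain ⟨H'', hH''⟩ := h.swap.exists_eq_mul_left (G := r • 1 - H' * ψ) (by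
    have := congrArg (· * ψ) hH'
    simp only [Matrix.sub_mul, Matrix.mul_assoc, h.mul_eq_zero, Matrix.mul_zero, sub_zero] at this
    rw [Matrix.mul_sub, ← this]
    simp)
  exact ⟨⟨H, H', h1⟩, H', H'', by rw [← hH'']; abel⟩

/-- The homotopies of `exists_homotopy` show that 𝔪^k annihilates both homologies, which are
finitely generated. -/
lemma IsExactPair.hasFiniteHomology [IsLocalRing R] [IsNoetherianRing R] (h : IsExactPair φ ψ)
    {ι : (Fin n → R) →ₗ[R] (Fin c → R)}
    {ε : (Fin c → R) →ₗ[R] N} (hε : Function.Surjective ε) (hιε : Function.Exact ι ε)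
    (hφι : Function.Exact φ.mulVecLin ι) {k : ℕ}
    (hk : ∀ r ∈ maximalIdeal R ^ k, SMulFactorsThroughFree R N r) : HasFiniteHomology φ ψ := by
  intro X _ _ _
  have key : ∀ {φ ψ : Matrix (Fin n) (Fin n) R}, (∀ r ∈ maximalIdeal R ^ k,
      ∃ H H' : Matrix (Fin n) (Fin n) R, r • 1 = H * φ + ψ * H') →
      Module.length R (Matrix.PairHomology φ ψ X) ≠ ⊤ := by
    intro φ ψ hr
    have : Module.Finite R (Matrix.PairHomology φ ψ X) := by
      unfold Matrix.PairHomology LinearMap.Homology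
      infer_instance
    rw [Module.length_ne_top_iff]
    refine isFiniteLength_of_pow_smul_eq_zero k fun r hrk x => ?_
    obtain ⟨H, H', hH⟩ := hr r hrk
    refine LinearMap.Homology.smul_eq_zero (fun v hv => ⟨H'.act X v, ?_⟩) x
    rw [← Matrix.act_smul_one, hH, Matrix.act_add, Matrix.act_mul, Matrix.act_mul, hv, map_zero,
      zero_add]
  exact ⟨key fun r hr => (h.exists_homotopy hε hιε hφι (hk r hr)).1,
    key fun r hr => (h.exists_homotopy hε hιε hφι (hk r hr)).2⟩

/-- If homomorphisms `L → N` extend to a free module, then `Tor` of the dual of `L` and the syzygy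
of `N` vanishes in even degrees. -/
lemma IsExactPair.torZero_dual (hα : IsExactPair α β) (hφ : IsExactPair φ ψ) {M : Type u}
    [AddCommGroup M] [Module R M] {m : ℕ} {q : (Fin m → R) →ₗ[R] M}
    (hL : IsCokerOf α (LinearMap.ker q)) (hres : LinearMap.range (resKer q N) = ⊤)
    {ι : Matrix (Fin c) (Fin n) R}
    {ε : (Fin c → R) →ₗ[R] N} (hε : Function.Surjective ε) (hιε : Function.Exact ι.mulVecLin ε)
    (hφι : Function.Exact φ.mulVecLin ι.mulVecLin) :
    TorZero ψ φ (Dual R (LinearMap.ker q)) := by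
  obtain ⟨π, hπ, hαπ⟩ := hL
  intro v hv
  have hcol : ∀ {k l : ℕ} (G : Matrix (Fin k) (Fin l) R) j, (fun i => G i j) =
      G.mulVec (Pi.single j 1) := fun G j => by ext i; simp
  have hιφ : ι * φ = 0 := by
    refine Matrix.ext_of_mulVec_single fun j => ?_
    rw [← Matrix.mulVec_mulVec, ← Matrix.mulVecLin_apply, ← Matrix.mulVecLin_apply,
      hφι.apply_apply_eq_zero, Matrix.zero_mulVec]
  -- A tuple of forms on L is a matrix G with Gα = 0, and the cycle condition reads ψG = 0.
  let G : Matrix (Fin n) (Fin p) R := LinearMap.toMatrix' (LinearMap.pi fun j => v j ∘ₗ π)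
  have hG : ∀ x j, G.mulVec x j = v j (π x) := fun x j => by
    rw [LinearMap.toMatrix'_mulVec]; rfl
  have hGα : G * α = 0 := by
    refine Matrix.ext_of_mulVec_single fun j => funext fun i => ?_
    rw [← Matrix.mulVec_mulVec, hG, ← Matrix.mulVecLin_apply, hαπ.apply_apply_eq_zero, map_zero,
      Matrix.zero_mulVec]
    rfl
  have hψG : ψ * G = 0 := by
    refine Matrix.ext_of_mulVec_single fun j => funext fun i => ?_
    have := LinearMap.congr_fun (congrFun hv i) (π (Pi.single j 1))
    rw [Matrix.act_apply, LinearMap.sum_apply] at this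
    rw [← Matrix.mulVec_mulVec, Matrix.zero_mulVec, Matrix.mulVec, dotProduct]
    simpa [hG] using this
  -- G is continued to a chain map: G = G₁β and ιG₁ = G₂α. Then εG₂ induces a homomorphism L → N.
  obtain ⟨G₁, hG₁⟩ := hα.exists_eq_mul_right hGα
  obtain ⟨K, hK⟩ := hφ.swap.exists_eq_mul_left hψG
  obtain ⟨G₂, hG₂⟩ := hα.swap.exists_eq_mul_right (G := ι * G₁) (by
    rw [Matrix.mul_assoc, ← hG₁, hK, ← Matrix.mul_assoc, hιφ, Matrix.zero_mul])
  obtain ⟨g, hg⟩ := LinearMap.exists_comp_eq_of_surjective hπ (ε ∘ₗ G₂.mulVecLin) (by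
    intro x hx
    obtain ⟨y, rfl⟩ := (hαπ x).1 hx
    rw [LinearMap.comp_apply, Matrix.mulVecLin_apply, Matrix.mulVecLin_apply, Matrix.mulVec_mulVec,
      ← hG₂, ← Matrix.mulVec_mulVec, ← Matrix.mulVecLin_apply, hιε.apply_apply_eq_zero])
  -- That homomorphism extends to the cover of M; a lift of the extension to R^c, restricted to L,
  -- is Q. It starts a null-homotopy, continued by G₂ - Q = ιP and G₁ - Pα = φW.
  obtain ⟨g', hg'⟩ := LinearMap.range_eq_top.1 hres g
  obtain ⟨g'', hg''⟩ := Module.projective_lifting_property ε g' hε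
  let Q : Matrix (Fin c) (Fin p) R :=
    LinearMap.toMatrix' (g'' ∘ₗ (LinearMap.ker q).subtype ∘ₗ π)
  have hQ : ∀ x, Q.mulVec x = g'' (π x) := fun x => by
    rw [LinearMap.toMatrix'_mulVec]; rfl
  have hQα : Q * α = 0 := by
    refine Matrix.ext_of_mulVec_single fun j => ?_
    rw [← Matrix.mulVec_mulVec, hQ, ← Matrix.mulVecLin_apply, hαπ.apply_apply_eq_zero,
      Submodule.coe_zero, map_zero, Matrix.zero_mulVec]
  obtain ⟨P, hP⟩ : ∃ P : Matrix (Fin n) (Fin p) R, G₂ - Q = ι * P := by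
    refine Matrix.exists_eq_mul_of_forall_col fun j => ?_
    rw [hcol]
    obtain ⟨w, hw⟩ := (hιε ((G₂ - Q).mulVec (Pi.single j 1))).1 (by
      rw [Matrix.sub_mulVec, hQ, map_sub, sub_eq_zero]
      have h1 := hg (Pi.single j 1)
      rw [← hg'] at h1
      refine h1.symm.trans ?_
      exact (LinearMap.congr_fun hg'' _).symm)
    exact ⟨w, hw.symm⟩
  obtain ⟨W, hW⟩ : ∃ W : Matrix (Fin n) (Fin p) R, G₁ - P * α = φ * W := by
    refine Matrix.exists_eq_mul_of_forall_col fun j => ?_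
    rw [hcol]
    obtain ⟨w, hw⟩ := (hφι ((G₁ - P * α).mulVec (Pi.single j 1))).1 (by
      have : ι * (G₁ - P * α) = 0 := by
        rw [Matrix.mul_sub, ← Matrix.mul_assoc, ← hP, hG₂, Matrix.sub_mul, hQα]
        simp
      rw [Matrix.mulVecLin_apply, Matrix.mulVec_mulVec, this, Matrix.zero_mulVec])
    exact ⟨w, hw.symm⟩
  -- Since βα = 0, the rows of Wβ descend to forms on L, and φ maps this tuple to v.
  have hGW : G = φ * (W * β) := by
    rw [← Matrix.mul_assoc, ← hW, Matrix.sub_mul, Matrix.mul_assoc, hα.mul_eq_zero, hG₁]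
    simp
  have : ∀ j, ∃ w : Dual R (LinearMap.ker q), ∀ x, w (π x) = (W * β).mulVec x j := fun j => by
    obtain ⟨w, hw⟩ := LinearMap.exists_comp_eq_of_surjective hπ
      (LinearMap.proj j ∘ₗ (W * β).mulVecLin) (by
        intro x hx
        obtain ⟨y, rfl⟩ := (hαπ x).1 hx
        simp [Matrix.mulVec_mulVec, hα.mul_eq_zero'])
    exact ⟨w, hw⟩
  choose w hw using this
  refine ⟨w, funext fun i => LinearMap.ext fun z => ?_⟩
  obtain ⟨x, rfl⟩ := hπ z
  rw [← hG, hGW, ← Matrix.mulVec_mulVec, Matrix.act_apply, LinearMap.sum_apply]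
  simp [Matrix.mulVec, dotProduct, hw]

end

/-! ### The theta invariant over a hypersurface of dimension three -/

section

variable {S R : Type u} [CommRing S] [CommRing R] [Algebra S R] {f : S} {p n : ℕ}
  {A B : Matrix (Fin p) (Fin p) S} {X : Type u} [AddCommGroup X] [Module S X] [Module R X]
  [IsScalarTower S R X]

lemma Matrix.act_map_algebraMap {ι κ : Type*} [Fintype κ] (Φ : Matrix ι κ S) (v : κ → X) :
    (Φ.map (algebraMap S R)).act X v = Φ.act X v := by
  ext i
  simp [Matrix.act_apply]

lemma torZero_map_algebraMap {Φ Ψ : Matrix (Fin n) (Fin n) S} :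
    TorZero (Φ.map (algebraMap S R)) (Ψ.map (algebraMap S R)) X ↔ TorZero Φ Ψ X := by
  simp only [TorZero, Matrix.act_map_algebraMap]

lemma IsMatrixFactorization.isCokerOf_map_iff (hR : IsHypersurfaceQuotient S R f)
    (h : IsMatrixFactorization f A B) :
    IsCokerOf (A.map (algebraMap S R)) X ↔ IsCokerOf A X := by
  have h1 : IsCokerOf (A.map (algebraMap S R)) (A.QuotCoker R) :=
    ⟨Submodule.mkQ _, Submodule.mkQ_surjective _, by rw [LinearMap.exact_iff, Submodule.ker_mkQ]⟩
  constructor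
  · intro h2
    obtain ⟨e⟩ := h1.nonempty_equiv h2
    exact (h.isCokerOf_quotCoker hR).of_equiv (e.restrictScalars S)
  · intro h2
    obtain ⟨e⟩ := (h.isCokerOf_quotCoker hR).nonempty_equiv h2
    exact h1.of_equiv (e.extendScalarsOfSurjective hR.surjective)

lemma torZero_iff_subsingleton {φ ψ : Matrix (Fin n) (Fin n) R} :
    TorZero φ ψ X ↔ Subsingleton (Matrix.PairHomology φ ψ X) := by
  rw [Matrix.PairHomology, LinearMap.Homology.subsingleton_iff]
  simp only [TorZero, LinearMap.mem_range, eq_comm]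

end

/-! ### Duals of syzygies, and the cases of a free syzygy -/

section

variable {R : Type u} [CommRing R] [IsLocalRing R] [IsNoetherianRing R] {n c m : ℕ}
  {φ ψ : Matrix (Fin n) (Fin n) R} {M N : Type u} [AddCommGroup M] [Module R M]
  [AddCommGroup N] [Module R N]

/-- The theta invariant changes sign under passing to the dual of a syzygy. -/
lemma pairTheta_dual_ker (h : IsExactPair φ ψ) (hfin : HasFiniteHomology φ ψ)
    (hdim : ∃ p : Ideal R, p.IsPrime ∧ p ≠ maximalIdeal R) {k : ℕ} [Module.Finite R M]
    (hk : ∀ r ∈ maximalIdeal R ^ k, SMulFactorsThroughFree R M r)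
    {q : (Fin m → R) →ₗ[R] M} (hq : Function.Surjective q) :
    pairTheta φ ψ (Dual R M) = - pairTheta φ ψ (Dual R (LinearMap.ker q)) := by
  have hex : Function.Exact (LinearMap.lcomp R R q) (resKer q R).rangeRestrict := by
    rw [LinearMap.exact_iff, LinearMap.ker_rangeRestrict, ← LinearMap.exact_iff]
    exact exact_lcomp_resKer hq
  have hs := LinearMap.surjective_rangeRestrict (resKer q R)
  have h1 := h.pairTheta_add hfin (X₃ := LinearMap.range (resKer q R))
    (lcomp_injective (N := R) hq) hex hs
  have h2 := h.pairTheta_add hfin (X₁ := LinearMap.range (resKer q R))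
    (X₂ := LinearMap.ker q →ₗ[R] R)
    (X₃ := (LinearMap.ker q →ₗ[R] R) ⧸ LinearMap.range (resKer q R))
    (i := (LinearMap.range (resKer q R)).subtype)
    (p := (LinearMap.range (resKer q R)).mkQ) (Submodule.injective_subtype _)
    (by rw [LinearMap.exact_iff, Submodule.ker_mkQ, Submodule.range_subtype])
    (Submodule.mkQ_surjective _)
  -- This quotient is Ext¹(M,R), which is killed by 𝔪^k.
  have h3 : pairTheta φ ψ ((LinearMap.ker q →ₗ[R] R) ⧸ LinearMap.range (resKer q R)) = 0 := by
    refine pairTheta_eq_zero_of_isFiniteLength h hfin hdim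
      (isFiniteLength_of_pow_smul_eq_zero k fun r hr z => ?_)
    obtain ⟨g, rfl⟩ := Submodule.mkQ_surjective _ z
    rw [← map_smul, Submodule.mkQ_apply, Submodule.Quotient.mk_eq_zero]
    exact (hk r hr).smul_mem_range_resKer hq g
  have h4 : pairTheta φ ψ ((Fin m → R) →ₗ[R] R) = 0 := h.pairTheta_eq_zero_of_free _
  rw [h4] at h1
  rw [h3] at h2
  change pairTheta φ ψ (M →ₗ[R] R) = - pairTheta φ ψ (LinearMap.ker q →ₗ[R] R)
  linarith

/-- If the syzygy of `M` is free and homomorphisms from it to `N` extend, then `M` is free or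
`N` is zero. -/
lemma projective_or_subsingleton_of_projective_ker [Module.Finite R N]
    {q : (Fin m → R) →ₗ[R] M} (hq : Function.Surjective q)
    (hqm : ∀ v, q v = 0 → ∀ i, v i ∈ maximalIdeal R) (hres : LinearMap.range (resKer q N) = ⊤)
    (hp : Module.Projective R (LinearMap.ker q)) : Module.Projective R M ∨ Subsingleton N := by
  have hfree : Module.Free R (LinearMap.ker q) := Module.free_of_flat_of_isLocalRing
  let b := Module.Free.chooseBasis R (LinearMap.ker q)
  rcases isEmpty_or_nonempty (Module.Free.ChooseBasisIndex R (LinearMap.ker q)) with he | ⟨⟨i⟩⟩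
  · left
    have : Subsingleton (LinearMap.ker q) := b.repr.toEquiv.subsingleton
    have hinj : Function.Injective q := by
      rw [← LinearMap.ker_eq_bot]
      exact Submodule.subsingleton_iff_eq_bot.1 this
    exact Module.Projective.of_equiv (LinearEquiv.ofBijective q ⟨hinj, hq⟩)
  · right
    -- Any x in N is the value at a basis vector of the syzygy of a homomorphism that extends to the
    -- cover; that vector lies in 𝔪 times the cover.
    have htop : (⊤ : Submodule R N) ≤ maximalIdeal R • ⊤ := by
      intro x _
      obtain ⟨g, hg⟩ := LinearMap.range_eq_top.1 hres (b.constr R fun _ => x)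
      have h1 : g (b i : Fin m → R) = x := by
        have := LinearMap.congr_fun hg (b i)
        simpa using this
      rw [← h1, pi_eq_sum_univ' (b i : Fin m → R), map_sum]
      refine Submodule.sum_mem _ fun j _ => ?_
      rw [map_smul]
      exact Submodule.smul_mem_smul (hqm _ (b i).2 j) trivial
    have := Submodule.eq_bot_of_le_smul_of_le_jacobson_bot (maximalIdeal R) _
      Module.Finite.fg_top htop (maximalIdeal_le_jacobson _)
    exact Submodule.subsingleton_iff R |>.1 (subsingleton_of_bot_eq_top this.symm)

/-- If the syzygy of `N ≠ 0` is free and homomorphisms to `N` extend, homomorphisms to `R` extend. -/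
lemma range_resKer_self_eq_top [Module.Finite R M] {q : (Fin m → R) →ₗ[R] M}
    {ε : (Fin c → R) →ₗ[R] N} (hε : Function.Surjective ε)
    (hεm : ∀ v, ε v = 0 → ∀ i, v i ∈ maximalIdeal R) (hc : 0 < c)
    (hres : LinearMap.range (resKer q N) = ⊤) {κ : Type*} [Fintype κ]
    (b : Basis κ R (LinearMap.ker ε)) :
    LinearMap.range (resKer q R) = ⊤ := by
  rw [eq_top_iff]
  refine Submodule.le_of_le_smul_of_le_jacobson_bot (I := maximalIdeal R) Module.Finite.fg_top
    (maximalIdeal_le_jacobson _) ?_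
  intro g _
  let j : Fin c := ⟨0, hc⟩
  let G : LinearMap.ker q →ₗ[R] (Fin c → R) := LinearMap.single R (fun _ => R) j ∘ₗ g
  obtain ⟨g', hg'⟩ := LinearMap.range_eq_top.1 hres (ε ∘ₗ G)
  obtain ⟨g'', hg''⟩ := Module.projective_lifting_property ε g' hε
  -- With g placed in coordinate j, εG extends to the cover and the extension lifts to g''. The
  -- difference D has values in ker ε, whose basis vectors have entries in 𝔪, so g is extendable
  -- modulo 𝔪.
  let D : LinearMap.ker q →ₗ[R] LinearMap.ker ε :=
    (G - g'' ∘ₗ (LinearMap.ker q).subtype).codRestrict _ fun x => by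
      have h1 := LinearMap.congr_fun hg' x
      have h2 := LinearMap.congr_fun hg'' x
      simp only [LinearMap.comp_apply, LinearMap.lcomp_apply, Submodule.subtype_apply] at h1 h2
      simp [h1, h2]
  have hg : g = resKer q R (LinearMap.proj j ∘ₗ g'') +
      ∑ k, (b k : Fin c → R) j • (b.coord k ∘ₗ D) := by
    ext x
    have h1 : (D x : Fin c → R) = G x - g'' x := rfl
    have h2 : g x = G x j := by simp [G]
    have h3 := congrArg (LinearMap.proj j ∘ₗ (LinearMap.ker ε).subtype : _ →ₗ[R] R)
      (b.sum_repr (D x))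
    rw [map_sum] at h3
    simp only [map_smul, LinearMap.comp_apply, Submodule.subtype_apply, LinearMap.proj_apply,
      smul_eq_mul, h1, Pi.sub_apply] at h3
    simp only [LinearMap.add_apply, LinearMap.lcomp_apply, LinearMap.comp_apply,
      Submodule.subtype_apply, LinearMap.proj_apply, LinearMap.sum_apply, LinearMap.smul_apply,
      Basis.coord_apply, smul_eq_mul, mul_comm ((b _ : Fin c → R) j), h3, h2]
    ring
  rw [hg]
  refine Submodule.add_mem_sup ⟨_, rfl⟩ (Submodule.sum_mem _ fun k _ => ?_)
  exact Submodule.smul_mem_smul (hεm _ (b k).2 j) trivial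

/-- Post-composition with `ε`, as a linear map on families of linear forms. -/
def LinearMap.piComp (M : Type u) [AddCommGroup M] [Module R M] (ε : (Fin c → R) →ₗ[R] N) :
    (Fin c → Dual R M) →ₗ[R] (M →ₗ[R] N) where
  toFun h := ε ∘ₗ LinearMap.pi h
  map_add' g h := LinearMap.ext fun x => map_add ε (fun j => g j x) fun j => h j x
  map_smul' r h := LinearMap.ext fun x => map_smul ε r fun j => h j x

lemma LinearMap.piComp_apply (ε : (Fin c → R) →ₗ[R] N) (h : Fin c → Dual R M) (x : M) :
    LinearMap.piComp M ε h x = ε fun j => h j x := rfl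

/-- If the syzygy of `N` is free and homomorphisms from the syzygy of `M` extend, homomorphisms from
`M` to `N` lift. -/
lemma piComp_surjective {q : (Fin m → R) →ₗ[R] M} (hq : Function.Surjective q)
    {ε : (Fin c → R) →ₗ[R] N} (hε : Function.Surjective ε)
    (hres : LinearMap.range (resKer q R) = ⊤) {κ : Type*} [Fintype κ]
    (b : Basis κ R (LinearMap.ker ε)) : Function.Surjective (LinearMap.piComp M ε) := by
  intro g
  obtain ⟨G, hG⟩ := Module.projective_lifting_property ε (g ∘ₗ q) hε
  have hG' : ∀ x, ε (G x) = g (q x) := fun x => LinearMap.congr_fun hG x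
  let D : LinearMap.ker q →ₗ[R] LinearMap.ker ε :=
    (G ∘ₗ (LinearMap.ker q).subtype).codRestrict _ fun x => by
      simp [hG', show q x.1 = 0 from x.2]
  choose H hH using fun k => LinearMap.range_eq_top.1 hres (b.coord k ∘ₗ D)
  have hH' : ∀ k (x : LinearMap.ker q), H k x = b.repr (D x) k := fun k x =>
    LinearMap.congr_fun (hH k) x
  -- The coordinates of G on ker q, with respect to the basis of ker ε, are extended to the cover
  -- and subtracted. The result has the same composite with ε and now vanishes on ker q.
  let G' : (Fin m → R) →ₗ[R] (Fin c → R) := G - ∑ k, (H k).smulRight (b k : Fin c → R)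
  have hG'' : ∀ x, ε (G' x) = g (q x) := fun x => by
    simp [G', hG', show ∀ k, ε (b k : Fin c → R) = 0 from fun k => (b k).2]
  obtain ⟨g', hg'⟩ := LinearMap.exists_comp_eq_of_surjective hq G' (by
    intro x hx
    have h3 := congrArg Subtype.val (b.sum_repr (D ⟨x, hx⟩))
    have h4 : (D ⟨x, hx⟩ : Fin c → R) = G x := rfl
    rw [h4] at h3
    simp only [G', LinearMap.sub_apply, ← h3, LinearMap.sum_apply, LinearMap.smulRight_apply]
    simp [← hH' _ ⟨x, hx⟩])
  refine ⟨fun j => LinearMap.proj j ∘ₗ g', ?_⟩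
  ext x
  obtain ⟨y, rfl⟩ := hq x
  rw [LinearMap.piComp_apply, ← hG'', ← hg']
  rfl

end

/-! ### Sign of theta and the case of equality -/

namespace IsHypersurfaceQuotient

variable {S R : Type u} [CommRing S] [CommRing R] [Algebra S R] {f : S} [IsRegularLocalRing S]
  [IsLocalRing R] [IsNoetherianRing R] {M N : Type u} [AddCommGroup M] [Module R M]
  [AddCommGroup N] [Module S N] [Module R N] [IsScalarTower S R N]

lemma mem_maximalIdeal_of_algebraMap {s : S} (hs : algebraMap S R s ∈ maximalIdeal R) :
    s ∈ maximalIdeal S := by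
  by_contra h
  have h1 : IsUnit s := by simpa using h
  exact (IsLocalRing.mem_maximalIdeal _).1 hs (h1.map (algebraMap S R))

/-- A count of generators and relations: if `N` has a free syzygy, homomorphisms from `M` to `N`
lift to a minimal free cover of `N`, and `Hom(M, N)` and `Hom(M, R)` are of maximal depth, then `N`
is free or `Hom(M, R)` is zero. -/
lemma eq_zero_or_subsingleton_dual (hR : IsHypersurfaceQuotient S R f) [Module.Finite R M]
    {c s : ℕ} {ε : (Fin c → R) →ₗ[R] N} (hεm : ∀ v, ε v = 0 → ∀ i, v i ∈ maximalIdeal R)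
    (b : Basis (Fin s) R (LinearMap.ker ε))
    (hsurj : Function.Surjective (LinearMap.piComp M ε))
    (hM : ProjDimLT S (Dual R M) 2) (hMN : ProjDimLT S (M →ₗ[R] N) 2) :
    s = 0 ∨ Subsingleton (Dual R M) := by
  have := hR.finite_of_finite (Dual R M)
  obtain ⟨r, A, B, π, hAB, hπ, hAπ, hAm, -⟩ :=
    exists_isMatrixFactorization hR.ne_zero hR.smul_eq_zero hM
  choose β hβ using fun k j => hR.surjective ((b k : Fin c → R) j)
  have hβm : ∀ k j, β k j ∈ maximalIdeal S := fun k j => by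
    refine mem_maximalIdeal_of_algebraMap (R := R) ?_
    rw [hβ]
    exact hεm _ (b k).2 j
  have hrep : ∀ {h : Fin c → Dual R M}, LinearMap.piComp M ε h = 0 →
      ∃ u : Fin s → Dual R M, ∀ j, h j = ∑ k, β k j • u k := by
    intro h hh
    let D : M →ₗ[R] LinearMap.ker ε := (LinearMap.pi h).codRestrict _ fun x =>
      LinearMap.congr_fun hh x
    refine ⟨fun k => b.coord k ∘ₗ D, fun j => LinearMap.ext fun x => ?_⟩
    have h3 := congrArg (LinearMap.proj j ∘ₗ (LinearMap.ker ε).subtype : _ →ₗ[R] R)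
      (b.sum_repr (D x))
    rw [map_sum] at h3
    simp only [map_smul, LinearMap.comp_apply, Submodule.subtype_apply, LinearMap.proj_apply,
      smul_eq_mul] at h3
    refine h3.symm.trans ?_
    rw [LinearMap.sum_apply]
    refine Finset.sum_congr rfl fun k _ => ?_
    rw [LinearMap.smul_apply, Algebra.smul_def, hβ, mul_comm]
    rfl
  have hzero : ∀ {u : Fin s → Dual R M}, (∀ j, ∑ k, β k j • u k = 0) → u = 0 := by
    intro u hu
    ext k x
    have h1 : ∑ k, u k x • b k = 0 := by
      refine Subtype.ext (funext fun j => ?_)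
      have h2 := LinearMap.congr_fun (hu j) x
      rw [LinearMap.sum_apply] at h2
      simp only [LinearMap.smul_apply, Algebra.smul_def, hβ] at h2
      simpa [mul_comm] using h2
    exact Fintype.linearIndependent_iff.1 b.linearIndependent _ h1 k
  have hε0 : ∀ u : Fin s → Dual R M, LinearMap.piComp M ε (fun j => ∑ k, β k j • u k) = 0 := by
    intro u
    refine LinearMap.ext fun x => ?_
    rw [LinearMap.piComp_apply]
    have : (fun j => (∑ k, β k j • u k) x) = ((∑ k, u k x • b k : LinearMap.ker ε) : Fin c → R) := by
      ext j
      rw [LinearMap.sum_apply]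
      simp only [LinearMap.smul_apply, Algebra.smul_def, hβ]
      simp [mul_comm]
    rw [this]
    exact (∑ k, u k x • b k : LinearMap.ker ε).2
  let C : (Fin r × Fin c → S) →ₗ[S] (Fin c → Dual R M) :=
    LinearMap.pi fun j => π ∘ₗ LinearMap.funLeft S S fun i => (i, j)
  have hC : ∀ V j, C V j = π fun i => V (i, j) := fun V j => rfl
  have hCs : Function.Surjective C := fun v => by
    choose V hV using fun j => hπ (v j)
    exact ⟨fun ij => V ij.2 ij.1, funext hV⟩
  -- Hom(M,N) is (M*)^c modulo (M*)^s, embedded by β, and M* is the cokernel of the r × r matrix A: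
  -- rc generators and rc + rs relations. Equality of the two numbers forces rs = 0.
  let Θ : ((Fin r × Fin c) ⊕ (Fin r × Fin s) → S) →ₗ[S] (Fin r × Fin c → S) :=
    LinearMap.pi fun ij => (∑ k, A ij.1 k • LinearMap.proj (Sum.inl (k, ij.2))) +
      ∑ k, β k ij.2 • LinearMap.proj (Sum.inr (ij.1, k))
  have hΘ : ∀ v j, (fun i => Θ v (i, j)) = A.mulVec (fun i => v (Sum.inl (i, j))) +
      ∑ k, β k j • fun i => v (Sum.inr (i, k)) := by
    intro v j
    ext i
    simp [Θ, Matrix.mulVec, dotProduct]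
  have hCΘ : ∀ v j, C (Θ v) j = ∑ k, β k j • π fun i => v (Sum.inr (i, k)) := by
    intro v j
    rw [hC, hΘ, map_add, ← Matrix.mulVecLin_apply, hAπ.apply_apply_eq_zero, zero_add, map_sum]
    simp only [map_smul]
  have hcard := card_eq_of_projDimLT_two hR.ne_zero (Z := M →ₗ[R] N) hR.smul_eq_zero hMN
    ((LinearMap.piComp M ε).restrictScalars S ∘ₗ C) (hsurj.comp hCs) Θ ?_ ?_
  · simp only [Fintype.card_sum, Fintype.card_prod, Fintype.card_fin] at hcard
    have : r * s = 0 := by omega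
    rcases Nat.mul_eq_zero.1 this with rfl | h
    · exact Or.inr hπ.subsingleton
    · exact Or.inl h
  · intro V
    rw [LinearMap.comp_apply, LinearMap.restrictScalars_apply]
    constructor
    · intro hV
      obtain ⟨u, hu⟩ := hrep hV
      choose w hw using fun k => hπ (u k)
      have h1 : ∀ j, ∃ x, A.mulVecLin x = (fun i => V (i, j)) - ∑ k, β k j • w k := fun j => by
        refine (hAπ _).1 ?_
        rw [map_sub, ← hC, hu, map_sum, sub_eq_zero]
        simp only [map_smul, hw]
      choose x hx using h1
      refine ⟨Sum.elim (fun ij => x ij.2 ij.1) fun ik => w ik.2 ik.1, ?_⟩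
      ext ⟨i, j⟩
      have := hΘ (Sum.elim (fun ij => x ij.2 ij.1) fun ik => w ik.2 ik.1) j
      refine (congrFun this i).trans ?_
      have h2 := congrFun (hx j) i
      rw [Matrix.mulVecLin_apply] at h2
      simp only [Sum.elim_inl, Sum.elim_inr, Pi.add_apply]
      rw [h2]
      simp
    · rintro ⟨v, rfl⟩
      rw [show C (Θ v) = _ from funext (hCΘ v)]
      exact hε0 _
  · intro v hv
    have h1 := hzero (u := fun k => π fun i => v (Sum.inr (i, k))) (fun j => by
      rw [← hCΘ, hv, map_zero]; rfl)
    choose w hw using fun k => (hAπ _).1 (congrFun h1 k)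
    have hmem : ∀ x : Fin r → S, ∀ i, A.mulVec x i ∈ maximalIdeal S := fun x i => by
      rw [Matrix.mulVec, dotProduct]
      exact Ideal.sum_mem _ fun j _ => Ideal.mul_mem_right _ _ (hAm i j)
    have h2 : ∀ j, (fun i => v (Sum.inl (i, j))) + ∑ k, β k j • w k = 0 := fun j => by
      apply hAB.mulVec_injective hR.ne_zero
      have h3 := hΘ v j
      rw [hv] at h3
      rw [← Matrix.mulVecLin_apply, map_add, map_sum]
      simp only [map_smul, hw]
      exact h3.symm
    rintro (⟨i, j⟩ | ⟨i, k⟩)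
    · have h3 := congrFun (h2 j) i
      rw [Pi.add_apply, Pi.zero_apply] at h3
      rw [eq_neg_of_add_eq_zero_left h3, Finset.sum_apply]
      exact (Ideal.neg_mem_iff _).2
        (Ideal.sum_mem _ fun k _ => Ideal.mul_mem_right _ _ (hβm k j))
    · have h3 := congrFun (hw k) i
      rw [← h3]
      exact hmem _ i

/-- The theta invariant of reflexive modules over a hypersurface of dimension three, computed from a
periodic resolution. -/
theorem exists_isExactPair_pairTheta_nonpos (hR : IsHypersurfaceQuotient S R f)
    (hd : (maximalIdeal S).spanFinrank = 4)
    (hdim : ∃ p : Ideal R, p.IsPrime ∧ p ≠ maximalIdeal R)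
    [Module S M] [IsScalarTower S R M] [Module.Finite R M] [Module.Finite R N] {a b a' b' k : ℕ}
    {i : M →ₗ[R] (Fin a → R)} {g : (Fin a → R) →ₗ[R] (Fin b → R)}
    (hi : Function.Injective i) (hig : Function.Exact i g)
    {i' : N →ₗ[R] (Fin a' → R)} {g' : (Fin a' → R) →ₗ[R] (Fin b' → R)}
    (hi' : Function.Injective i') (hig' : Function.Exact i' g')
    (hkM : ∀ r ∈ maximalIdeal R ^ k, SMulFactorsThroughFree R M r)
    (hkN : ∀ r ∈ maximalIdeal R ^ k, SMulFactorsThroughFree R N r)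
    (hMN : ProjDimLT S (M →ₗ[R] N) 2) :
    ∃ (c n : ℕ) (ε : (Fin c → R) →ₗ[R] N) (ι : (Fin n → R) →ₗ[R] (Fin c → R))
      (φ ψ : Matrix (Fin n) (Fin n) R), Function.Surjective ε ∧ Function.Exact ι ε ∧
      Function.Exact φ.mulVecLin ι ∧ IsExactPair φ ψ ∧ HasFiniteHomology φ ψ ∧
      pairTheta φ ψ (Dual R M) ≤ 0 ∧
      (pairTheta φ ψ (Dual R M) = 0 ↔ Module.Free R M ∨ Module.Free R N) := by
  obtain ⟨m, q, hq, hqm, -⟩ := IsLocalRing.exists_minimal_cover R M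
  obtain ⟨c, ε, hε, hεm, -⟩ := IsLocalRing.exists_minimal_cover R N
  have hN3 := hR.projDimLT_three_of_exact hd hi' hig'
  have hL2 := hR.projDimLT_two_ker (hR.projDimLT_three_of_exact hd hi hig) hq
  have hY2 := hR.projDimLT_two_ker hN3 hε
  have := hR.finite_of_finite (LinearMap.ker q)
  have := hR.finite_of_finite (LinearMap.ker ε)
  have := hR.finite_of_finite (Dual R (LinearMap.ker q))
  obtain ⟨p, A, B, π, hAB, hπ, hAπ, -⟩ :=
    exists_isMatrixFactorization hR.ne_zero hR.smul_eq_zero hL2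
  obtain ⟨n, Φ, Ψ, π', hΦ, hπ', hΦπ, -⟩ :=
    exists_isMatrixFactorization hR.ne_zero hR.smul_eq_zero hY2
  have hY : IsCokerOf Φ (LinearMap.ker ε) := ⟨π', hπ', hΦπ⟩
  have hα := hAB.isExactPair hR
  have hφ := hΦ.isExactPair hR
  have hLR := (hAB.isCokerOf_map_iff hR).2 ⟨π, hπ, hAπ⟩
  obtain ⟨ρ, hρ, hφρ⟩ := (hΦ.isCokerOf_map_iff hR).2 hY
  have hLd : ProjDimLT S (Dual R (LinearMap.ker q)) 2 := by
    have h1 := hα.isCokerOf_dual hLR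
    rw [← Matrix.transpose_map] at h1
    exact hAB.transpose.projDimLT_two hR.ne_zero ((hAB.transpose.isCokerOf_map_iff hR).1 h1)
  set φ := Φ.map (algebraMap S R)
  set ψ := Ψ.map (algebraMap S R)
  let ι : Matrix (Fin c) (Fin n) R := LinearMap.toMatrix' ((LinearMap.ker ε).subtype ∘ₗ ρ)
  have hι : ∀ v, ι.mulVecLin v = (ρ v : Fin c → R) := fun v => by
    rw [Matrix.mulVecLin_apply, LinearMap.toMatrix'_mulVec]; rfl
  have hιε : Function.Exact ι.mulVecLin ε := by
    intro v
    constructor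
    · intro hv
      obtain ⟨w, hw⟩ := hρ ⟨v, hv⟩
      exact ⟨w, by rw [hι, hw]⟩
    · rintro ⟨w, rfl⟩
      rw [hι]
      exact (ρ w).2
  have hφι : Function.Exact φ.mulVecLin ι.mulVecLin := by
    intro v
    rw [← hφρ v, hι, Submodule.coe_eq_zero]
  have hres := hR.range_resKer_eq_top hd hN3 hMN hkM hq
  have hfin := hφ.hasFiniteHomology hε hιε hφι hkN
  have hθ := pairTheta_dual_ker hφ hfin hdim hkM hq
  -- This kills ker ψ/im φ, the odd Tor of L* and N; theta of L* is therefore a length.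
  have hT := hα.torZero_dual hφ hLR hres hε hιε hφι
  have hT' := torZero_iff_subsingleton.1 hT
  have hθL : pairTheta φ ψ (Dual R (LinearMap.ker q)) =
      (Module.length R (Matrix.PairHomology φ ψ (Dual R (LinearMap.ker q)))).toNat := by
    rw [pairTheta, Module.length_eq_zero_iff.2 hT']
    simp
  have freeN : Subsingleton N → Module.Free R N := fun _ => Module.Free.of_subsingleton R N
  refine ⟨c, n, ε, ι.mulVecLin, φ, ψ, hε, hιε, hφι, hφ, hfin, by rw [hθ, hθL]; simp, ?_, ?_⟩
  · intro h0
    have h1 : Module.length R (Matrix.PairHomology φ ψ (Dual R (LinearMap.ker q))) = 0 := by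
      rw [hθ, hθL, neg_eq_zero, Nat.cast_eq_zero, ENat.toNat_eq_zero] at h0
      exact h0.resolve_right (hfin _).1
    have h2 := torZero_iff_subsingleton.2 (Module.length_eq_zero_iff.1 h1)
    rcases projective_or_projective_of_torZero hR hΦ hLd hY (torZero_map_algebraMap.1 h2)
      (torZero_map_algebraMap.1 hT) with h | h
    · have h3 := hα.projective_of_dual hLR h
      rcases projective_or_subsingleton_of_projective_ker hq hqm hres h3 with h | h
      · exact Or.inl Module.free_of_flat_of_isLocalRing
      · exact Or.inr (freeN h)
    -- Here the syzygy of N is free. For c = 0 the module N is zero; otherwise homomorphisms to R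
    -- extend, so M* has maximal depth and the count of generators and relations applies.
    · rcases Nat.eq_zero_or_pos c with rfl | hc
      · exact Or.inr (freeN hε.subsingleton)
      have : Module.Free R (LinearMap.ker ε) := Module.free_of_flat_of_isLocalRing
      have b := Module.finBasis R (LinearMap.ker ε)
      have hresR := range_resKer_self_eq_top hε hεm hc hres b
      have hM2 : ProjDimLT S (Dual R M) 2 :=
        ProjDimLT.left_of_tower (lcomp_injective (N := R) hq) (exact_lcomp_resKer hq)
          (LinearMap.range_eq_top.1 hresR) (projDimLT_linearMap_fin hR.projDimLT_two_self m)
          (hLd.mono (by omega))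
      rcases hR.eq_zero_or_subsingleton_dual hεm b (piComp_surjective hq hε hresR b) hM2 hMN
        with h | h
      · right
        rw [h] at b
        have : Subsingleton (LinearMap.ker ε) := b.repr.toEquiv.subsingleton
        have hinj : Function.Injective ε := by
          rw [← LinearMap.ker_eq_bot]
          exact Submodule.subsingleton_iff_eq_bot.1 this
        exact Module.Free.of_equiv (LinearEquiv.ofBijective ε ⟨hinj, hε⟩)
      -- M embeds into a free module, so M* = 0 forces M = 0.
      · left
        have : Subsingleton M := ⟨fun x y => hi (funext fun j => LinearMap.congr_fun
          (Subsingleton.elim (LinearMap.proj j ∘ₗ i : Dual R M) 0) x |>.trans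
          (LinearMap.congr_fun (Subsingleton.elim 0 (LinearMap.proj j ∘ₗ i : Dual R M)) y))⟩
        exact Module.Free.of_subsingleton R M
  · rintro (h | h)
    · exact hφ.pairTheta_eq_zero_of_free _
    -- For free N the scalar 1 factors through a free module, and the homotopy with r = 1 makes both
    -- homologies vanish.
    · have h1 : SMulFactorsThroughFree R N 1 := by
        let e := (Module.finBasis R N).equivFun
        exact ⟨_, e.toLinearMap, e.symm.toLinearMap, fun x => by simp⟩
      have key : ∀ {φ ψ : Matrix (Fin n) (Fin n) R},
          (∃ H H' : Matrix (Fin n) (Fin n) R, (1 : R) • 1 = H * φ + ψ * H') →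
          Subsingleton (Matrix.PairHomology φ ψ (Dual R M)) := by
        rintro φ ψ ⟨H, H', hH⟩
        refine torZero_iff_subsingleton.1 fun v hv => ⟨H'.act _ v, ?_⟩
        have h3 := Matrix.act_smul_one (1 : R) v
        rw [one_smul R v, hH, Matrix.act_add, Matrix.act_mul, Matrix.act_mul, hv, map_zero,
          zero_add] at h3
        exact h3.symm
      have h2 := hφ.exists_homotopy hε hιε hφι h1
      rw [pairTheta, Module.length_eq_zero_iff.2 (key h2.1), Module.length_eq_zero_iff.2 (key h2.2)]
      simp

end IsHypersurfaceQuotient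

/-! ### Tor from an explicit resolution -/

lemma CategoryTheory.ShortComplex.length_moduleCatLeftHomologyData_H {A : Type u} [CommRing A]
    (T : ShortComplex (ModuleCat.{u} A)) : Module.length A T.moduleCatLeftHomologyData.H =
      Module.length A (LinearMap.Homology T.f.hom T.g.hom) := by
  obtain ⟨e⟩ := LinearMap.Homology.nonempty_equiv (f := T.f.hom)
    (g := T.g.hom) (k := (LinearMap.ker T.g.hom).subtype)
    (q := (LinearMap.range T.moduleCatToCycles).mkQ)
    (Submodule.injective_subtype _) (LinearMap.exact_subtype_ker_map _)
    (Submodule.mkQ_surjective _) (fun x => by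
      rw [Submodule.mkQ_apply, Submodule.Quotient.mk_eq_zero]
      exact ⟨fun ⟨y, hy⟩ => ⟨y, congrArg Subtype.val hy⟩, fun ⟨y, hy⟩ => ⟨y, Subtype.ext hy⟩⟩)
  exact e.length_eq

/-- A projective resolution, given by linear maps. -/
structure LinearResolution (A : Type u) [CommRing A] (N : Type u) [AddCommGroup N] [Module A N] where
  /-- The modules of the resolution. -/
  X : ℕ → ModuleCat.{u} A
  projective : ∀ n, Module.Projective A (X n)
  /-- The differentials. -/
  d : ∀ n, X (n + 1) →ₗ[A] X n
  /-- The augmentation. -/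
  ε : X 0 →ₗ[A] N
  surjective : Function.Surjective ε
  exact_zero : Function.Exact (d 0) ε
  exact_succ : ∀ n, Function.Exact (d (n + 1)) (d n)

namespace LinearResolution

variable {A : Type u} [CommRing A] {N : Type u} [AddCommGroup N] [Module A N]
  (P : LinearResolution A N)

/-- The underlying complex. -/
noncomputable def complex : ChainComplex (ModuleCat.{u} A) ℕ :=
  ChainComplex.of P.X (fun n => ModuleCat.ofHom (P.d n)) fun n => by
    ext x
    exact (P.exact_succ n).apply_apply_eq_zero x

lemma complex_d (n : ℕ) : P.complex.d (n + 1) n = ModuleCat.ofHom (P.d n) :=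
  ChainComplex.of_d P.X (fun n => ModuleCat.ofHom (P.d n)) n

/-- The augmentation of the underlying complex. -/
noncomputable def π : P.complex ⟶ (ChainComplex.single₀ (ModuleCat.{u} A)).obj (ModuleCat.of A N) :=
  (P.complex.toSingle₀Equiv _).symm ⟨ModuleCat.ofHom P.ε, by
    rw [P.complex_d]
    ext x
    exact P.exact_zero.apply_apply_eq_zero x⟩

lemma π_f_zero : P.π.f 0 = ModuleCat.ofHom P.ε :=
  ChainComplex.toSingle₀Equiv_symm_apply_f_zero _ _

lemma quasiIso : QuasiIso P.π where
  quasiIsoAt m := by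
    cases m with
    | zero =>
      rw [ChainComplex.quasiIsoAt₀_iff, ShortComplex.quasiIso_iff_of_zeros' _ rfl rfl rfl]
      constructor
      · rw [ShortComplex.moduleCat_exact_iff]
        intro x hx
        obtain ⟨y, hy⟩ := (P.exact_zero x).1 (by
          have : (P.π.f 0).hom x = 0 := hx
          rwa [P.π_f_zero] at this)
        refine ⟨y, ?_⟩
        change (P.complex.d 1 0).hom y = x
        rw [P.complex_d]
        exact hy
      · change Epi (P.π.f 0)
        rw [ModuleCat.epi_iff_surjective, P.π_f_zero]
        exact P.surjective
    | succ m =>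
      rw [quasiIsoAt_iff_exactAt' (hL := ChainComplex.exactAt_succ_single_obj ..),
        HomologicalComplex.exactAt_iff' _ (m + 2) (m + 1) m (by simp) (by simp),
        ShortComplex.moduleCat_exact_iff]
      intro x hx
      obtain ⟨y, hy⟩ := (P.exact_succ m x).1 (by
        have : (P.complex.d (m + 1) m).hom x = 0 := hx
        rwa [P.complex_d] at this)
      refine ⟨y, ?_⟩
      change (P.complex.d (m + 2) (m + 1)).hom y = x
      rw [P.complex_d]
      exact hy

/-- The associated projective resolution. -/
noncomputable def toProjectiveResolution : ProjectiveResolution (ModuleCat.of A N) where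
  complex := P.complex
  projective n := by
    have := P.projective n
    exact (IsProjective.iff_projective (P.X n)).1 this
  π := P.π
  quasiIso := P.quasiIso

/-- The length of `Tor`, computed from a resolution. -/
theorem torLength_succ (Y : Type u) [AddCommGroup Y] [Module A Y] (n : ℕ) :
    torLength A Y N (n + 1) = Module.length A
      (LinearMap.Homology ((P.d (n + 1)).lTensor Y) ((P.d n).lTensor Y)) := by
  -- Tor is the left derived functor of Y ⊗ -, so it is the second argument N that gets resolved.
  let F := (MonoidalCategory.tensoringLeft (ModuleCat.{u} A)).obj (ModuleCat.of A Y)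
  let K := (F.mapHomologicalComplex (ComplexShape.down ℕ)).obj P.complex
  have e₁ := P.toProjectiveResolution.isoLeftDerivedObj F (n + 1)
  have e₂ : K.homology (n + 1) ≅ (K.sc' (n + 2) (n + 1) n).homology :=
    ShortComplex.homologyMapIso (K.isoSc' (n + 2) (n + 1) n (by simp) (by simp))
  have e₃ := (K.sc' (n + 2) (n + 1) n).moduleCatHomologyIso
  have h : torLength A Y N (n + 1) = Module.length A
      ((K.sc' (n + 2) (n + 1) n).moduleCatLeftHomologyData.H) :=
    (e₁ ≪≫ e₂ ≪≫ e₃).toLinearEquiv.length_eq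
  rw [h]
  have hd : ∀ m, (K.d (m + 1) m).hom = (P.d m).lTensor Y := fun m => by
    have : K.d (m + 1) m = F.map (ModuleCat.ofHom (P.d m)) := by rw [← P.complex_d]; rfl
    rw [this]
    rfl
  rw [CategoryTheory.ShortComplex.length_moduleCatLeftHomologyData_H]
  change Module.length A (LinearMap.Homology (K.d (n + 2) (n + 1)).hom (K.d (n + 1) n).hom) = _
  rw [hd, hd]
  rfl

end LinearResolution

open scoped TensorProduct

/-! ### Flat base change of homology and Tor -/

section baseChange

variable {A : Type*} [CommRing A] (B : Type*) [CommRing B] [Algebra A B] [Module.Flat A B]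
  {U V W : Type*} [AddCommGroup U] [Module A U] [AddCommGroup V] [Module A V] [AddCommGroup W]
  [Module A W] {f : U →ₗ[A] V} {g : V →ₗ[A] W}

lemma LinearMap.baseChange_exact (h : Function.Exact f g) :
    Function.Exact (f.baseChange B) (g.baseChange B) := by
  have := Module.Flat.lTensor_exact B h
  simpa only [← LinearMap.baseChange_eq_ltensor] using this

lemma LinearMap.baseChange_injective (h : Function.Injective f) :
    Function.Injective (f.baseChange B) := by
  have := Module.Flat.lTensor_preserves_injective_linearMap (M := B) f h
  simpa only [← LinearMap.baseChange_eq_ltensor] using this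

/-- Homology commutes with flat base change. -/
lemma LinearMap.Homology.nonempty_baseChange_equiv (h : ∀ x, g (f x) = 0) :
    Nonempty (B ⊗[A] Homology f g ≃ₗ[B] Homology (f.baseChange B) (g.baseChange B)) := by
  let f' : U →ₗ[A] ker g := f.codRestrict _ h
  have hf' : (ker g).subtype ∘ₗ f' = f := rfl
  have hex : Function.Exact f' ((range f).comap (ker g).subtype).mkQ := by
    rw [LinearMap.exact_iff, Submodule.ker_mkQ]
    ext x
    exact ⟨fun ⟨y, hy⟩ => ⟨y, Subtype.ext hy⟩, fun ⟨y, hy⟩ => ⟨y, congrArg Subtype.val hy⟩⟩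
  have hinj := LinearMap.baseChange_injective B (Submodule.injective_subtype (ker g))
  refine nonempty_equiv (k := (ker g).subtype.baseChange B)
    (q := ((range f).comap (ker g).subtype).mkQ.baseChange B) hinj
    (LinearMap.baseChange_exact B (LinearMap.exact_subtype_ker_map g))
    (LinearMap.baseChange_surjective B (Submodule.mkQ_surjective _)) fun x => ?_
  rw [LinearMap.baseChange_exact B hex x, ← hf', LinearMap.baseChange_comp]
  constructor
  · rintro ⟨y, rfl⟩
    exact ⟨y, rfl⟩
  · rintro ⟨y, hy⟩
    exact ⟨y, hinj hy⟩

end baseChange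

namespace LinearResolution

variable {A : Type u} [CommRing A] {N : Type u} [AddCommGroup N] [Module A N]

variable (A N) in
lemma nonempty : Nonempty (LinearResolution A N) := by
  let P := projectiveResolution (ModuleCat.of A N)
  refine ⟨{ X := P.complex.X
            projective := fun n => (IsProjective.iff_projective (P.complex.X n)).2 (P.projective n)
            d := fun n => (P.complex.d (n + 1) n).hom
            ε := (P.π.f 0).hom
            surjective := ?_
            exact_zero := ?_
            exact_succ := fun n => ?_ }⟩
  · exact (ModuleCat.epi_iff_surjective (P.π.f 0)).1 inferInstance
  · exact (ShortComplex.ShortExact.moduleCat_exact_iff_function_exact _).1 P.exact₀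
  · exact (ShortComplex.ShortExact.moduleCat_exact_iff_function_exact _).1 (P.exact_succ n)

/-- The length of `Tor`, computed from an exact sequence of projective modules. -/
theorem torLength_eq {X : ℕ → Type u} [∀ n, AddCommGroup (X n)] [∀ n, Module A (X n)]
    [∀ n, Module.Projective A (X n)] {d : ∀ n, X (n + 1) →ₗ[A] X n} {ε : X 0 →ₗ[A] N}
    (hε : Function.Surjective ε) (h0 : Function.Exact (d 0) ε)
    (h : ∀ n, Function.Exact (d (n + 1)) (d n)) (Y : Type u) [AddCommGroup Y] [Module A Y] (n : ℕ) :
    torLength A Y N (n + 1) = Module.length A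
      (LinearMap.Homology ((d (n + 1)).lTensor Y) ((d n).lTensor Y)) :=
  LinearResolution.torLength_succ
    { X := fun n => ModuleCat.of A (X n), projective := fun n => inferInstanceAs
        (Module.Projective A (X n)), d := d, ε := ε, surjective := hε, exact_zero := h0,
      exact_succ := h } Y n

end LinearResolution

section

variable {A : Type u} [CommRing A] [IsLocalRing A] (B : Type u) [CommRing B]
  [IsLocalRing B] [Algebra A B] [Module.Flat A B] [IsLocalHom (algebraMap A B)]
  (Y N : Type u) [AddCommGroup Y] [Module A Y] [AddCommGroup N] [Module A N]

/-- By flatness the extended complex resolves B ⊗ N and its homology is the extended homology. The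
length then grows by the length of the closed fibre. -/
lemma torLength_baseChange_of_exact {X : ℕ → Type u} [∀ n, AddCommGroup (X n)]
    [∀ n, Module A (X n)] [∀ n, Module.Projective A (X n)] {d : ∀ n, X (n + 1) →ₗ[A] X n}
    {ε : X 0 →ₗ[A] N} (hε : Function.Surjective ε) (h0 : Function.Exact (d 0) ε)
    (h : ∀ n, Function.Exact (d (n + 1)) (d n)) (n : ℕ) :
    torLength B (B ⊗[A] Y) (B ⊗[A] N) (n + 1) = torLength A Y N (n + 1) *
      Module.length B (B ⧸ (maximalIdeal A).map (algebraMap A B)) := by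
  rw [LinearResolution.torLength_eq hε h0 h, ← IsLocalRing.length_baseChange]
  have h₁ := LinearResolution.torLength_eq (X := fun n => B ⊗[A] X n)
    (d := fun n => (d n).baseChange B) (ε := ε.baseChange B) (N := B ⊗[A] N)
    (LinearMap.baseChange_surjective B hε) (LinearMap.baseChange_exact B h0)
    (fun n => LinearMap.baseChange_exact B (h n)) (B ⊗[A] Y) n
  refine h₁.trans ?_
  obtain ⟨e⟩ := LinearMap.Homology.nonempty_baseChange_equiv B (f := (d (n + 1)).lTensor Y)
    (g := (d n).lTensor Y) (fun x => by
      rw [← LinearMap.comp_apply, ← LinearMap.lTensor_comp,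
        (h n).linearMap_comp_eq_zero, LinearMap.lTensor_zero, LinearMap.zero_apply])
  rw [e.length_eq]
  have key : ∀ (n : ℕ) (x : B ⊗[A] (Y ⊗[A] X (n + 1))),
      TensorProduct.AlgebraTensorModule.distribBaseChange A B Y (X n)
        (((d n).lTensor Y).baseChange B x) = ((d n).baseChange B).lTensor (B ⊗[A] Y)
          (TensorProduct.AlgebraTensorModule.distribBaseChange A B Y (X (n + 1)) x) := by
    intro n x
    induction x with
    | zero => simp only [map_zero]
    | add x y hx hy => simp only [map_add, hx, hy]
    | tmul b x =>
      induction x with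
      | zero => simp only [map_zero, TensorProduct.tmul_zero]
      | add x y hx hy => simp only [map_add, TensorProduct.tmul_add, hx, hy]
      | tmul y x => simp
  refine (LinearMap.Homology.length_eq_of_equiv
    (TensorProduct.AlgebraTensorModule.distribBaseChange A B Y (X (n + 1))) ?_ ?_).symm
  · intro v
    rw [← key, LinearEquiv.map_eq_zero_iff]
  · intro v
    constructor
    · rintro ⟨w, rfl⟩
      exact ⟨_, (key (n + 1) w).symm⟩
    · rintro ⟨w, hw⟩
      refine ⟨(TensorProduct.AlgebraTensorModule.distribBaseChange A B Y _).symm w,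
        (TensorProduct.AlgebraTensorModule.distribBaseChange A B Y (X (n + 1))).injective ?_⟩
      rw [key (n + 1), LinearEquiv.apply_symm_apply, hw]

/-- The lengths of `Tor` under base change to a flat local extension. -/
theorem torLength_baseChange (n : ℕ) :
    torLength B (B ⊗[A] Y) (B ⊗[A] N) (n + 1) = torLength A Y N (n + 1) *
      Module.length B (B ⧸ (maximalIdeal A).map (algebraMap A B)) := by
  obtain ⟨P⟩ := LinearResolution.nonempty A N
  have := P.projective
  exact torLength_baseChange_of_exact B Y N (X := fun n => P.X n) (d := P.d) (ε := P.ε)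
    P.surjective P.exact_zero P.exact_succ n

end

section congr

variable {A : Type u} [CommRing A] {Y Y' N : Type u} [AddCommGroup Y] [Module A Y]
  [AddCommGroup Y'] [Module A Y'] [AddCommGroup N] [Module A N]

lemma torLength_congr (e : Y ≃ₗ[A] Y') (n : ℕ) : torLength A Y N n = torLength A Y' N n :=
  (((Tor (ModuleCat.{u} A) n).mapIso e.toModuleIso).app (ModuleCat.of A N)).toLinearEquiv.length_eq

end congr

/-! ### Periodic resolutions -/

section periodic

variable {R : Type u} [CommRing R] {c n : ℕ} {N : Type u} [AddCommGroup N] [Module R N]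
  {φ ψ : Matrix (Fin n) (Fin n) R}

/-- The maps `φ` in even degrees and `ψ` in odd degrees. -/
def Matrix.altMulVecLin (φ ψ : Matrix (Fin n) (Fin n) R) (k : ℕ) : (Fin n → R) →ₗ[R] (Fin n → R) :=
  if Even k then φ.mulVecLin else ψ.mulVecLin

lemma Matrix.altMulVecLin_of_even {k : ℕ} (hk : Even k) : φ.altMulVecLin ψ k = φ.mulVecLin :=
  if_pos hk

lemma Matrix.altMulVecLin_of_not_even {k : ℕ} (hk : ¬ Even k) :
    φ.altMulVecLin ψ k = ψ.mulVecLin :=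
  if_neg hk

/-- The periodic resolution given by an exact pair of matrices. -/
noncomputable def IsExactPair.resolution (h : IsExactPair φ ψ) {ε : (Fin c → R) →ₗ[R] N}
    {ι : (Fin n → R) →ₗ[R] (Fin c → R)} (hε : Function.Surjective ε) (hιε : Function.Exact ι ε)
    (hφι : Function.Exact φ.mulVecLin ι) : LinearResolution R N where
  X k := k.casesOn (ModuleCat.of R (Fin c → R)) fun _ => ModuleCat.of R (Fin n → R)
  projective k := by
    cases k
    · exact inferInstanceAs (Module.Projective R (Fin c → R))
    · exact inferInstanceAs (Module.Projective R (Fin n → R))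
  -- The alternation is shifted by one: ι comes first, then φ = `d 1` and ψ = `d 2`. So Tor₂ is
  -- computed by ker φ/im ψ.
  d k := k.casesOn ι fun k => φ.altMulVecLin ψ k
  ε := ε
  surjective := hε
  exact_zero := hιε
  exact_succ k := by
    cases k with
    | zero =>
      change Function.Exact (φ.altMulVecLin ψ 0) ι
      rwa [Matrix.altMulVecLin_of_even Even.zero]
    | succ k =>
      change Function.Exact (φ.altMulVecLin ψ (k + 1)) (φ.altMulVecLin ψ k)
      by_cases hk : Even k
      · rw [Matrix.altMulVecLin_of_even hk,
          Matrix.altMulVecLin_of_not_even (by rw [Nat.even_add_one]; simpa using hk)]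
        exact h.exact
      · rw [Matrix.altMulVecLin_of_not_even hk,
          Matrix.altMulVecLin_of_even (Nat.even_add_one.2 hk)]
        exact h.swap.exact

lemma length_homology_lTensor (φ ψ : Matrix (Fin n) (Fin n) R) (Y : Type u) [AddCommGroup Y]
    [Module R Y] : Module.length R (LinearMap.Homology (ψ.mulVecLin.lTensor Y)
      (φ.mulVecLin.lTensor Y)) = Module.length R (Matrix.PairHomology φ ψ Y) := by
  have key : ∀ (φ : Matrix (Fin n) (Fin n) R) (x : Y ⊗[R] (Fin n → R)),
      TensorProduct.piScalarRight R R Y (Fin n) (φ.mulVecLin.lTensor Y x) =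
        φ.act Y (TensorProduct.piScalarRight R R Y (Fin n) x) := by
    intro φ x
    induction x with
    | zero => simp only [map_zero]
    | add x y hx hy => simp only [map_add, hx, hy]
    | tmul y x =>
      ext i
      simp [Matrix.act_apply, Matrix.mulVec, dotProduct, Finset.sum_smul, smul_smul]
  refine LinearMap.Homology.length_eq_of_equiv (TensorProduct.piScalarRight R R Y (Fin n)) ?_ ?_
  · intro v
    rw [← key, LinearEquiv.map_eq_zero_iff]
  · intro v
    constructor
    · rintro ⟨w, rfl⟩
      exact ⟨_, (key ψ w).symm⟩
    · rintro ⟨w, hw⟩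
      refine ⟨(TensorProduct.piScalarRight R R Y (Fin n)).symm w,
        (TensorProduct.piScalarRight R R Y (Fin n)).injective ?_⟩
      rw [key, LinearEquiv.apply_symm_apply, hw]

variable (h : IsExactPair φ ψ) {ε : (Fin c → R) →ₗ[R] N}
    {ι : (Fin n → R) →ₗ[R] (Fin c → R)} (hε : Function.Surjective ε) (hιε : Function.Exact ι ε)
    (hφι : Function.Exact φ.mulVecLin ι) (Y : Type u) [AddCommGroup Y] [Module R Y]

include h hε hιε hφι

lemma IsExactPair.torLength_even (e : ℕ) : torLength R Y N (2 * e + 2) =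
    Module.length R (Matrix.PairHomology φ ψ Y) := by
  rw [← length_homology_lTensor, (h.resolution hε hιε hφι).torLength_succ Y (2 * e + 1)]
  change Module.length R (LinearMap.Homology
    ((φ.altMulVecLin ψ (2 * e + 1)).lTensor Y)
    ((φ.altMulVecLin ψ (2 * e)).lTensor Y)) = _
  rw [Matrix.altMulVecLin_of_even (even_two_mul e), Matrix.altMulVecLin_of_not_even (by simp)]

/-- The odd degrees start at 3: in degree 1 the kernel is taken of ι rather than of ψ. -/
lemma IsExactPair.torLength_odd (e : ℕ) : torLength R Y N (2 * (e + 1) + 1) =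
    Module.length R (Matrix.PairHomology ψ φ Y) := by
  rw [← length_homology_lTensor, (h.resolution hε hιε hφι).torLength_succ Y (2 * (e + 1))]
  change Module.length R (LinearMap.Homology
    ((φ.altMulVecLin ψ (2 * e + 2)).lTensor Y)
    ((φ.altMulVecLin ψ (2 * e + 1)).lTensor Y)) = _
  rw [Matrix.altMulVecLin_of_even (by simp [parity_simps]), Matrix.altMulVecLin_of_not_even (by simp)]

end periodic

open scoped TensorProduct

/-! ### Reflexive modules as second syzygies -/

section dualPresentation

variable {R : Type u} [CommRing R] {M : Type u} [AddCommGroup M] [Module R M]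

/-- A finitely generated reflexive module over a Noetherian ring is a second syzygy. -/
theorem Module.exists_exact_of_isReflexive (R : Type u) [CommRing R] [IsNoetherianRing R]
    (M : Type u) [AddCommGroup M] [Module R M] [Module.Finite R M] [Module.IsReflexive R M] :
    ∃ (a b : ℕ) (i : M →ₗ[R] (Fin a → R)) (g : (Fin a → R) →ₗ[R] (Fin b → R)),
      Function.Injective i ∧ Function.Exact i g := by
  have : Module.FinitePresentation R (Dual R M) := Module.finitePresentation_of_finite R _
  obtain ⟨a, b, q, T, hq, hT⟩ := Module.FinitePresentation.exists_fin' R (Dual R M)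
  -- The dual of a presentation R^b → R^a → M* → 0 is 0 → M** → R^a → R^b.
  have hex := LinearMap.exact_lcomp_of_exact_of_surjective R hT hq
  have hinj := LinearMap.lcomp_injective_of_surjective (S := R) (N := R) q hq
  refine ⟨a, b, (Module.piEquiv (Fin a) R R).symm.toLinearMap ∘ₗ q.lcomp R R ∘ₗ
      (Module.evalEquiv R M).toLinearMap, (Module.piEquiv (Fin b) R R).symm.toLinearMap ∘ₗ
      T.lcomp R R ∘ₗ (Module.piEquiv (Fin a) R R).toLinearMap, ?_, ?_⟩
  · exact (Module.piEquiv (Fin a) R R).symm.injective.comp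
      (hinj.comp (Module.evalEquiv R M).injective)
  · intro y
    have h := hex (Module.piEquiv (Fin a) R R y)
    constructor
    · intro hy
      obtain ⟨x, hx⟩ := h.1 ((Module.piEquiv (Fin b) R R).symm.map_eq_zero_iff.1 hy)
      refine ⟨(Module.evalEquiv R M).symm x, ?_⟩
      change (Module.piEquiv (Fin a) R R).symm (q.lcomp R R (Module.evalEquiv R M _)) = y
      rw [LinearEquiv.apply_symm_apply, hx, LinearEquiv.symm_apply_apply]
    · rintro ⟨x, rfl⟩
      change (Module.piEquiv (Fin b) R R).symm (T.lcomp R R (Module.piEquiv (Fin a) R R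
        ((Module.piEquiv (Fin a) R R).symm (q.lcomp R R (Module.evalEquiv R M x))))) = 0
      rw [LinearEquiv.apply_symm_apply, hex.apply_apply_eq_zero, map_zero]

/-- Only the second-syzygy form of reflexivity is carried to the completion, and flatness preserves
it. -/
theorem Module.exists_exact_baseChange (B : Type u) [CommRing B] [Algebra R B] [Module.Flat R B]
    {a b : ℕ} {i : M →ₗ[R] (Fin a → R)} {g : (Fin a → R) →ₗ[R] (Fin b → R)}
    (hi : Function.Injective i) (hig : Function.Exact i g) :
    ∃ (i' : B ⊗[R] M →ₗ[B] (Fin a → B)) (g' : (Fin a → B) →ₗ[B] (Fin b → B)),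
      Function.Injective i' ∧ Function.Exact i' g' := by
  let ea := TensorProduct.piScalarRight R B B (Fin a)
  let eb := TensorProduct.piScalarRight R B B (Fin b)
  refine ⟨ea.toLinearMap ∘ₗ i.baseChange B, eb.toLinearMap ∘ₗ g.baseChange B ∘ₗ
    ea.symm.toLinearMap, ?_, ?_⟩
  · exact ea.injective.comp (LinearMap.baseChange_injective B hi)
  · intro y
    have h := LinearMap.baseChange_exact B hig (ea.symm y)
    constructor
    · intro hy
      obtain ⟨x, hx⟩ := h.1 (eb.map_eq_zero_iff.1 hy)
      exact ⟨x, by change ea (i.baseChange B x) = y; rw [hx, ea.apply_symm_apply]⟩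
    · rintro ⟨x, rfl⟩
      change eb (g.baseChange B (ea.symm (ea (i.baseChange B x)))) = 0
      rw [ea.symm_apply_apply, (LinearMap.baseChange_exact B hig).apply_apply_eq_zero, map_zero]

end dualPresentation

/-! ### Scalars acting through a free module -/

section factorization

variable (R : Type u) [CommRing R] (M : Type u) [AddCommGroup M] [Module R M]

variable {R M} in
lemma Module.SMulFactorsThroughFree.of_finite_free {F : Type u} [AddCommGroup F] [Module R F]
    [Module.Free R F] [Module.Finite R F] {r : R} (u : M →ₗ[R] F) (v : F →ₗ[R] M)
    (h : ∀ x, v (u x) = r • x) : SMulFactorsThroughFree R M r := by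
  let b := (Module.Free.chooseBasis R F).reindex (Fintype.equivFin _)
  exact ⟨_, b.equivFun.toLinearMap ∘ₗ u, v ∘ₗ b.equivFun.symm.toLinearMap, fun x => by simp [h]⟩

/-- The ideal of ring elements whose action on `M` factors through a finite free module. -/
def Module.smulFactorsIdeal : Ideal R where
  carrier := {r | SMulFactorsThroughFree R M r}
  zero_mem' := ⟨0, 0, 0, fun x => by simp⟩
  add_mem' := by
    rintro r s ⟨n, u, v, h⟩ ⟨n', u', v', h'⟩
    refine .of_finite_free (F := (Fin n → R) × (Fin n' → R)) (u.prod u') (v.coprod v') fun x => ?_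
    simp [h, h', add_smul]
  smul_mem' := by
    rintro c r ⟨n, u, v, h⟩
    exact ⟨n, c • u, v, fun x => by simp [h, smul_smul]⟩

variable {R M}

lemma Module.SMulFactorsThroughFree.baseChange (B : Type u) [CommRing B] [Algebra R B] {r : R}
    (h : SMulFactorsThroughFree R M r) :
    SMulFactorsThroughFree B (B ⊗[R] M) (algebraMap R B r) := by
  obtain ⟨n, u, v, h⟩ := h
  refine .of_finite_free (F := B ⊗[R] (Fin n → R)) (u.baseChange B) (v.baseChange B) fun x => ?_
  induction x with
  | zero => simp
  | add x y hx hy => simp only [map_add, hx, hy, smul_add]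
  | tmul b x => simp [h]

lemma Module.map_smulFactorsIdeal_le (B : Type u) [CommRing B] [Algebra R B] :
    (smulFactorsIdeal R M).map (algebraMap R B) ≤ smulFactorsIdeal B (B ⊗[R] M) :=
  Ideal.map_le_iff_le_comap.2 fun _ h => SMulFactorsThroughFree.baseChange B h

/-- The isomorphism of M_𝔭 with a free module and its inverse lift to maps u, v over R after
clearing denominators s₁, s₂. A third factor s₃ turns the local identity vu = s₂s₁ into an identity
on M. -/
lemma Module.exists_notMem_smulFactorsThroughFree [IsNoetherianRing R] [Module.Finite R M]
    {p : PrimeSpectrum R} (hp : p ∈ freeLocus R M) :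
    ∃ s, s ∉ p.asIdeal ∧ SMulFactorsThroughFree R M s := by
  have := mem_freeLocus.1 hp
  have : Module.FinitePresentation R M := Module.finitePresentation_of_finite R _
  let Rp := Localization.AtPrime p.asIdeal
  let T := p.asIdeal.primeCompl
  let f := LocalizedModule.mkLinearMap T M
  let b := (Module.Free.chooseBasis Rp (LocalizedModule T M)).reindex (Fintype.equivFin _)
  let e := b.equivFun.restrictScalars R
  set n := Fintype.card (Module.Free.ChooseBasisIndex Rp (LocalizedModule T M))
  let j : (Fin n → R) →ₗ[R] (Fin n → Rp) :=
    LinearMap.pi fun k => Algebra.linearMap R Rp ∘ₗ LinearMap.proj k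
  have hj : IsLocalizedModule T j := inferInstance
  obtain ⟨u, s₁, hu⟩ := Module.FinitePresentation.exists_lift_of_isLocalizedModule T j
    (e.toLinearMap ∘ₗ f)
  obtain ⟨v, s₂, hv⟩ := Module.FinitePresentation.exists_lift_of_isLocalizedModule T f
    (e.symm.toLinearMap ∘ₗ j)
  obtain ⟨s₃, hs⟩ := Module.Finite.exists_smul_of_comp_eq_of_isLocalizedModule T f (v ∘ₗ u)
    ((s₂ * s₁) • LinearMap.id) (by
      ext x
      have h1 := LinearMap.congr_fun hv (u x)
      have h2 := LinearMap.congr_fun hu x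
      simp only [LinearMap.comp_apply, LinearMap.smul_apply, LinearEquiv.coe_coe] at h1 h2 ⊢
      simp only [Submonoid.smul_def] at h1 h2 ⊢
      rw [h1, h2, map_smul, LinearEquiv.symm_apply_apply, smul_smul, map_smul]
      rfl)
  refine ⟨s₃ * (s₂ * s₁), (s₃ * (s₂ * s₁)).2, n, s₃.1 • u, v, fun x => ?_⟩
  have h := LinearMap.congr_fun hs x
  simp only [LinearMap.smul_apply, LinearMap.comp_apply, LinearMap.id_apply] at h
  rw [LinearMap.smul_apply, map_smul, mul_smul]
  exact h

/-- No prime other than 𝔪 contains the ideal of scalars acting through a free module, so 𝔪 lies in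
its radical. -/
theorem IsLocallyFreeOnPuncturedSpectrum.exists_pow_le [IsLocalRing R] [IsNoetherianRing R]
    [Module.Finite R M] (h : IsLocallyFreeOnPuncturedSpectrum R M) :
    ∃ k, maximalIdeal R ^ k ≤ smulFactorsIdeal R M := by
  refine Ideal.exists_pow_le_of_le_radical_of_fg ?_ (IsNoetherian.noetherian _)
  rw [Ideal.radical_eq_sInf]
  refine le_sInf fun p ⟨hle, hp⟩ => ?_
  by_contra hne
  obtain ⟨s, hs, hsf⟩ := Module.exists_notMem_smulFactorsThroughFree (p := ⟨p, hp⟩)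
    (h (a := ⟨p, hp⟩) fun hpc => hne (by
      have := congrArg PrimeSpectrum.asIdeal (Set.mem_singleton_iff.1 hpc)
      exact this.ge))
  exact hs (hle hsf)

end factorization

/-! ### Depth, dimension and freeness under completion -/

section depth

open RingTheory.Sequence

variable {A : Type u} [CommRing A] [IsLocalRing A] {M : Type u} [AddCommGroup M] [Module A M]

/-- A supremum of lengths that is at least n > 0 needs a sequence of length at least n, which is
then truncated. Weak regularity also allows n = 0 for the zero module. -/
lemma exists_isWeaklyRegular_of_le_localDepth {n : ℕ} (h : (n : ℕ∞) ≤ localDepth A M) :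
    ∃ rs : List A, rs.length = n ∧ (∀ r ∈ rs, r ∈ maximalIdeal A) ∧ IsWeaklyRegular M rs := by
  obtain rfl | hn := Nat.eq_zero_or_pos n
  · exact ⟨[], rfl, by simp, IsWeaklyRegular.nil _ _⟩
  by_contra! H
  have hle : localDepth A M ≤ ((n - 1 : ℕ) : ℕ∞) := by
    refine iSup_le fun rs => iSup_le fun hrs => iSup_le fun hreg => ?_
    by_contra hlt
    have hlen : n ≤ rs.length := by
      have := not_le.1 hlt
      norm_cast at this
      lia
    have hsplit := hreg.toIsWeaklyRegular
    rw [← List.take_append_drop n rs, isWeaklyRegular_append_iff] at hsplit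
    exact H (rs.take n) (by simp [hlen]) (fun r hr => hrs r (List.mem_of_mem_take hr)) hsplit.1
  have := h.trans hle
  norm_cast at this
  lia

end depth

section dimension

variable {A B : Type u} [CommRing A] [IsLocalRing A] [IsNoetherianRing A]
  [CommRing B] [IsLocalRing B] [IsNoetherianRing B] [Algebra A B] [Module.Flat A B]

/-- The dimension formula for flat local extensions, the closed fibre being a field. -/
lemma ringKrullDim_eq_of_flat_of_map_maximalIdeal
    (h : (maximalIdeal A).map (algebraMap A B) = maximalIdeal B) :
    ringKrullDim B = ringKrullDim A := by
  have : (maximalIdeal B).LiesOver (maximalIdeal A) := ⟨by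
    refine le_antisymm (Ideal.map_le_iff_le_comap.1 h.le) (le_maximalIdeal ?_)
    exact Ideal.comap_ne_top _ (Ideal.IsPrime.ne_top')⟩
  rw [← maximalIdeal_height_eq_ringKrullDim, ← maximalIdeal_height_eq_ringKrullDim,
    Ideal.height_eq_height_add_of_liesOver_of_hasGoingDown (maximalIdeal A) (maximalIdeal B), h,
    Ideal.map_quotient_self]
  have : Nontrivial (B ⧸ maximalIdeal B) := Ideal.Quotient.nontrivial_iff.2 Ideal.IsPrime.ne_top'
  have h0 : (⊥ : Ideal (B ⧸ maximalIdeal B)).height = 0 := by simp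
  rw [h0, add_zero]

end dimension

section descent

variable {A B : Type u} [CommRing A] [IsLocalRing A] [IsNoetherianRing A]
  [CommRing B] [IsLocalRing B] [Algebra A B] [Module.Flat A B] [IsLocalHom (algebraMap A B)]

/-- Flatness descends along the faithfully flat map, and a finitely presented flat module over a
local ring is free. -/
lemma Module.free_baseChange_iff (M : Type u) [AddCommGroup M] [Module A M] [Module.Finite A M] :
    Module.Free B (B ⊗[A] M) ↔ Module.Free A M := by
  refine ⟨fun _ => ?_, fun _ => inferInstance⟩
  have := Module.FaithfullyFlat.of_flat_of_isLocalHom (A := A) (B := B)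
  have : Module.Flat A M := Module.Flat.of_flat_tensorProduct A M B
  have : Module.FinitePresentation A M := Module.finitePresentation_of_finite A _
  exact Module.free_of_flat_of_isLocalRing

end descent

open scoped TensorProduct

namespace IsHypersurfaceQuotient

variable {S R : Type u} [CommRing S] [CommRing R] [Algebra S R] {f : S}

lemma ringKrullDim_add_one (hR : IsHypersurfaceQuotient S R f) :
    ringKrullDim R + 1 = ringKrullDim S := by
  have := hR.isRegularLocalRing
  have hker : RingHom.ker (algebraMap S R) = Ideal.span {f} := by
    ext s
    rw [RingHom.mem_ker, hR.algebraMap_eq_zero_iff, Ideal.mem_span_singleton]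
  rw [← ringKrullDim_eq_of_ringEquiv (RingHom.quotientKerEquivOfSurjective hR.surjective), hker]
  exact ringKrullDim_quotient_span_singleton_succ_eq_ringKrullDim_of_mem_nonZeroDivisors
    (mem_nonZeroDivisors_of_ne_zero hR.ne_zero) ((mem_maximalIdeal f).2 hR.not_isUnit)

lemma spanFinrank_eq_of_ringKrullDim_eq (hR : IsHypersurfaceQuotient S R f) {d : ℕ}
    (h : ringKrullDim R = d) :
    @Submodule.spanFinrank S S _ _ _ (@maximalIdeal S _ hR.isRegularLocalRing.toIsLocalRing) =
      d + 1 := by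
  have := hR.isRegularLocalRing
  have hS := hR.ringKrullDim_add_one
  rw [h, ← IsRegularLocalRing.spanFinrank_maximalIdeal] at hS
  exact_mod_cast hS.symm

end IsHypersurfaceQuotient

lemma IsLocalRing.exists_isPrime_ne_maximalIdeal {R : Type u} [CommRing R] [IsLocalRing R]
    (h : 0 < ringKrullDim R) : ∃ p : Ideal R, p.IsPrime ∧ p ≠ maximalIdeal R := by
  by_contra! H
  refine h.not_ge ?_
  have : Ring.KrullDimLE 0 R := Ring.KrullDimLE.mk₀ fun I hI => H I hI ▸ maximalIdeal.isMaximal R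
  exact (Ring.krullDimLE_iff (n := 0)).1 this

/-! ### Hom and its depth under flat base change -/

section

open RingTheory.Sequence

variable (A B : Type u) [CommRing A] [IsLocalRing A] [IsNoetherianRing A] [CommRing B]
  [Algebra A B] [Module.Flat A B]
  (M N : Type u) [AddCommGroup M] [Module A M] [AddCommGroup N] [Module A N] [Module.Finite A M]

/-- Formation of `Hom` from a finitely generated module commutes with flat base change. -/
noncomputable def LinearMap.homBaseChangeEquiv :
    B ⊗[A] (M →ₗ[A] N) ≃ₗ[B] (B ⊗[A] M →ₗ[B] B ⊗[A] N) :=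
  have : Module.FinitePresentation A M := Module.finitePresentation_of_finite A _
  (Module.FinitePresentation.isBaseChange_map A M N B).equiv

noncomputable def Module.dualBaseChangeEquiv :
    B ⊗[A] Dual A M ≃ₗ[B] Dual B (B ⊗[A] M) :=
  (LinearMap.homBaseChangeEquiv A B M A).trans
    ((TensorProduct.AlgebraTensorModule.rid A B B).congrRight)

variable {A M N}

/-- Hom commutes with flat base change, and a weakly regular sequence stays weakly regular under it.
-/
lemma IsMaximalCohenMacaulay.subsingleton_or_exists_isWeaklyRegular [IsLocalRing B]
    [IsLocalHom (algebraMap A B)] {d : ℕ} (hA : ringKrullDim A = d)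
    (h : IsMaximalCohenMacaulay A (M →ₗ[A] N)) :
    Subsingleton (B ⊗[A] M →ₗ[B] B ⊗[A] N) ∨ ∃ rs : List B, rs.length = d ∧
      (∀ r ∈ rs, r ∈ maximalIdeal B) ∧ IsWeaklyRegular (B ⊗[A] M →ₗ[B] B ⊗[A] N) rs := by
  let e := LinearMap.homBaseChangeEquiv A B M N
  obtain hs | hdepth := h.2
  · exact .inl e.symm.toEquiv.subsingleton
  · rw [hA] at hdepth
    have hdepth : localDepth A (M →ₗ[A] N) = d := by exact_mod_cast hdepth
    obtain ⟨rs, hlen, hrs, hreg⟩ := exists_isWeaklyRegular_of_le_localDepth hdepth.ge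
    refine .inr ⟨rs.map (algebraMap A B), by simpa using hlen, ?_, ?_⟩
    · intro r hr
      obtain ⟨s, hs, rfl⟩ := List.mem_map.1 hr
      exact (map_mem_nonunits_iff (algebraMap A B) s).2 (hrs s hs)
    · exact (e.isWeaklyRegular_congr _).1
        (hreg.of_flat_of_isBaseChange (TensorProduct.isBaseChange A (M →ₗ[A] N) B))

end

/-- The theta invariant of reflexive modules over a three-dimensional hypersurface, in terms of a
periodic resolution; no module structure over the regular ring is required. -/
theorem IsHypersurfaceQuotient.exists_isExactPair_of_isWeaklyRegular {S R : Type u} [CommRing S]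
    [CommRing R] [Algebra S R] {f : S} [IsLocalRing R] [IsNoetherianRing R]
    (hR : IsHypersurfaceQuotient S R f) (hd : ringKrullDim R = 3)
    {M N : Type u} [AddCommGroup M] [Module R M] [AddCommGroup N] [Module R N]
    [Module.Finite R M] [Module.Finite R N] {a b a' b' k : ℕ}
    {i : M →ₗ[R] (Fin a → R)} {g : (Fin a → R) →ₗ[R] (Fin b → R)}
    (hi : Function.Injective i) (hig : Function.Exact i g)
    {i' : N →ₗ[R] (Fin a' → R)} {g' : (Fin a' → R) →ₗ[R] (Fin b' → R)}
    (hi' : Function.Injective i') (hig' : Function.Exact i' g')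
    (hkM : ∀ r ∈ maximalIdeal R ^ k, SMulFactorsThroughFree R M r)
    (hkN : ∀ r ∈ maximalIdeal R ^ k, SMulFactorsThroughFree R N r)
    (hMN : Subsingleton (M →ₗ[R] N) ∨ ∃ rs : List R, rs.length = 3 ∧
      (∀ r ∈ rs, r ∈ maximalIdeal R) ∧ RingTheory.Sequence.IsWeaklyRegular (M →ₗ[R] N) rs) :
    ∃ (c n : ℕ) (ε : (Fin c → R) →ₗ[R] N) (ι : (Fin n → R) →ₗ[R] (Fin c → R))
      (φ ψ : Matrix (Fin n) (Fin n) R), Function.Surjective ε ∧ Function.Exact ι ε ∧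
      Function.Exact φ.mulVecLin ι ∧ IsExactPair φ ψ ∧ HasFiniteHomology φ ψ ∧
      pairTheta φ ψ (Dual R M) ≤ 0 ∧
      (pairTheta φ ψ (Dual R M) = 0 ↔ Module.Free R M ∨ Module.Free R N) := by
  let : Module S M := Module.compHom M (algebraMap S R)
  let : Module S N := Module.compHom N (algebraMap S R)
  have : IsScalarTower S R M := .of_algebraMap_smul fun _ _ => rfl
  have : IsScalarTower S R N := .of_algebraMap_smul fun _ _ => rfl
  have := hR.isRegularLocalRing
  have hS : (maximalIdeal S).spanFinrank = 4 := hR.spanFinrank_eq_of_ringKrullDim_eq (d := 3) hd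
  refine hR.exists_isExactPair_pairTheta_nonpos hS
    (IsLocalRing.exists_isPrime_ne_maximalIdeal (by rw [hd]; norm_num)) hi hig hi' hig' hkM hkN ?_
  obtain hs | ⟨rs, hlen, hrs, hreg⟩ := hMN
  · exact ProjDimLT.of_subsingleton 2
  · exact hR.projDimLT_of_isWeaklyRegular (by rw [hS, hlen]) hrs hreg

/-! ### Descent from the completion -/

section

variable {A B S : Type u} [CommRing A] [IsLocalRing A] [IsNoetherianRing A]
  [CommRing B] [IsLocalRing B] [Algebra A B] [Module.Flat A B] [IsLocalHom (algebraMap A B)]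
  [CommRing S] [Algebra S B] {f : S}

/-- The closed fibre of A → B is the residue field of B, of length 1, so positive-degree Tor lengths
over A equal those over B, where the periodic resolution lives. -/
theorem IsHypersurfaceQuotient.exists_hasHochsterTheta (hB : IsHypersurfaceQuotient S B f)
    (hmap : (maximalIdeal A).map (algebraMap A B) = maximalIdeal B) (hdim : ringKrullDim A = 3)
    (M N : Type u) [AddCommGroup M] [Module A M] [AddCommGroup N] [Module A N]
    [Module.Finite A M] [Module.Finite A N]
    [Module.IsReflexive A M] [Module.IsReflexive A N]
    (hM : IsLocallyFreeOnPuncturedSpectrum A M) (hN : IsLocallyFreeOnPuncturedSpectrum A N)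
    (hMN : IsMaximalCohenMacaulay A (M →ₗ[A] N)) :
    ∃ t : ℤ, HasHochsterTheta A (Module.Dual A M) N t ∧
      t ≤ 0 ∧ (t = 0 ↔ Module.Free A M ∨ Module.Free A N) := by
  have := hB.isRegularLocalRing
  have := hB.isNoetherianRing
  have hdimB : ringKrullDim B = 3 := by
    rw [ringKrullDim_eq_of_flat_of_map_maximalIdeal hmap, hdim]
  obtain ⟨a, b, i, g, hi, hig⟩ := Module.exists_exact_of_isReflexive A M
  obtain ⟨a', b', i', g', hi', hig'⟩ := Module.exists_exact_of_isReflexive A N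
  obtain ⟨iB, gB, hiB, higB⟩ := Module.exists_exact_baseChange B hi hig
  obtain ⟨iB', gB', hiB', higB'⟩ := Module.exists_exact_baseChange B hi' hig'
  obtain ⟨k, hk⟩ := hM.exists_pow_le
  obtain ⟨k', hk'⟩ := hN.exists_pow_le
  have hpow : ∀ (X : Type u) [AddCommGroup X] [Module A X] (l : ℕ), l ≤ max k k' →
      maximalIdeal A ^ l ≤ smulFactorsIdeal A X → ∀ r ∈ maximalIdeal B ^ max k k',
        SMulFactorsThroughFree B (B ⊗[A] X) r := by
    intro X _ _ l hl hX r hr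
    refine Module.map_smulFactorsIdeal_le B (Ideal.map_mono hX ?_)
    rw [Ideal.map_pow, hmap]
    exact Ideal.pow_le_pow_right hl hr
  obtain ⟨c, n, ε, ι, φ, ψ, hε, hιε, hφι, hφψ, hfin, hle, hiff⟩ :=
    hB.exists_isExactPair_of_isWeaklyRegular hdimB hiB higB hiB' higB'
      (hpow M k (le_max_left _ _) hk) (hpow N k' (le_max_right _ _) hk')
      (hMN.subsingleton_or_exists_isWeaklyRegular B (d := 3) hdim)
  have hlen : Module.length B (B ⧸ (maximalIdeal A).map (algebraMap A B)) = 1 := by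
    rw [hmap, Module.length_eq_one_iff]
    exact isSimpleModule_iff_isCoatom.2 (maximalIdeal.isMaximal B).out
  have htor : ∀ j, torLength A (Dual A M) N (j + 1) =
      torLength B (Dual B (B ⊗[A] M)) (B ⊗[A] N) (j + 1) := by
    intro j
    rw [← torLength_congr (Module.dualBaseChangeEquiv A B M), torLength_baseChange, hlen,
      mul_one]
  refine ⟨pairTheta φ ψ (Dual B (B ⊗[A] M)), ?_, hle, ?_⟩
  · intro e he
    -- From 2e ≥ 3 the odd degree 2e + 1 lies beyond 1, in the periodic range.
    have he2 : 2 ≤ e := by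
      rw [hdim] at he
      have : 3 ≤ 2 * e := by exact_mod_cast he
      lia
    obtain ⟨e, rfl⟩ : ∃ e', e = e' + 1 := ⟨e - 1, by lia⟩
    obtain ⟨h1, h2⟩ := hfin (Dual B (B ⊗[A] M))
    refine ⟨_, _, ?_, ?_, rfl⟩
    · rw [htor, hφψ.torLength_even hε hιε hφι]
      exact (ENat.natCast_toNat h1).symm
    · rw [htor, hφψ.torLength_odd hε hιε hφι]
      exact (ENat.natCast_toNat h2).symm
  · rw [hiff, Module.free_baseChange_iff, Module.free_baseChange_iff]

end

theorem mainTheorem8 (A : Type u) [CommRing A] [IsLocalRing A]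
    (hA : IsAbstractHypersurface A) (hdim : ringKrullDim A = 3)
    (M N : Type u) [AddCommGroup M] [Module A M] [AddCommGroup N] [Module A N]
    [Module.Finite A M] [Module.Finite A N]
    [Module.IsReflexive A M] [Module.IsReflexive A N]
    (hM : IsLocallyFreeOnPuncturedSpectrum A M) (hN : IsLocallyFreeOnPuncturedSpectrum A N)
    (hMN : IsMaximalCohenMacaulay A (M →ₗ[A] N)) :
    ∃ t : ℤ, HasHochsterTheta A (Module.Dual A M) N t ∧
      t ≤ 0 ∧ (t = 0 ↔ Module.Free A M ∨ Module.Free A N) := by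
  obtain ⟨_, S, _, hS, f, hf, hfu, ⟨e⟩⟩ := hA
  let B := AdicCompletion (maximalIdeal A) A
  let : Algebra S B := (e.symm.toRingHom.comp (Ideal.Quotient.mk (Ideal.span {f}))).toAlgebra
  have hB : IsHypersurfaceQuotient S B f :=
    { isRegularLocalRing := hS
      surjective := e.symm.surjective.comp Ideal.Quotient.mk_surjective
      algebraMap_eq_zero_iff := fun s => by
        change e.symm (Ideal.Quotient.mk (Ideal.span {f}) s) = 0 ↔ f ∣ s
        rw [EmbeddingLike.map_eq_zero_iff, Ideal.Quotient.eq_zero_iff_dvd]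
      ne_zero := hf
      not_isUnit := hfu }
  exact hB.exists_hasHochsterTheta (AdicCompletion.maximalIdeal_eq_map (R := A)).symm hdim M N
    hM hN hMN
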